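/- Let $\mathbb T=\mathbb R/2\pi\mathbb Z$. For $f\in L^2(\mathbb R\times\mathbb T)$ (complex valued) let $\widehat f(\xi,\eta)=\int_{\mathbb T}\int_{\mathbb R} f(x,y)e^{-ix\xi-iy\eta}\,dx\,dy$ ($\xi\in\mathbb R$, $\eta\in\mathbb Z$), extended to $L^2$ by Plancherel. Let $U(t)$, $t\in\mathbb R$, be the unitary group on $L^2(\mathbb R\times\mathbb T)$ given by $$\widehat{U(t)f}(\xi,\eta)=e^{it\omega(\xi,\eta)}\widehat f(\xi,\eta),\qquad \omega(\xi,\eta)=\operatorname{sgn}(\xi)\,(\xi^2+\eta^2),$$ and let $\mathcal H_x$ be the Hilbert transform in $x$, $\widehat{\mathcal H_xf}(\xi,\eta)=-i\operatorname{sgn}(\xi)\widehat f(\xi,\eta)$. For $s\ge 0$ let $H^{s,0}(\mathbb R\times\mathbb T)$ be the space of $f\in L^2(\mathbb R\times\mathbb T)$ with $\sum_{\eta\in\mathbb Z}\int_{\mathbb R}(1+\xi^2)^{s}|\widehat f(\xi,\eta)|^2\,d\xi<\infty$, and let $L^2(|x|^{2\theta}\,dx\,dy)$ be the $L^2$-space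 on $\mathbb R\times\mathbb T$ with respect to the measure $|x|^{2\theta}\,dx\,dy$. Let $k\ge 0$ be an integer, and let $f\in H^{k+\frac12,0}(\mathbb R\times\mathbb T)\cap L^2(|x|^{2(k+\frac12)}\,dx\,dy)$ (so that $x^kf\in L^2(\mathbb R\times\mathbb T)$). Assume that for some fixed $t\neq0$, $U(t)f\in L^2(|x|^{2(k+\frac12)}\,dx\,dy)$. (i) If $k=0$ or $k=1$, then $$U(t)\mathcal H_x(x^kf)\in L^2(|x|\,dx\,dy)\iff \mathcal H_x(x^kf)\in L^2(|x|\,dx\,dy).$$ (ii) If $k\ge2$, then $x^{k-2}f$ is integrable on $\mathbb R\times\mathbb T$, and $$U(t)(x^kf)\in L^2(|x|\,dx\,dy)\iff \int_{\mathbb T}\int_{\mathbb R}e^{-i\eta y}x^{k-2}f(x,y)\,dx\,dy=0\ \text{ for all }\eta\in\mathbb Z.$$ Moreover, assuming either of these two (equivalent) conditions, $$U(t)\mathcal H_x(x^kf)\in L^2(|x|\,dx\,dy)\iff \mathcal H_x(x^kf)\in L^2(|x|\,dx\,dy).$$ -/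

import Mathlib

open MeasureTheory
open scoped FourierTransform

instance fact_two_pi_pos : Fact (0 < 2 * Real.pi) := ⟨Real.two_pi_pos⟩

noncomputable section

namespace Cylinder

/-- The cylinder `ℝ × 𝕋`, where `𝕋 = ℝ / 2πℤ`. Its `volume` is `dx dy`, with total mass `2π` in `y`. -/
abbrev Cyl : Type := ℝ × AddCircle (2 * Real.pi)

/-- The space `L²(ℝ × 𝕋)` of complex valued functions. -/
abbrev L2Cyl : Type := Lp ℂ 2 (volume : Measure Cyl)

/-- The space `L²(ℝ)` of complex valued functions. -/
abbrev L2Line : Type := Lp ℂ 2 (volume : Measure ℝ)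

/-- The measure `|x|^{2θ} dx dy` on the cylinder. The space `L²(|x|^{2θ} dx dy)` consists of the
functions `f` with `MemLp f 2 (weight θ)`. -/
def weight (θ : ℝ) : Measure Cyl :=
  (volume : Measure Cyl).withDensity (fun p => ENNReal.ofReal (|p.1| ^ (2 * θ)))

/-! ### The Fourier transform on the cylinder -/

/-- The `η`-th Fourier coefficient in the periodic variable, `x ↦ ∫_𝕋 e^{-iηy} f(x,y) dy`. -/
def yCoeff (f : Cyl → ℂ) (η : ℤ) (x : ℝ) : ℂ :=
  ∫ y : AddCircle (2 * Real.pi), fourier (-η) y * f (x, y)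

theorem memLp_yCoeff {f : Cyl → ℂ} (hf : MemLp f 2 (volume : Measure Cyl)) (η : ℤ) :
    MemLp (yCoeff f η) 2 (volume : Measure ℝ) := by
  have hmeas : AEStronglyMeasurable (fun p : Cyl => fourier (-η) p.2 * f p)
      ((volume : Measure ℝ).prod (volume : Measure (AddCircle (2 * Real.pi)))) := by
    refine AEStronglyMeasurable.mul ?_ hf.1
    exact ((fourier (-η)).continuous.comp continuous_snd).aestronglyMeasurable
  refine ⟨hmeas.integral_prod_right', ?_⟩
  rw [eLpNorm_lt_top_iff_lintegral_rpow_enorm_lt_top (by norm_num) (by norm_num)]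
  have hf2 := hf.2
  rw [eLpNorm_lt_top_iff_lintegral_rpow_enorm_lt_top (by norm_num) (by norm_num),
    Measure.volume_eq_prod, lintegral_prod _ (hf.1.enorm.pow_const _)] at hf2
  have hfib : ∀ᵐ x : ℝ, AEStronglyMeasurable (fun y => f (x, y))
      (volume : Measure (AddCircle (2 * Real.pi))) := hf.1.prodMk_left
  set M : ENNReal := (volume (Set.univ : Set (AddCircle (2 * Real.pi)))) ^ (2⁻¹ : ℝ) with hM
  have hMtop : M ≠ ⊤ := ENNReal.rpow_ne_top_of_nonneg (by norm_num) (measure_ne_top _ _)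
  have key : ∀ᵐ x : ℝ, ‖yCoeff f η x‖ₑ ^ (2 : ℝ) ≤ M ^ (2 : ℝ) * ∫⁻ y, ‖f (x, y)‖ₑ ^ (2 : ℝ) := by
    filter_upwards [hfib] with x hx
    have h1 : ‖yCoeff f η x‖ₑ ≤ eLpNorm (fun y => f (x, y)) 1 volume := by
      rw [eLpNorm_one_eq_lintegral_enorm]
      refine (enorm_integral_le_lintegral_enorm _).trans (lintegral_mono fun y => ?_)
      rw [enorm_mul]
      have : ‖(fourier (-η) y : ℂ)‖ₑ = 1 := by
        rw [← ofReal_norm, fourier_apply, Circle.norm_coe, ENNReal.ofReal_one]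
      rw [this, one_mul]
    have h2 := eLpNorm_le_eLpNorm_mul_rpow_measure_univ (p := 1) (q := 2) (by norm_num) hx
    have h3 : ‖yCoeff f η x‖ₑ ≤ eLpNorm (fun y => f (x, y)) 2 volume * M := by
      refine h1.trans (h2.trans_eq ?_)
      rw [hM]; norm_num
    refine (ENNReal.rpow_le_rpow h3 (by norm_num : (0 : ℝ) ≤ 2)).trans_eq ?_
    rw [ENNReal.mul_rpow_of_nonneg _ _ (by norm_num), mul_comm,
      eLpNorm_eq_lintegral_rpow_enorm_toReal (by norm_num) (by norm_num)]
    simp only [ENNReal.toReal_ofNat, ← ENNReal.rpow_mul]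
    rw [one_div, inv_mul_cancel₀ (by norm_num), ENNReal.rpow_one]
  simp only [ENNReal.toReal_ofNat] at hf2 ⊢
  refine (lintegral_mono_ae key).trans_lt ?_
  rw [lintegral_const_mul' _ _ (ENNReal.rpow_ne_top_of_nonneg (by norm_num) hMtop)]
  exact ENNReal.mul_lt_top (ENNReal.rpow_lt_top_of_nonneg (by norm_num) hMtop) hf2

/-- The `η`-th Fourier coefficient in `y` of an `L²` function, as an element of `L²(ℝ)`. -/
def coeffL2 (f : L2Cyl) (η : ℤ) : L2Line :=
  (memLp_yCoeff (Lp.memLp f) η).toLp (yCoeff f η)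

/-- The Fourier transform on the cylinder. Mathlib's `𝓕` on `L²(ℝ)` is
`∫ e^{-2πixξ} g(x) dx` (extended to `L²` by continuity), so that
`cylFourier f η (ξ / 2π) = ∫_𝕋 ∫_ℝ f(x,y) e^{-ixξ-iyη} dx dy`. -/
def cylFourier (f : L2Cyl) (η : ℤ) : L2Line := 𝓕 (coeffL2 f η)

theorem memLp_mode (g : L2Line) (η : ℤ) :
    MemLp (fun p : Cyl => g p.1 * fourier η p.2) 2 (volume : Measure Cyl) := by
  have h : MemLp (fun p : Cyl => g p.1) 2 (volume : Measure Cyl) :=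
    (Lp.memLp g).comp_fst (volume : Measure (AddCircle (2 * Real.pi)))
  refine MemLp.of_le h (h.1.mul
    ((fourier η).continuous.comp continuous_snd).aestronglyMeasurable)
    (Filter.Eventually.of_forall fun p => ?_)
  rw [norm_mul, fourier_apply, Circle.norm_coe, mul_one]

/-- The function `(x,y) ↦ g(x) e^{iηy}` in `L²(ℝ × 𝕋)`. -/
def mode (g : L2Line) (η : ℤ) : L2Cyl := (memLp_mode g η).toLp _

/-! ### Fourier multipliers -/

theorem memLp_freqMul {m : ℝ → ℂ} (hm : Measurable m) (hb : ∀ ξ, ‖m ξ‖ ≤ 1) (g : L2Line) :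
    MemLp (fun ξ => m ξ * g ξ) 2 (volume : Measure ℝ) := by
  refine MemLp.of_le (Lp.memLp g) (hm.aestronglyMeasurable.mul (Lp.aestronglyMeasurable g))
    (Filter.Eventually.of_forall fun ξ => ?_)
  rw [norm_mul]
  exact mul_le_of_le_one_left (norm_nonneg _) (hb ξ)

/-- Multiplication of a function in `L²(ℝ)` by a bounded measurable function. -/
def freqMul (m : ℝ → ℂ) (hm : Measurable m) (hb : ∀ ξ, ‖m ξ‖ ≤ 1) (g : L2Line) : L2Line :=
  (memLp_freqMul hm hb g).toLp _

/-- The Fourier multiplier with symbol `m`, `‖m‖ ≤ 1`, on `L²(ℝ × 𝕋)`: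
`(2π)⁻² ∑_η ∫ e^{ixξ+iyη} m(ξ,η) f̂(ξ,η) dξ`. (One factor `(2π)⁻¹` is written; the other one is
contained in `𝓕⁻`, after the change of variables `ξ ↦ 2πξ`.) The series converges in
`L²`, see `summable_multiplier`, and the Fourier transform of the result is `m f̂`,
see `cylFourier_multiplier`. -/
def multiplier (m : ℝ → ℤ → ℂ) (hm : ∀ η, Measurable fun ξ => m ξ η)
    (hb : ∀ ξ η, ‖m ξ η‖ ≤ 1) (f : L2Cyl) : L2Cyl :=
  ∑' η : ℤ, ((2 * Real.pi : ℝ) : ℂ)⁻¹ •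
    mode (𝓕⁻ (freqMul (fun ξ => m (2 * Real.pi * ξ) η)
      ((hm η).comp (measurable_const_mul _)) (fun _ => hb _ η) (cylFourier f η))) η

theorem coe_mode (g : L2Line) (η : ℤ) :
    mode g η =ᵐ[volume] fun p : Cyl => g p.1 * fourier η p.2 := MemLp.coeFn_toLp _

theorem integral_fourier_mul (η η' : ℤ) :
    ∫ y : AddCircle (2 * Real.pi), (starRingEnd ℂ) (fourier η y) * fourier η' y =
      if η = η' then ((2 * Real.pi : ℝ) : ℂ) else 0 := by
  have h := fourierCoeff_fourier (T := 2 * Real.pi) η'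
  have h2 := congrFun h η
  rw [fourierCoeff, AddCircle.integral_haarAddCircle] at h2
  have hpi : (2 * Real.pi : ℝ) ≠ 0 := Real.two_pi_pos.ne'
  have h3 : (∫ y : AddCircle (2 * Real.pi), (starRingEnd ℂ) (fourier η y) * fourier η' y)
      = (2 * Real.pi : ℝ) • ((2 * Real.pi : ℝ)⁻¹ •
        ∫ y : AddCircle (2 * Real.pi), fourier (-η) y • (fourier η' y : ℂ)) := by
    rw [smul_inv_smul₀ hpi]
    simp only [fourier_neg, smul_eq_mul]
  rw [h3, h2]
  by_cases he : η = η'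
  · subst he; simp
  · simp [he]

theorem inner_mode_left (g : L2Line) (η : ℤ) (f : L2Cyl) :
    inner ℂ (mode g η) f = inner ℂ g (coeffL2 f η) := by
  rw [L2.inner_def, L2.inner_def]
  have hint : Integrable (fun p : Cyl => inner ℂ (mode g η p) (f p)) volume :=
    L2.integrable_inner _ _
  have hae : (fun p : Cyl => inner ℂ (mode g η p) (f p)) =ᵐ[(volume : Measure ℝ).prod volume]
      fun p => inner ℂ (g p.1 * fourier η p.2) (f p) := by
    filter_upwards [coe_mode g η] with p hp
    rw [hp]
  refine (integral_congr_ae hae).trans ((integral_prod _ (hint.congr hae)).trans ?_)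
  refine integral_congr_ae ?_
  filter_upwards [MemLp.coeFn_toLp (memLp_yCoeff (Lp.memLp f) η)] with x hx
  have : (coeffL2 f η : ℝ → ℂ) x = yCoeff f η x := hx
  rw [this, yCoeff, RCLike.inner_apply, ← integral_mul_const]
  refine integral_congr_ae (Filter.Eventually.of_forall fun y => ?_)
  simp only [RCLike.inner_apply, map_mul, fourier_neg]
  ring

theorem inner_mode_mode (g h : L2Line) (η η' : ℤ) :
    inner ℂ (mode g η) (mode h η') =
      if η = η' then ((2 * Real.pi : ℝ) : ℂ) * inner ℂ g h else 0 := by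
  rw [L2.inner_def, L2.inner_def]
  have hae : (fun p : Cyl => inner ℂ (mode g η p) (mode h η' p))
      =ᵐ[(volume : Measure ℝ).prod volume]
      fun p => inner ℂ (g p.1) (h p.1) *
        ((starRingEnd ℂ) (fourier η p.2) * fourier η' p.2) := by
    filter_upwards [coe_mode g η, coe_mode h η'] with p hp hp'
    rw [hp, hp']
    simp only [RCLike.inner_apply, map_mul]
    ring
  refine (integral_congr_ae hae).trans ((integral_prod_mul (fun x => inner ℂ (g x) (h x))
    (fun y => (starRingEnd ℂ) (fourier η y) * fourier η' y)).trans ?_)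
  rw [integral_fourier_mul]
  split_ifs <;> ring

theorem norm_mode_sq (g : L2Line) (η : ℤ) : ‖mode g η‖ ^ 2 = 2 * Real.pi * ‖g‖ ^ 2 := by
  have h := inner_mode_mode g g η η
  rw [if_pos rfl, inner_self_eq_norm_sq_to_K, inner_self_eq_norm_sq_to_K] at h
  apply Complex.ofReal_injective
  push_cast at h ⊢
  exact h

theorem summable_coeffL2 (f : L2Cyl) : Summable fun η : ℤ => ‖coeffL2 f η‖ ^ 2 := by
  refine summable_of_sum_le (c := 2 * Real.pi * ‖f‖ ^ 2) (fun η => by positivity) fun s => ?_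
  set S : ℝ := ∑ η ∈ s, ‖coeffL2 f η‖ ^ 2 with hS
  have hS0 : 0 ≤ S := Finset.sum_nonneg fun η _ => by positivity
  set v : L2Cyl := ∑ η ∈ s, mode (coeffL2 f η) η with hv
  have h1 : inner ℂ v f = (S : ℂ) := by
    rw [hv, sum_inner, hS]
    push_cast
    refine Finset.sum_congr rfl fun η _ => ?_
    rw [inner_mode_left, inner_self_eq_norm_sq_to_K]
    rfl
  have h2 : ‖v‖ ^ 2 = 2 * Real.pi * S := by
    have : inner ℂ v v = ((2 * Real.pi * S : ℝ) : ℂ) := by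
      conv_lhs => rw [hv]
      rw [sum_inner]
      simp_rw [inner_sum, inner_mode_mode]
      rw [hS]
      push_cast
      rw [Finset.mul_sum]
      refine Finset.sum_congr rfl fun η hη => ?_
      rw [Finset.sum_ite_eq, if_pos hη, inner_self_eq_norm_sq_to_K]
      simp
    rw [inner_self_eq_norm_sq_to_K] at this
    apply Complex.ofReal_injective
    push_cast at this ⊢
    exact this
  have h3 : S ≤ ‖v‖ * ‖f‖ := by
    have := norm_inner_le_norm (𝕜 := ℂ) v f
    rwa [h1, Complex.norm_real, Real.norm_of_nonneg hS0] at this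
  rcases hS0.eq_or_lt with h0 | h0
  · rw [← h0]; positivity
  · have h4 : S * S ≤ (2 * Real.pi * ‖f‖ ^ 2) * S := by
      calc S * S ≤ (‖v‖ * ‖f‖) * (‖v‖ * ‖f‖) := mul_self_le_mul_self hS0 h3
        _ = ‖v‖ ^ 2 * ‖f‖ ^ 2 := by ring
        _ = _ := by rw [h2]; ring
    exact le_of_mul_le_mul_right h4 h0

theorem norm_freqMul_le (m : ℝ → ℂ) (hm : Measurable m) (hb : ∀ ξ, ‖m ξ‖ ≤ 1) (g : L2Line) :
    ‖freqMul m hm hb g‖ ≤ ‖g‖ := by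
  refine Lp.norm_le_norm_of_ae_le ?_
  filter_upwards [MemLp.coeFn_toLp (memLp_freqMul hm hb g)] with ξ hξ
  have : (freqMul m hm hb g : ℝ → ℂ) ξ = m ξ * g ξ := hξ
  rw [this, norm_mul]
  exact mul_le_of_le_one_left (norm_nonneg _) (hb ξ)

theorem mode_add (g h : L2Line) (η : ℤ) : mode (g + h) η = mode g η + mode h η := by
  refine Lp.ext ?_
  have hadd : (fun p : Cyl => (g + h : L2Line) p.1) =ᵐ[volume] fun p : Cyl => g p.1 + h p.1 :=
    Measure.quasiMeasurePreserving_fst.ae_eq_comp (Lp.coeFn_add g h)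
  filter_upwards [coe_mode (g + h) η, coe_mode g η, coe_mode h η,
    Lp.coeFn_add (mode g η) (mode h η), hadd] with p h1 h2 h3 h4 h5
  rw [h1, h4, Pi.add_apply, h2, h3, h5]
  ring

theorem mode_smul (c : ℂ) (g : L2Line) (η : ℤ) : mode (c • g) η = c • mode g η := by
  refine Lp.ext ?_
  have hsm : (fun p : Cyl => (c • g : L2Line) p.1) =ᵐ[volume] fun p : Cyl => c • g p.1 :=
    Measure.quasiMeasurePreserving_fst.ae_eq_comp (Lp.coeFn_smul c g)
  filter_upwards [coe_mode (c • g) η, coe_mode g η, Lp.coeFn_smul c (mode g η), hsm]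
    with p h1 h2 h3 h4
  rw [h1, h3, Pi.smul_apply, h2, h4, smul_eq_mul, smul_eq_mul]
  ring

/-- The normalized map `g ↦ (2π)^{-1/2} g(x) e^{iηy}`, an isometry. -/
def modeIsometry (η : ℤ) : L2Line →ₗᵢ[ℂ] L2Cyl where
  toFun g := ((Real.sqrt (2 * Real.pi) : ℝ) : ℂ)⁻¹ • mode g η
  map_add' g h := by rw [mode_add, smul_add]
  map_smul' c g := by rw [mode_smul, smul_comm, RingHom.id_apply]
  norm_map' g := by
    change ‖((Real.sqrt (2 * Real.pi) : ℝ) : ℂ)⁻¹ • mode g η‖ = ‖g‖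
    have hpos : 0 < Real.sqrt (2 * Real.pi) := Real.sqrt_pos.mpr Real.two_pi_pos
    have h : ‖mode g η‖ = Real.sqrt (2 * Real.pi) * ‖g‖ := by
      rw [← Real.sqrt_sq (norm_nonneg (mode g η)), norm_mode_sq,
        Real.sqrt_mul Real.two_pi_pos.le, Real.sqrt_sq (norm_nonneg g)]
    rw [norm_smul, h, norm_inv, Complex.norm_real, Real.norm_of_nonneg hpos.le,
      inv_mul_cancel_left₀ hpos.ne']

theorem orthogonalFamily_mode :
    OrthogonalFamily ℂ (fun _ : ℤ => L2Line) modeIsometry := by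
  intro η η' hne g h
  change inner ℂ (((Real.sqrt (2 * Real.pi) : ℝ) : ℂ)⁻¹ • mode g η)
    (((Real.sqrt (2 * Real.pi) : ℝ) : ℂ)⁻¹ • mode h η') = 0
  rw [inner_smul_left, inner_smul_right, inner_mode_mode, if_neg hne]
  simp

theorem summable_mode {g : ℤ → L2Line} (hg : Summable fun η => ‖g η‖ ^ 2) :
    Summable fun η => mode (g η) η := by
  have h := (orthogonalFamily_mode.summable_iff_norm_sq_summable g).mpr hg
  have h2 := h.const_smul ((Real.sqrt (2 * Real.pi) : ℝ) : ℂ)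
  refine h2.congr fun η => ?_
  change ((Real.sqrt (2 * Real.pi) : ℝ) : ℂ) •
    (((Real.sqrt (2 * Real.pi) : ℝ) : ℂ)⁻¹ • mode (g η) η) = mode (g η) η
  refine smul_inv_smul₀ ?_ _
  exact_mod_cast (Real.sqrt_pos.mpr Real.two_pi_pos).ne'

theorem summable_multiplier (m : ℝ → ℤ → ℂ) (hm : ∀ η, Measurable fun ξ => m ξ η)
    (hb : ∀ ξ η, ‖m ξ η‖ ≤ 1) (f : L2Cyl) :
    Summable fun η : ℤ => ((2 * Real.pi : ℝ) : ℂ)⁻¹ •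
      mode (𝓕⁻ (freqMul (fun ξ => m (2 * Real.pi * ξ) η)
        ((hm η).comp (measurable_const_mul _)) (fun _ => hb _ η) (cylFourier f η))) η := by
  refine (summable_mode ?_).const_smul _
  refine (summable_coeffL2 f).of_nonneg_of_le (fun η => by positivity) fun η => ?_
  have h1 : ∀ g : L2Line, ‖𝓕⁻ g‖ = ‖g‖ := (Lp.fourierTransformₗᵢ ℝ ℂ).symm.norm_map
  have h2 : ‖cylFourier f η‖ = ‖coeffL2 f η‖ := Lp.norm_fourier_eq _
  rw [h1, ← h2]
  exact pow_le_pow_left₀ (norm_nonneg _) (norm_freqMul_le _ _ _ _) 2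

theorem cylFourier_multiplier (m : ℝ → ℤ → ℂ) (hm : ∀ η, Measurable fun ξ => m ξ η)
    (hb : ∀ ξ η, ‖m ξ η‖ ≤ 1) (f : L2Cyl) (η : ℤ) :
    cylFourier (multiplier m hm hb f) η =ᵐ[volume]
      fun ξ => m (2 * Real.pi * ξ) η * cylFourier f η ξ := by
  set G : ℤ → L2Line := fun η => freqMul (fun ξ => m (2 * Real.pi * ξ) η)
      ((hm η).comp (measurable_const_mul _)) (fun _ => hb _ η) (cylFourier f η) with hG
  have hc : coeffL2 (multiplier m hm hb f) η = 𝓕⁻ (G η) := by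
    refine ext_inner_left ℂ fun g => ?_
    rw [← inner_mode_left]
    have h := ((summable_multiplier m hm hb f).hasSum.mapL (innerSL ℂ (mode g η))).tsum_eq
    change _ = inner ℂ (mode g η) (multiplier m hm hb f) at h
    rw [← h, tsum_eq_single η]
    · rw [innerSL_apply_apply, inner_smul_right, inner_mode_mode, if_pos rfl,
        inv_mul_cancel_left₀]
      exact_mod_cast Real.two_pi_pos.ne'
    · intro η' hne
      rw [innerSL_apply_apply, inner_smul_right, inner_mode_mode, if_neg hne.symm, mul_zero]
  have : cylFourier (multiplier m hm hb f) η = G η := by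
    rw [cylFourier, hc, FourierTransform.fourier_fourierInv_eq]
  rw [this]
  exact MemLp.coeFn_toLp _

/-! ### The linear group, the Hilbert transform, Sobolev spaces and powers of `x` -/

/-- The dispersive symbol `ω(ξ,η) = sgn(ξ) ξ² + sgn(ξ) η²`. -/
def omega (ξ : ℝ) (η : ℤ) : ℝ := Real.sign ξ * ξ ^ 2 + Real.sign ξ * (η : ℝ) ^ 2

theorem measurable_sign : Measurable Real.sign := by
  unfold Real.sign
  exact Measurable.ite measurableSet_Iio measurable_const
    (Measurable.ite measurableSet_Ioi measurable_const measurable_const)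

theorem measurable_expOmega (t : ℝ) (η : ℤ) :
    Measurable fun ξ => Complex.exp (Complex.I * ((t * omega ξ η : ℝ) : ℂ)) := by
  have h : Measurable fun ξ => t * omega ξ η := by
    unfold omega
    have := measurable_sign
    fun_prop
  fun_prop

theorem norm_expOmega (t ξ : ℝ) (η : ℤ) :
    ‖Complex.exp (Complex.I * ((t * omega ξ η : ℝ) : ℂ))‖ ≤ 1 := by
  rw [mul_comm, Complex.norm_exp_ofReal_mul_I]

/-- The unitary group of `∂ₜ v - 𝓗ₓ ∂ₓ² v - 𝓗ₓ ∂_y² v = 0`, the multiplier `e^{itω(ξ,η)}`. -/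
def U (t : ℝ) (f : L2Cyl) : L2Cyl :=
  multiplier (fun ξ η => Complex.exp (Complex.I * ((t * omega ξ η : ℝ) : ℂ)))
    (measurable_expOmega t) (norm_expOmega t) f

theorem measurable_hilbertSymbol :
    Measurable fun ξ : ℝ => -Complex.I * ((Real.sign ξ : ℝ) : ℂ) := by
  have := measurable_sign
  fun_prop

theorem norm_hilbertSymbol (ξ : ℝ) : ‖-Complex.I * ((Real.sign ξ : ℝ) : ℂ)‖ ≤ 1 := by
  rcases Real.sign_apply_eq ξ with h | h | h <;> simp [h]

/-- The Hilbert transform in `x`, the multiplier `-i sgn(ξ)`. -/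
def hilbertX (f : L2Cyl) : L2Cyl :=
  multiplier (fun ξ _ => -Complex.I * ((Real.sign ξ : ℝ) : ℂ))
    (fun _ => measurable_hilbertSymbol) (fun ξ _ => norm_hilbertSymbol ξ) f

/-- For `s ≥ 0`, the condition that `f ∈ L²(ℝ × 𝕋)` belongs to `H^{s,0}(ℝ × 𝕋)`:
`∑_η ∫ (1 + ξ²)^s |f̂(ξ,η)|² dξ < ∞`, in the variable `2πξ` in place of `ξ`. -/
def MemSobolevX (s : ℝ) (f : L2Cyl) : Prop :=
  (∑' η : ℤ, ∫⁻ ξ : ℝ, ENNReal.ofReal ((1 + (2 * Real.pi * ξ) ^ 2) ^ s) *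
    ‖cylFourier f η ξ‖ₑ ^ 2) < ⊤

theorem memLp_powX (k : ℕ) (f : L2Cyl) (hf : MemLp f 2 (weight ((k : ℝ) + 1 / 2))) :
    MemLp (fun p : Cyl => (p.1 : ℂ) ^ k * f p) 2 (volume : Measure Cyl) := by
  set θ : ℝ := (k : ℝ) + 1 / 2 with hθ
  have hmeas : AEStronglyMeasurable (fun p : Cyl => |p.1| ^ θ * ‖f p‖) volume := by
    refine AEStronglyMeasurable.mul ?_ (Lp.aestronglyMeasurable f).norm
    have : Measurable fun p : Cyl => |p.1| ^ θ := by fun_prop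
    exact this.aestronglyMeasurable
  have hw : MemLp (fun p : Cyl => |p.1| ^ θ * ‖f p‖) 2 (volume : Measure Cyl) := by
    refine ⟨hmeas, ?_⟩
    have h := hf.2
    rw [eLpNorm_lt_top_iff_lintegral_rpow_enorm_lt_top (by norm_num) (by norm_num)] at h ⊢
    rw [weight, lintegral_withDensity_eq_lintegral_mul₀' (by fun_prop)
      (hf.1.enorm.pow_const _)] at h
    refine lt_of_le_of_lt (le_of_eq (lintegral_congr fun p => ?_)) h
    simp only [Pi.mul_apply, ENNReal.toReal_ofNat]
    rw [enorm_mul, enorm_norm, ENNReal.mul_rpow_of_nonneg _ _ (by norm_num),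
      Real.enorm_of_nonneg (by positivity), ENNReal.ofReal_rpow_of_nonneg (by positivity)
      (by norm_num), ← Real.rpow_mul (abs_nonneg _), mul_comm θ 2]
  refine MemLp.of_le (hw.add (Lp.memLp f).norm) ?_ (Filter.Eventually.of_forall fun p => ?_)
  · have : Measurable fun p : Cyl => (p.1 : ℂ) ^ k := by fun_prop
    exact this.aestronglyMeasurable.mul (Lp.aestronglyMeasurable f)
  · have h1 : |p.1| ^ k ≤ |p.1| ^ θ + 1 := by
      rcases le_total |p.1| 1 with h | h
      · have := pow_le_one₀ (n := k) (abs_nonneg p.1) h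
        have : 0 ≤ |p.1| ^ θ := by positivity
        linarith
      · have : |p.1| ^ (k : ℝ) ≤ |p.1| ^ θ :=
          Real.rpow_le_rpow_of_exponent_le h (by rw [hθ]; linarith)
        rw [Real.rpow_natCast] at this
        linarith
    rw [norm_mul, norm_pow, Complex.norm_real, Real.norm_eq_abs, Pi.add_apply,
      Real.norm_of_nonneg (by positivity)]
    calc |p.1| ^ k * ‖f p‖ ≤ (|p.1| ^ θ + 1) * ‖f p‖ := by gcongr
      _ = _ := by ring

/-- The function `x^k f`, an element of `L²(ℝ × 𝕋)` for `f ∈ L² ∩ L²(|x|^{2k+1} dx dy)`. -/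
def powX (k : ℕ) (f : L2Cyl) (hf : MemLp f 2 (weight ((k : ℝ) + 1 / 2))) : L2Cyl :=
  (memLp_powX k f hf).toLp _

end Cylinder

end

open Cylinder

namespace Cylinder
open scoped SchwartzMap ENNReal

/-! ### The Fourier transform on `L²(ℝ)` -/

/-! Expand in Fourier modes in `y` and take the Fourier transform in `x`. Membership in L²(|x|)
becomes finiteness of the sum over η of H^{1/2} seminorms of the transforms, written as Gagliardo
double integrals (`gagliardo_fourier`, `memLp_weight_half_iff`). For a family in H^{1/2},
multiplication by sgn stays in H^{1/2} exactly when the Hardy energy ∫|G|²/|ξ| is summable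
(`tsum_gagliardo_sign_mul_lt_top_iff`). This energy sees only |G|, so a unimodular phase does not
change it. As U(t) commutes with the Hilbert transform, the two Hilbert transform conditions are
equivalent as soon as g = x^k f and U(t)g both lie in L²(|x|) (`memLp_U_hilbertX_iff`).

It remains to decide when U(t)(x^k f) lies in L²(|x|). Let A_l and B_l be the l-th derivatives of
the transforms of f and U(t)f in a fixed mode. On each half-line the phase is a Gaussian, with
exponents ±aξ²/2 of opposite signs. Hence the transform of U(t)(x^k f) is, up to a constant, the
Leibniz sum P = ∑ (k choose l) q_{k-l} B_l for ξ > 0 and the same sum N with -a in place of a for ξ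
< 0. Both sums are in H^{1/2}: weights in position and in frequency together control all products
ξ^j x^l of total order at most k, which is proved on phase space with the short-time Fourier
transform (`BiWeighted.position_mul`). The glued function is (P+N)/2 + sgn·(P-N)/2, so the question
is whether P-N has finite Hardy energy (`tsum_gagliardo_glued_iff`).

Terms of P-N divisible by ξ are harmless. What is left is a constant-coefficient combination of the
B_l with l ≤ k-2, which is empty for k ≤ 1. Since the A_l are continuous at 0, matching the two
half-line expansions there forces B_l(0) = 0 for l ≤ k-3 (`DerivSeq.apply_zero_eq_zero`), so these
terms have finite energy. The term B_{k-2} then has finite energy if and only if it vanishes at 0,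
that is, if and only if the moment of order k-2 of that mode of f vanishes
(`tsum_hardyIntegral_leibnizDefect_iff`, `exists_profile`). -/

theorem integral_schwartz_mul_fourier (g : L2Line) (φ : 𝓢(ℝ, ℂ)) :
    ∫ x, φ x * (𝓕 g : L2Line) x = ∫ x, (𝓕 φ) x * g x := by
  have h := congrArg (fun T => T φ) (Lp.fourier_toTemperedDistribution_eq g)
  simp only [TemperedDistribution.fourier_apply, Lp.toTemperedDistribution_apply,
    smul_eq_mul] at h
  exact h.symm

theorem ae_eq_of_integral_schwartz_mul {f g : ℝ → ℂ} (hf : LocallyIntegrable f)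
    (hg : LocallyIntegrable g) (h : ∀ φ : 𝓢(ℝ, ℂ), ∫ x, φ x * f x = ∫ x, φ x * g x) :
    f =ᵐ[volume] g := by
  refine ae_eq_of_integral_contDiff_smul_eq hf hg fun φ hφ hc => ?_
  have hc' : HasCompactSupport fun x => (φ x : ℂ) := hc.comp_left Complex.ofReal_zero
  have hd : ContDiff ℝ (⊤ : ℕ∞) fun x => (φ x : ℂ) := Complex.ofRealCLM.contDiff.comp hφ
  exact h (hc'.toSchwartzMap hd)

/-- Reconciles the L² transform with the integral: tested against Schwartz functions, both move the
transform onto the test function. -/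
theorem fourier_toLp_ae {g : ℝ → ℂ} (h1 : Integrable g) (h2 : MemLp g 2 volume) :
    (𝓕 (h2.toLp g) : L2Line) =ᵐ[volume] 𝓕 g := by
  have hcont : Continuous (𝓕 g) := VectorFourier.fourierIntegral_continuous
    Real.continuous_fourierChar (innerSL ℝ (E := ℝ)).continuous₂ h1
  refine ae_eq_of_integral_schwartz_mul
    ((Lp.memLp (𝓕 (h2.toLp g) : L2Line)).locallyIntegrable one_le_two)
    hcont.locallyIntegrable fun φ => ?_
  rw [integral_schwartz_mul_fourier]
  have h3 : ∫ x, (𝓕 φ) x * (h2.toLp g) x = ∫ x, (𝓕 φ) x * g x := by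
    refine integral_congr_ae ?_
    filter_upwards [h2.coeFn_toLp] with x hx
    rw [hx]
  rw [h3]
  have := VectorFourier.integral_fourierIntegral_smul_eq_flip (L := innerₗ ℝ)
    (μ := volume) (ν := volume) Real.continuous_fourierChar (innerSL ℝ (E := ℝ)).continuous₂
    (φ.integrable (μ := volume)) h1
  rw [flip_innerₗ] at this
  simp only [smul_eq_mul] at this
  exact this

theorem lintegral_enorm_sq_fourier (g : L2Line) :
    ∫⁻ ξ, ‖(𝓕 g : L2Line) ξ‖ₑ ^ 2 = ∫⁻ x, ‖g x‖ₑ ^ 2 := by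
  have key : ∀ f : L2Line, ∫⁻ x, ‖f x‖ₑ ^ 2 = ‖f‖ₑ ^ 2 := fun f => by
    rw [Lp.enorm_def, eLpNorm_eq_lintegral_rpow_enorm_toReal (by norm_num) (by norm_num),
      ← ENNReal.rpow_natCast, ← ENNReal.rpow_mul]
    simp
  rw [key, key, ← ofReal_norm, ← ofReal_norm, Lp.norm_fourier_eq]

theorem lintegral_enorm_sq_fourier_integrable {g : ℝ → ℂ} (h1 : Integrable g)
    (h2 : MemLp g 2 volume) : ∫⁻ ξ, ‖𝓕 g ξ‖ₑ ^ 2 = ∫⁻ x, ‖g x‖ₑ ^ 2 := by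
  calc ∫⁻ ξ, ‖𝓕 g ξ‖ₑ ^ 2 = ∫⁻ ξ, ‖(𝓕 (h2.toLp g) : L2Line) ξ‖ₑ ^ 2 := by
        refine lintegral_congr_ae ?_
        filter_upwards [fourier_toLp_ae h1 h2] with ξ hξ
        rw [hξ]
    _ = _ := by
        rw [lintegral_enorm_sq_fourier]
        refine lintegral_congr_ae ?_
        filter_upwards [h2.coeFn_toLp] with ξ hξ
        rw [hξ]

theorem continuous_fourier_of_integrable {g : ℝ → ℂ} (h1 : Integrable g) : Continuous (𝓕 g) :=
  VectorFourier.fourierIntegral_continuous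
    Real.continuous_fourierChar (innerSL ℝ (E := ℝ)).continuous₂ h1

theorem fourier_compSubConst (φ : 𝓢(ℝ, ℂ)) (h x : ℝ) :
    (𝓕 (SchwartzMap.compSubConstCLM ℝ h φ)) x = (𝐞 (-(h * x)) : ℂ) * (𝓕 φ) x := by
  rw [SchwartzMap.fourier_coe, SchwartzMap.fourier_coe, mul_comm,
    Real.fourier_real_eq, Real.fourier_real_eq, ← integral_mul_const]
  refine ((integral_congr_ae (Filter.Eventually.of_forall fun v => ?_)).trans
    (integral_add_right_eq_self
      (fun v => 𝐞 (-(v * x)) • (SchwartzMap.compSubConstCLM ℝ h φ) v) h)).symm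
  simp only [SchwartzMap.compSubConstCLM_apply, add_sub_cancel_right, Circle.smul_def, smul_eq_mul]
  rw [show -((v + h) * x) = -(v * x) + -(h * x) by ring, AddChar.map_add_eq_mul, Circle.coe_mul]
  ring

/-- By duality the claim reduces to Schwartz functions, where translating a function modulates its
transform. -/
theorem fourier_modulation {p q : L2Line} (h : ℝ)
    (hq : q =ᵐ[volume] fun x => (𝐞 (-(h * x)) : ℂ) * p x) :
    (𝓕 q : L2Line) =ᵐ[volume] fun ξ => (𝓕 p : L2Line) (ξ + h) := by
  have hmp : MeasurePreserving (fun ξ : ℝ => ξ + h) volume volume :=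
    measurePreserving_add_right volume h
  refine ae_eq_of_integral_schwartz_mul
    ((Lp.memLp (𝓕 q : L2Line)).locallyIntegrable one_le_two)
    (((Lp.memLp (𝓕 p : L2Line)).comp_measurePreserving hmp).locallyIntegrable one_le_two)
    fun φ => ?_
  rw [integral_schwartz_mul_fourier]
  have h1 : ∫ ξ, φ ξ * (𝓕 p : L2Line) (ξ + h)
      = ∫ ξ, (SchwartzMap.compSubConstCLM ℝ h φ) ξ * (𝓕 p : L2Line) ξ := by
    rw [← integral_add_right_eq_self
      (fun ξ => (SchwartzMap.compSubConstCLM ℝ h φ) ξ * (𝓕 p : L2Line) ξ) h]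
    simp
  rw [h1, integral_schwartz_mul_fourier]
  refine integral_congr_ae ?_
  filter_upwards [hq] with x hx
  rw [hx, fourier_compSubConst]
  ring

/-! ### The Gagliardo form of the `H^{1/2}(ℝ)` seminorm -/

theorem enorm_sq_eq_ofReal (z : ℂ) : ‖z‖ₑ ^ 2 = ENNReal.ofReal (‖z‖ ^ 2) := by
  rw [← ofReal_norm, ENNReal.ofReal_pow (norm_nonneg _)]

/-- `∬ |G(b) - G(a)|² / (b - a)² da db`. -/
noncomputable def gagliardo (G : ℝ → ℂ) : ℝ≥0∞ :=
  ∫⁻ a, ∫⁻ b, ENNReal.ofReal (1 / (b - a) ^ 2) * ‖G b - G a‖ₑ ^ 2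

/-- `∫ |G(ξ)|² / |ξ| dξ`. -/
noncomputable def hardyIntegral (G : ℝ → ℂ) : ℝ≥0∞ := ∫⁻ ξ, ‖ξ‖ₑ⁻¹ * ‖G ξ‖ₑ ^ 2

theorem gagliardo_congr {G H : ℝ → ℂ} (h : G =ᵐ[volume] H) : gagliardo G = gagliardo H := by
  refine lintegral_congr_ae ?_
  filter_upwards [h] with a ha
  refine lintegral_congr_ae ?_
  filter_upwards [h] with b hb
  rw [ha, hb]

theorem hardyIntegral_congr {G H : ℝ → ℂ} (h : ∀ᵐ ξ, ‖G ξ‖ = ‖H ξ‖) :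
    hardyIntegral G = hardyIntegral H := by
  refine lintegral_congr_ae ?_
  filter_upwards [h] with a ha
  rw [enorm_sq_eq_ofReal, ha, enorm_sq_eq_ofReal]

/-- `∫ |e^{-2πiu} - 1|² / u² du`. -/
noncomputable def gagliardoConst : ℝ≥0∞ := ∫⁻ u : ℝ, ENNReal.ofReal (1 / u ^ 2) * ‖(𝐞 (-u) : ℂ) - 1‖ₑ ^ 2

theorem norm_fourierChar_sub_one_le (u : ℝ) : ‖(𝐞 (-u) : ℂ) - 1‖ ≤ 2 * Real.pi * |u| := by
  have h := Real.norm_exp_I_mul_ofReal_sub_one_le (x := 2 * Real.pi * (-u))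
  rw [Real.fourierChar_apply, mul_comm]
  refine h.trans_eq ?_
  rw [Real.norm_eq_abs, abs_mul, abs_neg, abs_of_pos Real.two_pi_pos]

theorem gagliardoConst_ne_top : gagliardoConst ≠ ⊤ := by
  -- Since |e^{-2πiu} - 1|² is at most both 4 and 40u² (as 4π² ≤ 40), multiplying it by 1 + u² gives
  -- at most 44u²; 80 is a safe constant.
  have hint : Integrable fun u : ℝ => 80 * (1 + u ^ 2)⁻¹ := integrable_inv_one_add_sq.const_mul _
  refine ne_top_of_le_ne_top hint.lintegral_lt_top.ne (lintegral_mono fun u => ?_)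
  rw [enorm_sq_eq_ofReal, ← ENNReal.ofReal_mul (by positivity)]
  refine ENNReal.ofReal_le_ofReal ?_
  rcases eq_or_ne u 0 with rfl | hu
  · norm_num
  have hu2 : 0 < u ^ 2 := by positivity
  have h1 := norm_fourierChar_sub_one_le u
  have h2 : ‖(𝐞 (-u) : ℂ) - 1‖ ≤ 2 := by
    refine (norm_sub_le _ _).trans ?_
    rw [Circle.norm_coe, norm_one]; norm_num
  have h0 := norm_nonneg ((𝐞 (-u) : ℂ) - 1)
  set N := ‖(𝐞 (-u) : ℂ) - 1‖
  have h3 : N ^ 2 ≤ 40 * u ^ 2 := by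
    have hpi : Real.pi ^ 2 ≤ 10 := by nlinarith [Real.pi_lt_d2, Real.pi_pos]
    calc N ^ 2 ≤ (2 * Real.pi * |u|) ^ 2 := pow_le_pow_left₀ h0 h1 2
      _ = 4 * Real.pi ^ 2 * u ^ 2 := by rw [mul_pow, mul_pow, sq_abs]; ring
      _ ≤ _ := by nlinarith
  have h4 : N ^ 2 ≤ 4 := by nlinarith
  rw [one_div, ← div_eq_inv_mul, ← div_eq_mul_inv, div_le_div_iff₀ hu2 (by positivity)]
  nlinarith

/-- The integrand vanishes only where e^{-2πiu} = 1 or u = 0, hence nowhere on (0,1). Being nonzero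
allows the constant to be cancelled when passing from Gagliardo energies back to weights. -/
theorem gagliardoConst_ne_zero : gagliardoConst ≠ 0 := by
  intro h
  have hm : Measurable fun u : ℝ => ENNReal.ofReal (1 / u ^ 2) * ‖(𝐞 (-u) : ℂ) - 1‖ₑ ^ 2 := by
    have : Measurable fun u : ℝ => (𝐞 (-u) : ℂ) := by
      have : Continuous fun u : ℝ => (𝐞 (-u) : ℂ) :=
        continuous_subtype_val.comp (Real.continuous_fourierChar.comp continuous_neg)
      exact this.measurable
    fun_prop
  rw [gagliardoConst, lintegral_eq_zero_iff hm] at h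
  have h2 : volume (Set.Ioo (0 : ℝ) 1) = 0 := by
    refine measure_mono_null (fun u hu => ?_) h
    simp only [Set.mem_compl_iff, Set.mem_ofPred_eq, Pi.zero_apply]
    intro h0
    rcases mul_eq_zero.mp h0 with h1 | h1
    · have : 0 < u ^ 2 := pow_pos hu.1 2
      rw [ENNReal.ofReal_eq_zero] at h1
      have : 0 < 1 / u ^ 2 := by positivity
      linarith
    · have h3 : (𝐞 (-u) : ℂ) - 1 = 0 := by simpa using h1
      rw [Real.fourierChar_apply, sub_eq_zero, Complex.exp_eq_one_iff] at h3
      obtain ⟨n, hn⟩ := h3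
      have h4 : ((-u : ℝ) : ℂ) = (n : ℂ) := by
        have hI : (2 * Real.pi * Complex.I : ℂ) ≠ 0 := by simp [Real.pi_ne_zero]
        apply mul_right_cancel₀ hI
        rw [← hn]; push_cast; ring
      have h5 : -u = (n : ℝ) := by exact_mod_cast h4
      have h6 : n < 0 := by
        have : (n : ℝ) < 0 := by rw [← h5]; linarith [hu.1]
        exact_mod_cast this
      have h7 : -1 < n := by
        have : (-1 : ℝ) < n := by rw [← h5]; linarith [hu.2]
        exact_mod_cast this
      omega
  rw [Real.volume_Ioo] at h2
  norm_num at h2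

/-- The substitution u = hx turns the kernel into the fixed one and leaves a factor x²/|x| = |x|. -/
theorem lintegral_gagliardo_kernel (x : ℝ) :
    ∫⁻ h : ℝ, ENNReal.ofReal (1 / h ^ 2) * ‖(𝐞 (-(h * x)) : ℂ) - 1‖ₑ ^ 2
      = gagliardoConst * ‖x‖ₑ := by
  rcases eq_or_ne x 0 with rfl | hx
  · simp
  set F : ℝ → ℝ≥0∞ := fun u => ENNReal.ofReal (1 / u ^ 2) * ‖(𝐞 (-u) : ℂ) - 1‖ₑ ^ 2 with hF
  have hm : Measurable F := by
    have : Measurable fun u : ℝ => (𝐞 (-u) : ℂ) := by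
      have : Continuous fun u : ℝ => (𝐞 (-u) : ℂ) :=
        continuous_subtype_val.comp (Real.continuous_fourierChar.comp continuous_neg)
      exact this.measurable
    fun_prop
  have h1 : ∀ h : ℝ, ENNReal.ofReal (1 / h ^ 2) * ‖(𝐞 (-(h * x)) : ℂ) - 1‖ₑ ^ 2
      = ENNReal.ofReal (x ^ 2) * F (h * x) := fun h => by
    rw [hF, ← mul_assoc, ← ENNReal.ofReal_mul (by positivity)]
    congr 2
    field_simp
  simp_rw [h1]
  rw [lintegral_const_mul _ (by fun_prop),
    ← lintegral_map (g := fun h : ℝ => h * x) hm (measurable_mul_const x), Real.map_volume_mul_right hx,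
    lintegral_smul_measure, smul_eq_mul, ← mul_assoc, ← ENNReal.ofReal_mul (by positivity),
    mul_comm, Real.enorm_eq_ofReal_abs, gagliardoConst]
  congr 2
  rw [abs_inv, ← sq_abs]
  have : |x| ≠ 0 := abs_ne_zero.mpr hx
  field_simp

/-- For each shift h, the increment of the transform is the transform of (e^{-2πihx} - 1)p.
Plancherel in the base point, Tonelli, and the kernel integral in h give the weight |x|. -/
theorem gagliardo_fourier (p : L2Line) :
    gagliardo (𝓕 p : L2Line) = gagliardoConst * ∫⁻ x, ‖x‖ₑ * ‖p x‖ₑ ^ 2 := by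
  have hGm : Measurable (𝓕 p : L2Line) := (Lp.stronglyMeasurable (𝓕 p : L2Line)).measurable
  have hpm : Measurable p := (Lp.stronglyMeasurable p).measurable
  set G : ℝ → ℂ := ⇑(𝓕 p : L2Line) with hG
  have hexp : Measurable fun u : ℝ => (𝐞 (-u) : ℂ) := by
    have : Continuous fun u : ℝ => (𝐞 (-u) : ℂ) :=
      continuous_subtype_val.comp (Real.continuous_fourierChar.comp continuous_neg)
    exact this.measurable
  have hdiff : ∀ h : ℝ, ∫⁻ a, ‖G (a + h) - G a‖ₑ ^ 2
      = ∫⁻ x, ‖(𝐞 (-(h * x)) : ℂ) - 1‖ₑ ^ 2 * ‖p x‖ₑ ^ 2 := fun h => by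
    have hmem : MemLp (fun x => (𝐞 (-(h * x)) : ℂ) * p x) 2 volume := by
      refine MemLp.of_le (Lp.memLp p) ?_ (Filter.Eventually.of_forall fun x => ?_)
      · exact ((hexp.comp (measurable_const_mul h)).mul hpm).aestronglyMeasurable
      · rw [norm_mul, Circle.norm_coe, one_mul]
    have hq := fourier_modulation h hmem.coeFn_toLp
    have hsub : (𝓕 (hmem.toLp _ - p) : L2Line) =ᵐ[volume] fun a => G (a + h) - G a := by
      have : (𝓕 (hmem.toLp _ - p) : L2Line) = 𝓕 (hmem.toLp _) - 𝓕 p :=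
        map_sub (Lp.fourierTransformₗᵢ ℝ ℂ) _ _
      rw [this]
      filter_upwards [hq, Lp.coeFn_sub (𝓕 (hmem.toLp _) : L2Line) (𝓕 p)] with a h1 h2
      rw [h2, Pi.sub_apply, h1]
    calc ∫⁻ a, ‖G (a + h) - G a‖ₑ ^ 2 = ∫⁻ a, ‖(𝓕 (hmem.toLp _ - p) : L2Line) a‖ₑ ^ 2 := by
          refine lintegral_congr_ae ?_
          filter_upwards [hsub] with a ha
          rw [ha]
      _ = ∫⁻ x, ‖(hmem.toLp _ - p : L2Line) x‖ₑ ^ 2 := lintegral_enorm_sq_fourier _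
      _ = _ := by
          refine lintegral_congr_ae ?_
          filter_upwards [Lp.coeFn_sub (hmem.toLp _) p, hmem.coeFn_toLp] with x h1 h2
          rw [h1, Pi.sub_apply, h2, ← sub_one_mul, enorm_mul, mul_pow]
  have hswap1 : gagliardo G
      = ∫⁻ h : ℝ, ∫⁻ a, ENNReal.ofReal (1 / h ^ 2) * ‖G (a + h) - G a‖ₑ ^ 2 := by
    rw [lintegral_lintegral_swap]
    · refine lintegral_congr fun a => ?_
      rw [← lintegral_add_left_eq_self
        (fun b => ENNReal.ofReal (1 / (b - a) ^ 2) * ‖G b - G a‖ₑ ^ 2) a]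
      simp
    · refine Measurable.aemeasurable ?_
      unfold Function.uncurry
      fun_prop
  rw [hswap1]
  have h2 : ∀ h : ℝ, ∫⁻ a, ENNReal.ofReal (1 / h ^ 2) * ‖G (a + h) - G a‖ₑ ^ 2
      = ∫⁻ x, ENNReal.ofReal (1 / h ^ 2) * ‖(𝐞 (-(h * x)) : ℂ) - 1‖ₑ ^ 2 * ‖p x‖ₑ ^ 2 := by
    intro h
    rw [lintegral_const_mul _ (by fun_prop), hdiff, ← lintegral_const_mul]
    · simp_rw [mul_assoc]
    · have := hexp.comp (measurable_const_mul h)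
      simp only [Function.comp_def] at this
      fun_prop
  simp_rw [h2]
  have hme2 : Measurable fun z : ℝ × ℝ => (𝐞 (-(z.1 * z.2)) : ℂ) :=
    hexp.comp (measurable_fst.mul measurable_snd)
  rw [lintegral_lintegral_swap]
  · rw [← lintegral_const_mul _ (by fun_prop)]
    refine lintegral_congr fun x => ?_
    rw [lintegral_mul_const, lintegral_gagliardo_kernel, mul_assoc]
    have := hexp.comp (measurable_mul_const x)
    simp only [Function.comp_def] at this
    fun_prop
  · refine Measurable.aemeasurable ?_
    unfold Function.uncurry
    fun_prop

theorem gagliardo_add_le (G H : ℝ → ℂ) (hG : Measurable G) (hH : Measurable H) :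
    gagliardo (fun ξ => G ξ + H ξ) ≤ 2 * gagliardo G + 2 * gagliardo H := by
  unfold gagliardo
  rw [← lintegral_const_mul _ (by fun_prop), ← lintegral_const_mul _ (by fun_prop),
    ← lintegral_add_left (by fun_prop)]
  refine lintegral_mono fun a => ?_
  rw [← lintegral_const_mul _ (by fun_prop), ← lintegral_const_mul _ (by fun_prop),
    ← lintegral_add_left (by fun_prop)]
  refine lintegral_mono fun b => ?_
  rw [← mul_assoc, ← mul_assoc, mul_comm 2, mul_assoc, mul_assoc, ← mul_add]
  gcongr
  rw [enorm_sq_eq_ofReal, enorm_sq_eq_ofReal, enorm_sq_eq_ofReal,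
    show (2 : ℝ≥0∞) = ENNReal.ofReal 2 by simp, ← ENNReal.ofReal_mul zero_le_two,
    ← ENNReal.ofReal_mul zero_le_two, ← ENNReal.ofReal_add (by positivity) (by positivity)]
  refine ENNReal.ofReal_le_ofReal ?_
  have h : ‖G b + H b - (G a + H a)‖ ≤ ‖G b - G a‖ + ‖H b - H a‖ := by
    rw [add_sub_add_comm]; exact norm_add_le _ _
  nlinarith [norm_nonneg (G b + H b - (G a + H a)), sq_nonneg (‖G b - G a‖ - ‖H b - H a‖)]

theorem gagliardo_const_mul (c : ℂ) {G : ℝ → ℂ} (hG : Measurable G) :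
    gagliardo (fun ξ => c * G ξ) = ‖c‖ₑ ^ 2 * gagliardo G := by
  unfold gagliardo
  rw [← lintegral_const_mul _ (by fun_prop)]
  refine lintegral_congr fun a => ?_
  rw [← lintegral_const_mul _ (by fun_prop)]
  refine lintegral_congr fun b => ?_
  rw [← mul_sub, enorm_mul]
  ring

/-! ### Multiplication by `sgn` on `H^{1/2}(ℝ)` -/

/-- After a translation or reflection this is the integral of u^{-2} over u > |a|. It is the source
of the Hardy weight. -/
theorem lintegral_opposite_sign {a : ℝ} (ha : a ≠ 0) :
    ∫⁻ b, Set.indicator {b : ℝ | b * a < 0} (fun b => ENNReal.ofReal (1 / (b - a) ^ 2)) b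
      = ‖a‖ₑ⁻¹ := by
  have base : ∀ c : ℝ, 0 < c →
      ∫⁻ u in Set.Ioi c, ENNReal.ofReal (1 / u ^ 2) = ‖c‖ₑ⁻¹ := fun c hc => by
    have hi := integrableOn_Ioi_rpow_of_lt (show (-2 : ℝ) < -1 by norm_num) hc
    have hv := integral_Ioi_rpow_of_lt (show (-2 : ℝ) < -1 by norm_num) hc
    have he : ∀ u ∈ Set.Ioi c, ENNReal.ofReal (1 / u ^ 2) = ENNReal.ofReal (u ^ (-2 : ℝ)) := by
      intro u hu
      rw [Real.rpow_neg (hc.trans hu).le, one_div]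
      norm_num
    rw [setLIntegral_congr_fun measurableSet_Ioi he, ← ofReal_integral_eq_lintegral_ofReal hi, hv]
    · rw [Real.enorm_eq_ofReal_abs, ← ENNReal.ofReal_inv_of_pos (abs_pos.mpr hc.ne'),
        abs_of_pos hc]
      congr 1
      norm_num
      rw [Real.rpow_neg_one]
    · filter_upwards [ae_restrict_mem measurableSet_Ioi] with u hu
      exact Real.rpow_nonneg (hc.trans hu).le _
  have hmeas : MeasurableSet {b : ℝ | b * a < 0} :=
    measurableSet_lt (measurable_mul_const a) measurable_const
  rw [lintegral_indicator hmeas]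
  rcases ha.lt_or_gt with h | h
  · have hs : {b : ℝ | b * a < 0} = Set.Ioi 0 := by
      ext b
      simp only [Set.mem_ofPred_eq, Set.mem_Ioi]
      exact ⟨fun hb => by nlinarith [mul_nonneg_of_nonpos_of_nonpos (a := b) (b := a)],
        fun hb => mul_neg_of_pos_of_neg hb h⟩
    rw [hs, ← enorm_neg, ← base (-a) (by linarith), ← lintegral_indicator measurableSet_Ioi,
      ← lintegral_indicator measurableSet_Ioi,
      ← lintegral_sub_right_eq_self
        (Set.indicator (Set.Ioi (-a)) fun u => ENNReal.ofReal (1 / u ^ 2)) a]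
    refine lintegral_congr fun b => ?_
    simp only [Set.indicator, Set.mem_Ioi, neg_lt_sub_iff_lt_add, lt_add_iff_pos_right]
  · have hs : {b : ℝ | b * a < 0} = Set.Iio 0 := by
      ext b
      simp only [Set.mem_ofPred_eq, Set.mem_Iio]
      exact ⟨fun hb => by nlinarith [mul_nonneg (a := b) (b := a)],
        fun hb => mul_neg_of_neg_of_pos hb h⟩
    rw [hs, ← base a h, ← lintegral_indicator measurableSet_Ioi,
      ← lintegral_indicator measurableSet_Iio,
      ← lintegral_sub_left_eq_self
        (Set.indicator (Set.Ioi a) fun u => ENNReal.ofReal (1 / u ^ 2)) a]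
    refine lintegral_congr fun b => ?_
    simp only [Set.indicator, Set.mem_Ioi, Set.mem_Iio, lt_sub_iff_add_lt, add_lt_iff_neg_left]
    rw [sub_sq_comm]

theorem lintegral_opposite_sign_left (G : ℝ → ℂ) :
    ∫⁻ a, ∫⁻ b, Set.indicator {b : ℝ | b * a < 0}
      (fun b => ENNReal.ofReal (1 / (b - a) ^ 2)) b * ‖G a‖ₑ ^ 2 = hardyIntegral G := by
  refine lintegral_congr_ae ?_
  filter_upwards [compl_mem_ae_iff.mpr (measure_singleton (0 : ℝ))] with a ha
  rw [lintegral_mul_const, lintegral_opposite_sign ha]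
  refine Measurable.indicator (by fun_prop) ?_
  exact measurableSet_lt (measurable_mul_const a) measurable_const

theorem measurable_opposite_sign : Measurable fun z : ℝ × ℝ =>
    Set.indicator {b : ℝ | b * z.1 < 0} (fun b => ENNReal.ofReal (1 / (b - z.1) ^ 2)) z.2 := by
  have : (fun z : ℝ × ℝ =>
      Set.indicator {b : ℝ | b * z.1 < 0} (fun b => ENNReal.ofReal (1 / (b - z.1) ^ 2)) z.2)
      = Set.indicator {z : ℝ × ℝ | z.2 * z.1 < 0}
        (fun z => ENNReal.ofReal (1 / (z.2 - z.1) ^ 2)) := by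
    ext z; simp [Set.indicator]
  rw [this]
  refine Measurable.indicator (by fun_prop) ?_
  exact measurableSet_lt (measurable_snd.mul measurable_fst) measurable_const

theorem lintegral_opposite_sign_right {G : ℝ → ℂ} (hG : Measurable G) :
    ∫⁻ a, ∫⁻ b, Set.indicator {b : ℝ | b * a < 0}
      (fun b => ENNReal.ofReal (1 / (b - a) ^ 2)) b * ‖G b‖ₑ ^ 2 = hardyIntegral G := by
  rw [lintegral_lintegral_swap, ← lintegral_opposite_sign_left G]
  · refine lintegral_congr fun b => lintegral_congr fun a => ?_
    simp only [Set.indicator, Set.mem_ofPred_eq, mul_comm b a, sub_sq_comm b a]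
  · have := measurable_opposite_sign
    exact (Measurable.mul this (by fun_prop)).aemeasurable

/-- Multiplication by sgn changes the size of an increment only across the origin, where the
difference becomes a sum. -/
theorem sign_mul_sub_bounds (x y : ℂ) {a b : ℝ} (ha : a ≠ 0) (hb : b ≠ 0) :
    (0 < b * a ∧ ‖((Real.sign b : ℝ) : ℂ) * y - ((Real.sign a : ℝ) : ℂ) * x‖ = ‖y - x‖) ∨
    (b * a < 0 ∧ ‖((Real.sign b : ℝ) : ℂ) * y - ((Real.sign a : ℝ) : ℂ) * x‖ = ‖y + x‖) := by
  rcases ha.lt_or_gt with h | h <;> rcases hb.lt_or_gt with h' | h'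
  · refine Or.inl ⟨mul_pos_of_neg_of_neg h' h, ?_⟩
    rw [Real.sign_of_neg h, Real.sign_of_neg h', ← norm_neg]
    congr 1; push_cast; ring
  · refine Or.inr ⟨mul_neg_of_pos_of_neg h' h, ?_⟩
    rw [Real.sign_of_neg h, Real.sign_of_pos h']
    congr 1; push_cast; ring
  · refine Or.inr ⟨mul_neg_of_neg_of_pos h' h, ?_⟩
    rw [Real.sign_of_pos h, Real.sign_of_neg h', ← norm_neg]
    congr 1; push_cast; ring
  · refine Or.inl ⟨mul_pos h' h, ?_⟩
    rw [Real.sign_of_pos h, Real.sign_of_pos h']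
    congr 1; push_cast; ring

theorem ae_ne_zero : ∀ᵐ a : ℝ, a ≠ 0 := compl_mem_ae_iff.mpr (measure_singleton (0 : ℝ))

/-- Across the origin use |x + y|² ≤ 2|x|² + 2|y|²; each of the two terms integrates to the Hardy
energy. -/
theorem gagliardo_sign_mul_le {G : ℝ → ℂ} (hG : Measurable G) :
    gagliardo (fun ξ => ((Real.sign ξ : ℝ) : ℂ) * G ξ) ≤ gagliardo G + 4 * hardyIntegral G := by
  have hmi := measurable_opposite_sign
  have hmi' : ∀ a : ℝ, Measurable (Set.indicator {b : ℝ | b * a < 0}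
      (fun b => ENNReal.ofReal (1 / (b - a) ^ 2))) := fun a =>
    hmi.comp measurable_prodMk_left
  have h4 : 4 * hardyIntegral G = 2 * hardyIntegral G + 2 * hardyIntegral G := by
    rw [← add_mul]; norm_num
  have hl := lintegral_opposite_sign_left G
  have hr := lintegral_opposite_sign_right hG
  rw [h4]
  nth_rewrite 1 [← hl]
  rw [← hr]
  unfold gagliardo
  rw [← lintegral_const_mul _ (by fun_prop), ← lintegral_const_mul _ (by fun_prop),
    ← lintegral_add_left (by fun_prop), ← lintegral_add_left (by fun_prop)]
  refine lintegral_mono_ae ?_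
  filter_upwards [ae_ne_zero] with a ha
  have := hmi' a
  rw [← lintegral_const_mul _ (by fun_prop), ← lintegral_const_mul _ (by fun_prop),
    ← lintegral_add_left (by fun_prop), ← lintegral_add_left (by fun_prop)]
  refine lintegral_mono_ae ?_
  filter_upwards [ae_ne_zero] with b hb
  rcases sign_mul_sub_bounds (G a) (G b) ha hb with ⟨h1, h2⟩ | ⟨h1, h2⟩
  · rw [enorm_sq_eq_ofReal, h2, enorm_sq_eq_ofReal]
    exact le_self_add
  · rw [Set.indicator_of_mem (show b ∈ {b : ℝ | b * a < 0} from h1)]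
    refine le_trans ?_ le_add_self
    rw [← mul_assoc, ← mul_assoc, mul_comm 2, mul_assoc, mul_assoc, ← mul_add]
    gcongr
    rw [enorm_sq_eq_ofReal, h2, enorm_sq_eq_ofReal, enorm_sq_eq_ofReal,
      show (2 : ℝ≥0∞) = ENNReal.ofReal 2 by simp, ← ENNReal.ofReal_mul zero_le_two,
      ← ENNReal.ofReal_mul zero_le_two, ← ENNReal.ofReal_add (by positivity) (by positivity)]
    refine ENNReal.ofReal_le_ofReal ?_
    nlinarith [norm_add_le (G b) (G a), norm_nonneg (G b + G a), sq_nonneg (‖G b‖ - ‖G a‖)]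

/-- Across the origin 2G(a) is the sum minus the difference of G(b) and G(a): the former is an
increment of sgn·G, the latter an increment of G. -/
theorem hardyIntegral_le {G : ℝ → ℂ} (hG : Measurable G) :
    4 * hardyIntegral G ≤
      2 * gagliardo G + 2 * gagliardo (fun ξ => ((Real.sign ξ : ℝ) : ℂ) * G ξ) := by
  have hs : Measurable fun ξ : ℝ => ((Real.sign ξ : ℝ) : ℂ) := by
    have := measurable_sign
    fun_prop
  have hmi := measurable_opposite_sign
  have hmi' : ∀ a : ℝ, Measurable (Set.indicator {b : ℝ | b * a < 0}
      (fun b => ENNReal.ofReal (1 / (b - a) ^ 2))) := fun a =>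
    hmi.comp measurable_prodMk_left
  obtain ⟨S, hS⟩ : ∃ S : ℝ → ℂ, S = fun ξ => ((Real.sign ξ : ℝ) : ℂ) * G ξ := ⟨_, rfl⟩
  have hSm : Measurable S := hS ▸ hs.mul hG
  rw [← hS, ← lintegral_opposite_sign_left G]
  unfold gagliardo
  rw [← lintegral_const_mul _ (by fun_prop), ← lintegral_const_mul _ (by fun_prop),
    ← lintegral_const_mul _ (by fun_prop), ← lintegral_add_left (by fun_prop)]
  refine lintegral_mono_ae ?_
  filter_upwards [ae_ne_zero] with a ha
  have := hmi' a
  rw [← lintegral_const_mul _ (by fun_prop), ← lintegral_const_mul _ (by fun_prop),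
    ← lintegral_const_mul _ (by fun_prop), ← lintegral_add_left (by fun_prop)]
  refine lintegral_mono_ae ?_
  filter_upwards [ae_ne_zero] with b hb
  rcases sign_mul_sub_bounds (G a) (G b) ha hb with ⟨h1, h2⟩ | ⟨h1, h2⟩
  · rw [Set.indicator_of_notMem (show b ∉ {b : ℝ | b * a < 0} from not_lt.mpr h1.le)]
    simp
  · rw [Set.indicator_of_mem (show b ∈ {b : ℝ | b * a < 0} from h1)]
    have h3 : 4 * ‖G a‖ₑ ^ 2 ≤ 2 * ‖G b - G a‖ₑ ^ 2 +
        2 * ‖S b - S a‖ₑ ^ 2 := by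
      rw [hS, enorm_sq_eq_ofReal, enorm_sq_eq_ofReal, enorm_sq_eq_ofReal, h2,
        show (2 : ℝ≥0∞) = ENNReal.ofReal 2 by simp, show (4 : ℝ≥0∞) = ENNReal.ofReal 4 by simp,
        ← ENNReal.ofReal_mul zero_le_two, ← ENNReal.ofReal_mul zero_le_two,
        ← ENNReal.ofReal_mul zero_le_four, ← ENNReal.ofReal_add (by positivity) (by positivity)]
      refine ENNReal.ofReal_le_ofReal ?_
      have h5 : 2 * ‖G a‖ ≤ ‖G b - G a‖ + ‖G b + G a‖ := by
        have : (2 : ℂ) * G a = (G b + G a) - (G b - G a) := by ring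
        have h6 := norm_sub_le (G b + G a) (G b - G a)
        rw [← this, norm_mul] at h6
        norm_num at h6
        linarith
      nlinarith [norm_nonneg (G a), sq_nonneg (‖G b - G a‖ - ‖G b + G a‖)]
    calc _ = ENNReal.ofReal (1 / (b - a) ^ 2) * (4 * ‖G a‖ₑ ^ 2) := by ring
      _ ≤ ENNReal.ofReal (1 / (b - a) ^ 2) * (2 * ‖G b - G a‖ₑ ^ 2 + 2 * ‖S b - S a‖ₑ ^ 2) := by
        gcongr
      _ = _ := by ring

/-- For a family in `H^{1/2}(ℝ)`, multiplication by `sgn` stays in `H^{1/2}(ℝ)` if and only if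
`∫ |G|² / |ξ| < ∞`. -/
theorem tsum_gagliardo_sign_mul_lt_top_iff {G : ℤ → ℝ → ℂ} (hG : ∀ η, Measurable (G η))
    (h : ∑' η, gagliardo (G η) < ⊤) :
    ∑' η, gagliardo (fun ξ => ((Real.sign ξ : ℝ) : ℂ) * G η ξ) < ⊤ ↔
      ∑' η, hardyIntegral (G η) < ⊤ := by
  constructor
  · intro h1
    have h2 := ENNReal.tsum_le_tsum fun η => hardyIntegral_le (hG η)
    rw [ENNReal.tsum_add, ENNReal.tsum_mul_left, ENNReal.tsum_mul_left, ENNReal.tsum_mul_left] at h2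
    have h3 : 4 * ∑' η, hardyIntegral (G η) < ⊤ :=
      h2.trans_lt (ENNReal.add_lt_top.mpr
        ⟨ENNReal.mul_lt_top (by simp) h, ENNReal.mul_lt_top (by simp) h1⟩)
    exact ENNReal.lt_top_of_mul_ne_top_right h3.ne (by norm_num)
  · intro h1
    have h2 := ENNReal.tsum_le_tsum fun η => gagliardo_sign_mul_le (hG η)
    rw [ENNReal.tsum_add, ENNReal.tsum_mul_left] at h2
    exact h2.trans_lt (ENNReal.add_lt_top.mpr ⟨h, ENNReal.mul_lt_top (by simp) h1⟩)

/-! ### The short-time Fourier transform -/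

/-- `∫ (1 + |x|)ⁿ |p(x)|² dx`. -/
noncomputable def polyWeight (n : ℕ) (p : ℝ → ℂ) : ℝ≥0∞ := ∫⁻ x, (1 + ‖x‖ₑ) ^ n * ‖p x‖ₑ ^ 2

/-- The short-time Fourier transform with window `h`,
`(x, ξ) ↦ ∫ p(y) h(x - y) e^{-2πiyξ} dy`. -/
noncomputable def stft (h : 𝓢(ℝ, ℂ)) (p : L2Line) (z : ℝ × ℝ) : ℂ :=
  𝓕 (fun y => p y * h (z.1 - y)) z.2

/-- `∬ (1 + |x| + |ξ|)ⁿ |V(x, ξ)|² dx dξ` for the short-time Fourier transform `V` of `p`. -/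
noncomputable def phaseNorm (n : ℕ) (h : 𝓢(ℝ, ℂ)) (p : L2Line) : ℝ≥0∞ :=
  ∫⁻ z : ℝ × ℝ, (1 + ‖z.1‖ₑ + ‖z.2‖ₑ) ^ n * ‖stft h p z‖ₑ ^ 2

theorem memLp_mul_schwartz (p : L2Line) (h : 𝓢(ℝ, ℂ)) :
    MemLp (fun y => p y * h y) 2 volume := by
  have : MemLp (fun y => h y * p y) 2 volume :=
    (Lp.memLp p).mul (p := ⊤) (q := 2) (h.memLp ⊤)
  simpa only [mul_comm] using this

theorem integrable_mul_schwartz (p : L2Line) (h : 𝓢(ℝ, ℂ)) :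
    Integrable (fun y => p y * h y) volume :=
  (Lp.memLp p).integrable_mul (h.memLp 2)

/-- The Schwartz function `y ↦ h(x - y)`. -/
noncomputable def reflectSub (h : 𝓢(ℝ, ℂ)) (x : ℝ) : 𝓢(ℝ, ℂ) :=
  SchwartzMap.compSubConstCLM ℝ x
    (SchwartzMap.compCLMOfContinuousLinearEquiv ℝ (ContinuousLinearEquiv.neg ℝ) h)

theorem reflectSub_apply (h : 𝓢(ℝ, ℂ)) (x y : ℝ) : reflectSub h x y = h (x - y) := by
  simp [reflectSub]

/-- The Schwartz function `ζ ↦ ζ h(ζ)`. -/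
noncomputable def idMul (h : 𝓢(ℝ, ℂ)) : 𝓢(ℝ, ℂ) :=
  SchwartzMap.smulLeftCLM ℂ (fun x : ℝ => (x : ℂ)) h

theorem idMul_apply (h : 𝓢(ℝ, ℂ)) (x : ℝ) : idMul h x = x * h x := by
  rw [idMul, SchwartzMap.smulLeftCLM_apply_apply, smul_eq_mul]
  exact Complex.ofRealCLM.hasTemperateGrowth

theorem fourierInv_reflectSub (h : 𝓢(ℝ, ℂ)) (x u : ℝ) :
    (𝓕⁻ (reflectSub h x)) u = (𝐞 (u * x) : ℂ) * (𝓕 h) u := by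
  rw [SchwartzMap.fourierInv_coe, SchwartzMap.fourier_coe, Real.fourierInv_eq,
    Real.fourier_real_eq, ← integral_const_mul,
    ← integral_sub_left_eq_self (fun v => (𝐞 (inner ℝ v u)) • reflectSub h x v) volume x]
  refine integral_congr_ae (Filter.Eventually.of_forall fun v => ?_)
  simp only [reflectSub_apply, sub_sub_cancel, Circle.smul_def, smul_eq_mul]
  rw [← mul_assoc, ← Circle.coe_mul, ← AddChar.map_add_eq_mul]
  congr 3
  simp
  ring

/-- Moving the transform from the window to p shows that position and frequency play symmetric
roles: up to a phase, this is a windowed transform of 𝓕 p with window 𝓕 h. -/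
theorem stft_eq_integral_fourier (h : 𝓢(ℝ, ℂ)) (p : L2Line) (x ξ : ℝ) :
    stft h p (x, ξ) =
      ∫ ζ, (𝐞 ((ζ - ξ) * x) : ℂ) * ((𝓕 p : L2Line) ζ * (𝓕 h) (ζ - ξ)) := by
  have key := integral_schwartz_mul_fourier p
    (SchwartzMap.compSubConstCLM ℝ ξ (𝓕⁻ (reflectSub h x)))
  simp only [fourier_compSubConst, SchwartzMap.compSubConstCLM_apply, fourierInv_reflectSub,
    FourierTransform.fourier_fourierInv_eq, reflectSub_apply] at key
  rw [stft, Real.fourier_real_eq]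
  refine Eq.trans ?_ (key.symm.trans ?_)
  · refine integral_congr_ae (Filter.Eventually.of_forall fun v => ?_)
    simp only [Circle.smul_def, smul_eq_mul]
    rw [mul_comm ξ v]
    ring
  · refine integral_congr_ae (Filter.Eventually.of_forall fun v => ?_)
    ring_nf

theorem enorm_stft_eq (h : 𝓢(ℝ, ℂ)) (p : L2Line) (x ξ : ℝ) :
    ‖stft h p (x, ξ)‖ₑ =
      ‖𝓕 (fun ζ => (𝓕 p : L2Line) ζ * (𝓕 h) (ζ - ξ)) (-x)‖ₑ := by
  rw [stft_eq_integral_fourier, Real.fourier_real_eq]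
  have : ∀ ζ : ℝ, (𝐞 ((ζ - ξ) * x) : ℂ) * ((𝓕 p : L2Line) ζ * (𝓕 h) (ζ - ξ)) =
      (𝐞 (-(ξ * x)) : ℂ) * (𝐞 (-(ζ * -x)) • ((𝓕 p : L2Line) ζ * (𝓕 h) (ζ - ξ))) := fun ζ => by
    have h1 : (𝐞 ((ζ - ξ) * x) : ℂ) = (𝐞 (-(ξ * x)) : ℂ) * (𝐞 (-(ζ * -x)) : ℂ) := by
      rw [← Circle.coe_mul, ← AddChar.map_add_eq_mul]
      congr 2
      ring
    rw [h1, Circle.smul_def, smul_eq_mul]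
    ring
  simp_rw [this]
  rw [integral_const_mul, enorm_mul, ← ofReal_norm, Circle.norm_coe, ENNReal.ofReal_one, one_mul]

theorem measurable_stft (h : 𝓢(ℝ, ℂ)) (p : L2Line) : Measurable (stft h p) := by
  have hp : Measurable p := (Lp.stronglyMeasurable p).measurable
  have hh : Measurable h := h.continuous.measurable
  have he : Measurable fun w : (ℝ × ℝ) × ℝ => (𝐞 (-(w.2 * w.1.2)) : ℂ) := by
    have : Continuous fun w : (ℝ × ℝ) × ℝ => (𝐞 (-(w.2 * w.1.2)) : ℂ) :=
      continuous_subtype_val.comp (Real.continuous_fourierChar.comp (by fun_prop))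
    exact this.measurable
  have hm : Measurable fun w : (ℝ × ℝ) × ℝ =>
      (𝐞 (-(w.2 * w.1.2)) : ℂ) * (p w.2 * h (w.1.1 - w.2)) := by fun_prop
  have := hm.stronglyMeasurable.integral_prod_right' (ν := volume)
  have he : stft h p = fun z : ℝ × ℝ =>
      ∫ y, (𝐞 (-(y * z.2)) : ℂ) * (p y * h (z.1 - y)) := by
    ext z
    rw [stft, Real.fourier_real_eq]
    rfl
  rw [he]
  exact this.measurable

/-- Plancherel in ξ at fixed x: a weight in x alone sees only |p|² convolved with |h|². -/
theorem lintegral_stft_left (h : 𝓢(ℝ, ℂ)) (p : L2Line) {w : ℝ → ℝ≥0∞} (hw : Measurable w) :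
    ∫⁻ z : ℝ × ℝ, w z.1 * ‖stft h p z‖ₑ ^ 2
      = ∫⁻ x, w x * ∫⁻ y, ‖p y‖ₑ ^ 2 * ‖h (x - y)‖ₑ ^ 2 := by
  have hm := measurable_stft h p
  rw [Measure.volume_eq_prod, lintegral_prod _ (by fun_prop)]
  refine lintegral_congr fun x => ?_
  refine (lintegral_const_mul (w x) (by fun_prop)).trans ?_
  congr 1
  have h1 := memLp_mul_schwartz p (reflectSub h x)
  have h2 := integrable_mul_schwartz p (reflectSub h x)
  simp only [reflectSub_apply] at h1 h2
  refine (lintegral_enorm_sq_fourier_integrable h2 h1).trans ?_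
  simp_rw [enorm_mul, mul_pow]

theorem lintegral_enorm_sq_fourier_neg {g : ℝ → ℂ} (h1 : Integrable g)
    (h2 : MemLp g 2 volume) : ∫⁻ x, ‖𝓕 g (-x)‖ₑ ^ 2 = ∫⁻ x, ‖g x‖ₑ ^ 2 := by
  rw [← lintegral_enorm_sq_fourier_integrable h1 h2]
  exact lintegral_neg_eq_self fun x => ‖𝓕 g x‖ₑ ^ 2

theorem lintegral_stft_right (h : 𝓢(ℝ, ℂ)) (p : L2Line) {w : ℝ → ℝ≥0∞} (hw : Measurable w) :
    ∫⁻ z : ℝ × ℝ, w z.2 * ‖stft h p z‖ₑ ^ 2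
      = ∫⁻ ξ, w ξ * ∫⁻ ζ, ‖(𝓕 p : L2Line) ζ‖ₑ ^ 2 * ‖(𝓕 h) (ζ - ξ)‖ₑ ^ 2 := by
  have hm := measurable_stft h p
  rw [Measure.volume_eq_prod, lintegral_prod_symm _ (by fun_prop)]
  refine lintegral_congr fun ξ => ?_
  have h1 := memLp_mul_schwartz (𝓕 p) (SchwartzMap.compSubConstCLM ℝ ξ (𝓕 h))
  have h2 := integrable_mul_schwartz (𝓕 p) (SchwartzMap.compSubConstCLM ℝ ξ (𝓕 h))
  simp only [SchwartzMap.compSubConstCLM_apply] at h1 h2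
  have h3 := lintegral_enorm_sq_fourier_neg h2 h1
  simp_rw [enorm_mul, mul_pow] at h3
  rw [← h3]
  refine (lintegral_const_mul (w ξ) (by fun_prop)).trans ?_
  simp_rw [enorm_stft_eq]

theorem lintegral_weight_conv {p : ℝ → ℂ} (hp : Measurable p) {g : ℝ → ℝ≥0∞} (hg : Measurable g)
    {w : ℝ → ℝ≥0∞} (hw : Measurable w) :
    ∫⁻ x, w x * ∫⁻ y, ‖p y‖ₑ ^ 2 * g (x - y)
      = ∫⁻ y, (∫⁻ u, w (u + y) * g u) * ‖p y‖ₑ ^ 2 := by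
  have : ∀ x, w x * ∫⁻ y, ‖p y‖ₑ ^ 2 * g (x - y) =
      ∫⁻ y, w x * g (x - y) * ‖p y‖ₑ ^ 2 := fun x => by
    rw [← lintegral_const_mul _ (by fun_prop)]
    refine lintegral_congr fun y => ?_
    ring
  simp_rw [this]
  rw [lintegral_lintegral_swap]
  · refine lintegral_congr fun y => ?_
    rw [lintegral_mul_const _ (by fun_prop),
      ← lintegral_add_right_eq_self (fun x => w x * g (x - y)) y]
    simp
  · refine Measurable.aemeasurable ?_
    unfold Function.uncurry
    fun_prop

/-- The weight is submultiplicative: 1 + |u + y| ≤ (1 + |u|)(1 + |y|). -/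
theorem polyWeight_conv_le {p : ℝ → ℂ} (hp : Measurable p) {g : ℝ → ℝ≥0∞} (hg : Measurable g)
    (n : ℕ) :
    ∫⁻ x, (1 + ‖x‖ₑ) ^ n * ∫⁻ y, ‖p y‖ₑ ^ 2 * g (x - y)
      ≤ (∫⁻ u, (1 + ‖u‖ₑ) ^ n * g u) * polyWeight n p := by
  rw [lintegral_weight_conv hp hg (by fun_prop), polyWeight, ← lintegral_const_mul _ (by fun_prop)]
  refine lintegral_mono fun y => ?_
  rw [← mul_assoc]
  gcongr
  rw [← lintegral_mul_const _ (by fun_prop)]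
  refine lintegral_mono fun u => ?_
  rw [mul_right_comm, ← mul_pow]
  gcongr
  calc 1 + ‖u + y‖ₑ ≤ 1 + (‖u‖ₑ + ‖y‖ₑ) := by gcongr; exact enorm_add_le _ _
    _ ≤ 1 + (‖u‖ₑ + ‖y‖ₑ) + ‖u‖ₑ * ‖y‖ₑ := le_self_add
    _ = _ := by ring

/-- For |u| < 1 one has 1 + |y| ≤ 2(1 + |u + y|), so restricting the convolution to such u loses
only 2^n. -/
theorem polyWeight_le_conv {p : ℝ → ℂ} (hp : Measurable p) {g : ℝ → ℝ≥0∞} (hg : Measurable g)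
    (n : ℕ) :
    (∫⁻ u in Set.Ioo (-1) 1, g u) * polyWeight n p ≤
      2 ^ n * ∫⁻ x, (1 + ‖x‖ₑ) ^ n * ∫⁻ y, ‖p y‖ₑ ^ 2 * g (x - y) := by
  rw [lintegral_weight_conv hp hg (by fun_prop), polyWeight,
    ← lintegral_const_mul _ (by fun_prop), ← lintegral_const_mul _ (by fun_prop)]
  refine lintegral_mono fun y => ?_
  rw [← mul_assoc, ← mul_assoc]
  refine mul_le_mul' ?_ le_rfl
  rw [← lintegral_mul_const _ (by fun_prop), ← lintegral_const_mul _ (by fun_prop)]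
  refine (setLIntegral_mono (g := fun u => 2 ^ n * ((1 + ‖u + y‖ₑ) ^ n * g u)) (by fun_prop)
    fun u hu => ?_).trans (setLIntegral_le_lintegral _ _)
  rw [mul_comm (g u), ← mul_assoc, ← mul_pow]
  gcongr
  have h1 : ‖y‖ₑ ≤ ‖u + y‖ₑ + 1 := by
    have : ‖u‖ₑ ≤ 1 := by
      rw [Real.enorm_eq_ofReal_abs, ← ENNReal.ofReal_one]
      exact ENNReal.ofReal_le_ofReal (abs_le.mpr ⟨hu.1.le, hu.2.le⟩)
    calc ‖y‖ₑ = ‖(u + y) - u‖ₑ := by ring_nf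
      _ ≤ ‖u + y‖ₑ + ‖u‖ₑ := enorm_sub_le
      _ ≤ _ := by gcongr
  calc 1 + ‖y‖ₑ ≤ 1 + (‖u + y‖ₑ + 1) := by gcongr
    _ ≤ 1 + (‖u + y‖ₑ + 1) + ‖u + y‖ₑ := le_self_add
    _ = _ := by ring

theorem polyWeight_schwartz_lt_top (n : ℕ) (h : 𝓢(ℝ, ℂ)) : polyWeight n h < ⊤ := by
  have hb : ∀ m : ℕ, ∫⁻ x, ‖x‖ₑ ^ m * ‖h x‖ₑ < ⊤ := fun m => by
    have := (h.integrable_pow_mul (μ := volume) m).2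
    rw [hasFiniteIntegral_iff_enorm] at this
    refine lt_of_le_of_lt (le_of_eq (lintegral_congr fun x => ?_)) this
    rw [enorm_mul, enorm_pow, enorm_norm, enorm_norm]
  obtain ⟨C, hC⟩ : ∃ C : ℝ, ∀ x, ‖h x‖ ≤ C := ⟨_, h.norm_le_seminorm ℝ⟩
  have hm : Measurable h := h.continuous.measurable
  have key : polyWeight n h ≤
      ∫⁻ x, ENNReal.ofReal C * 2 ^ n * (‖x‖ₑ ^ 0 * ‖h x‖ₑ + ‖x‖ₑ ^ n * ‖h x‖ₑ) := by
    refine lintegral_mono fun x => ?_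
    have h1 : ‖h x‖ₑ ≤ ENNReal.ofReal C := by
      rw [← ofReal_norm]; exact ENNReal.ofReal_le_ofReal (hC x)
    have h2 : (1 + ‖x‖ₑ) ^ n ≤ 2 ^ n * (1 + ‖x‖ₑ ^ n) := by
      rcases le_total ‖x‖ₑ 1 with hx | hx
      · calc (1 + ‖x‖ₑ) ^ n ≤ (1 + 1) ^ n := by gcongr
          _ = 2 ^ n * 1 := by norm_num
          _ ≤ _ := by gcongr; exact le_self_add
      · calc (1 + ‖x‖ₑ) ^ n ≤ (‖x‖ₑ + ‖x‖ₑ) ^ n := by gcongr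
          _ = 2 ^ n * ‖x‖ₑ ^ n := by rw [← two_mul, mul_pow]
          _ ≤ _ := by gcongr; exact le_add_self
    calc (1 + ‖x‖ₑ) ^ n * ‖h x‖ₑ ^ 2 ≤ (2 ^ n * (1 + ‖x‖ₑ ^ n)) * (‖h x‖ₑ * ENNReal.ofReal C) := by
          rw [sq]; gcongr
      _ = _ := by ring
  refine key.trans_lt ?_
  rw [lintegral_const_mul _ (by fun_prop), lintegral_add_left (by fun_prop)]
  exact ENNReal.mul_lt_top (ENNReal.mul_lt_top (by simp) (by simp))
    (ENNReal.add_lt_top.mpr ⟨hb 0, hb n⟩)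

/-- A nonnegative bump works, its transform at 0 being its integral. Both values must be nonzero for
the lower bounds in position and in frequency to be usable with one window. -/
theorem exists_schwartz_apply_zero_ne_zero :
    ∃ h : 𝓢(ℝ, ℂ), h 0 ≠ 0 ∧ (𝓕 h) 0 ≠ 0 := by
  let b : ContDiffBump (0 : ℝ) := default
  have hc : HasCompactSupport fun x => (b x : ℂ) :=
    b.hasCompactSupport.comp_left Complex.ofReal_zero
  have hd : ContDiff ℝ (⊤ : ℕ∞) fun x => (b x : ℂ) := Complex.ofRealCLM.contDiff.comp b.contDiff
  refine ⟨hc.toSchwartzMap hd, ?_, ?_⟩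
  · change (b 0 : ℂ) ≠ 0
    rw [b.one_of_mem_closedBall (by simp [b.rIn_pos.le])]
    simp
  · rw [SchwartzMap.fourier_coe, Real.fourier_real_eq]
    simp only [mul_zero, neg_zero, AddChar.map_zero_eq_one, one_smul]
    change ∫ x, (b x : ℂ) ≠ 0
    rw [integral_complex_ofReal]
    exact_mod_cast b.integral_pos.ne'

theorem setLIntegral_enorm_sq_ne_zero {h : 𝓢(ℝ, ℂ)} (h0 : h 0 ≠ 0) :
    ∫⁻ u in Set.Ioo (-1 : ℝ) 1, ‖h u‖ₑ ^ 2 ≠ 0 := by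
  intro hz
  have hm : Measurable h := h.continuous.measurable
  rw [lintegral_eq_zero_iff (by fun_prop)] at hz
  have := Measure.eqOn_open_of_ae_eq (f := fun u => ‖h u‖ₑ ^ 2) (g := 0) hz isOpen_Ioo
    (by have := h.continuous; fun_prop) continuousOn_const
  have h1 := this (show (0 : ℝ) ∈ Set.Ioo (-1 : ℝ) 1 by norm_num)
  simp at h1
  exact h0 h1

/-! ### Families with simultaneous weights in position and frequency -/

theorem measurable_coe_Lp (p : L2Line) : Measurable p := (Lp.stronglyMeasurable p).measurable

/-- Both `∑ ∫ (1 + |x|)ⁿ |p|² dx` and `∑ ∫ (1 + |ξ|)ⁿ |𝓕 p|² dξ` are finite. -/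
structure BiWeighted (n : ℕ) (p : ℤ → L2Line) : Prop where
  position : ∑' η, polyWeight n (p η) < ⊤
  frequency : ∑' η, polyWeight n (𝓕 (p η) : L2Line) < ⊤

/-- The larger of |x| and |ξ| dominates the joint weight, so separate weights suffice; each one is a
convolution estimate. -/
theorem phaseNorm_le (n : ℕ) (h : 𝓢(ℝ, ℂ)) (p : L2Line) :
    phaseNorm n h p ≤ 2 ^ n * (polyWeight n h * polyWeight n p +
      (∫⁻ u, (1 + ‖u‖ₑ) ^ n * ‖(𝓕 h) (-u)‖ₑ ^ 2) * polyWeight n (𝓕 p : L2Line)) := by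
  have hm := measurable_stft h p
  have h1 := polyWeight_conv_le (measurable_coe_Lp p) (g := fun u => ‖h u‖ₑ ^ 2)
    (by have := h.continuous.measurable; fun_prop) n
  have h2 := polyWeight_conv_le (measurable_coe_Lp (𝓕 p)) (g := fun u => ‖(𝓕 h) (-u)‖ₑ ^ 2)
    (by have := (𝓕 h).continuous.measurable; fun_prop) n
  simp only [neg_sub] at h2
  refine le_trans ?_ (mul_le_mul' le_rfl (add_le_add h1 h2))
  rw [← lintegral_stft_left h p (by fun_prop), ← lintegral_stft_right h p (by fun_prop),
    ← lintegral_add_left (by fun_prop), ← lintegral_const_mul _ (by fun_prop)]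
  refine lintegral_mono fun z => ?_
  rw [← add_mul, ← mul_assoc]
  refine mul_le_mul' ?_ le_rfl
  rcases le_total ‖z.1‖ₑ ‖z.2‖ₑ with hz | hz
  · calc (1 + ‖z.1‖ₑ + ‖z.2‖ₑ) ^ n ≤ ((1 + ‖z.2‖ₑ) + (1 + ‖z.2‖ₑ)) ^ n := by
          gcongr
          exact le_add_self
      _ = 2 ^ n * (1 + ‖z.2‖ₑ) ^ n := by rw [← two_mul, mul_pow]
      _ ≤ _ := by gcongr; exact le_add_self
  · calc (1 + ‖z.1‖ₑ + ‖z.2‖ₑ) ^ n ≤ ((1 + ‖z.1‖ₑ) + (1 + ‖z.1‖ₑ)) ^ n := by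
          gcongr
          exact hz.trans le_add_self
      _ = 2 ^ n * (1 + ‖z.1‖ₑ) ^ n := by rw [← two_mul, mul_pow]
      _ ≤ _ := by gcongr; exact le_self_add

theorem BiWeighted.phaseNorm_lt_top {n : ℕ} {p : ℤ → L2Line} (hp : BiWeighted n p)
    (h : 𝓢(ℝ, ℂ)) : ∑' η, phaseNorm n h (p η) < ⊤ := by
  refine (ENNReal.tsum_le_tsum fun η => phaseNorm_le n h (p η)).trans_lt ?_
  rw [ENNReal.tsum_mul_left, ENNReal.tsum_add, ENNReal.tsum_mul_left, ENNReal.tsum_mul_left]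
  refine ENNReal.mul_lt_top (by simp) (ENNReal.add_lt_top.mpr
    ⟨ENNReal.mul_lt_top (polyWeight_schwartz_lt_top n h) hp.position,
      ENNReal.mul_lt_top ?_ hp.frequency⟩)
  have hneg := lintegral_neg_eq_self (μ := volume)
    (fun u : ℝ => (1 + ‖u‖ₑ) ^ n * ‖(𝓕 h) u‖ₑ ^ 2)
  simp only [enorm_neg] at hneg
  rw [hneg]
  exact polyWeight_schwartz_lt_top n (𝓕 h)

theorem biWeighted_of_phaseNorm_lt_top {n : ℕ} {p : ℤ → L2Line}
    (hp : ∀ h : 𝓢(ℝ, ℂ), ∑' η, phaseNorm n h (p η) < ⊤) : BiWeighted n p := by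
  obtain ⟨h, h0, h0'⟩ := exists_schwartz_apply_zero_ne_zero
  have hfin := hp h
  have hhm := h.continuous.measurable
  have hFm := (𝓕 h).continuous.measurable
  have aux : ∀ {c : ℝ≥0∞} {a : ℤ → ℝ≥0∞}, c ≠ 0 →
      (∀ η, c * a η ≤ 2 ^ n * phaseNorm n h (p η)) → ∑' η, a η < ⊤ := by
    intro c a hc ha
    have := ENNReal.tsum_le_tsum ha
    rw [ENNReal.tsum_mul_left, ENNReal.tsum_mul_left] at this
    exact ENNReal.lt_top_of_mul_ne_top_right
      (this.trans_lt (ENNReal.mul_lt_top (by simp) hfin)).ne hc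
  constructor
  · refine aux (setLIntegral_enorm_sq_ne_zero h0) fun η => ?_
    refine (polyWeight_le_conv (measurable_coe_Lp (p η)) (by fun_prop) n).trans ?_
    rw [← lintegral_stft_left h (p η) (by fun_prop)]
    exact mul_le_mul' le_rfl
      (lintegral_mono fun z => mul_le_mul' (pow_le_pow_left' le_self_add n) le_rfl)
  · refine aux (setLIntegral_enorm_sq_ne_zero
      (h := SchwartzMap.compCLMOfContinuousLinearEquiv ℝ (ContinuousLinearEquiv.neg ℝ) (𝓕 h))
      (by simpa using h0')) fun η => ?_
    refine (polyWeight_le_conv (measurable_coe_Lp (𝓕 (p η)))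
      (by have := (SchwartzMap.compCLMOfContinuousLinearEquiv ℝ
            (ContinuousLinearEquiv.neg ℝ) (𝓕 h)).continuous.measurable
          fun_prop) n).trans ?_
    simp only [SchwartzMap.compCLMOfContinuousLinearEquiv_apply, Function.comp_apply,
      ContinuousLinearEquiv.neg_apply, neg_sub]
    rw [← lintegral_stft_right h (p η) (by fun_prop)]
    unfold phaseNorm
    gcongr
    exact le_add_right le_rfl

/-- Write y = x - (x - y) and absorb the second factor into the window. -/
theorem stft_position_mul (h : 𝓢(ℝ, ℂ)) {p q : L2Line}
    (hq : q =ᵐ[volume] fun x => (x : ℂ) * p x) (z : ℝ × ℝ) :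
    stft h q z = z.1 * stft h p z - stft (idMul h) p z := by
  have i1 := integrable_mul_schwartz p (reflectSub h z.1)
  have i2 := integrable_mul_schwartz p (reflectSub (idMul h) z.1)
  simp only [reflectSub_apply] at i1 i2
  have j1 := (Real.fourierIntegral_convergent_iff z.2).mpr i1
  have j2 := (Real.fourierIntegral_convergent_iff z.2).mpr i2
  simp only [stft, Real.fourier_real_eq]
  rw [← integral_const_mul, ← integral_sub]
  · refine integral_congr_ae ?_
    filter_upwards [hq] with y hy
    rw [hy, idMul_apply]
    simp only [Circle.smul_def, smul_eq_mul]
    push_cast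
    ring
  · simpa [mul_comm] using j1.const_mul (z.1 : ℂ)
  · simpa [mul_comm] using j2

/-- Write ζ = ξ + (ζ - ξ) in the frequency-side formula and absorb the second factor into the
transform of the window. -/
theorem stft_frequency_mul (h : 𝓢(ℝ, ℂ)) {p q : L2Line}
    (hq : (𝓕 q : L2Line) =ᵐ[volume] fun ξ => (ξ : ℂ) * (𝓕 p : L2Line) ξ) (z : ℝ × ℝ) :
    stft h q z = z.2 * stft h p z + stft (𝓕⁻ (idMul (𝓕 h))) p z := by
  obtain ⟨x, ξ⟩ := z
  have hint : ∀ g : 𝓢(ℝ, ℂ), Integrable fun ζ : ℝ =>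
      (𝐞 ((ζ - ξ) * x) : ℂ) * ((𝓕 p : L2Line) ζ * g (ζ - ξ)) := fun g => by
    have := integrable_mul_schwartz (𝓕 p) (SchwartzMap.compSubConstCLM ℝ ξ g)
    simp only [SchwartzMap.compSubConstCLM_apply] at this
    refine this.bdd_mul (c := 1) ?_ (Filter.Eventually.of_forall fun ζ => ?_)
    · have : Continuous fun ζ : ℝ => (𝐞 ((ζ - ξ) * x) : ℂ) :=
        continuous_subtype_val.comp (Real.continuous_fourierChar.comp (by fun_prop))
      exact this.aestronglyMeasurable
    · rw [Circle.norm_coe]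
  rw [stft_eq_integral_fourier, stft_eq_integral_fourier, stft_eq_integral_fourier,
    ← integral_const_mul, ← integral_add ((hint _).const_mul _) (hint _)]
  refine integral_congr_ae ?_
  filter_upwards [hq] with ζ hζ
  rw [hζ, FourierTransform.fourier_fourierInv_eq, idMul_apply]
  push_cast
  ring

theorem enorm_add_sq_le (a b : ℂ) : ‖a + b‖ₑ ^ 2 ≤ 2 * ‖a‖ₑ ^ 2 + 2 * ‖b‖ₑ ^ 2 := by
  rw [enorm_sq_eq_ofReal, enorm_sq_eq_ofReal, enorm_sq_eq_ofReal,
    show (2 : ℝ≥0∞) = ENNReal.ofReal 2 by simp, ← ENNReal.ofReal_mul zero_le_two,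
    ← ENNReal.ofReal_mul zero_le_two, ← ENNReal.ofReal_add (by positivity) (by positivity)]
  refine ENNReal.ofReal_le_ofReal ?_
  nlinarith [norm_add_le a b, norm_nonneg (a + b), sq_nonneg (‖a‖ - ‖b‖)]

theorem phaseNorm_le_of_eq_mul_add {n : ℕ} {h h₂ : 𝓢(ℝ, ℂ)} {p q : L2Line} (c : ℝ × ℝ → ℂ)
    (hc : ∀ z, ‖c z‖ₑ ≤ 1 + ‖z.1‖ₑ + ‖z.2‖ₑ)
    (hq : ∀ z, ‖stft h q z‖ₑ ^ 2 ≤ 2 * ‖c z * stft h p z‖ₑ ^ 2 + 2 * ‖stft h₂ p z‖ₑ ^ 2) :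
    phaseNorm n h q ≤ 2 * phaseNorm (n + 2) h p + 2 * phaseNorm (n + 2) h₂ p := by
  have hm := measurable_stft h p
  have hm₂ := measurable_stft h₂ p
  unfold phaseNorm
  rw [← lintegral_const_mul _ (by fun_prop), ← lintegral_const_mul _ (by fun_prop),
    ← lintegral_add_left (by fun_prop)]
  refine lintegral_mono fun z => ?_
  have h1 : 1 ≤ 1 + ‖z.1‖ₑ + ‖z.2‖ₑ := by rw [add_assoc]; exact le_self_add
  specialize hc z
  generalize 1 + ‖z.1‖ₑ + ‖z.2‖ₑ = w at h1 hc ⊢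
  calc w ^ n * ‖stft h q z‖ₑ ^ 2
      ≤ w ^ n * (2 * ‖c z * stft h p z‖ₑ ^ 2 + 2 * ‖stft h₂ p z‖ₑ ^ 2) := by gcongr; exact hq z
    _ = 2 * (w ^ n * ‖c z‖ₑ ^ 2 * ‖stft h p z‖ₑ ^ 2) + 2 * (w ^ n * 1 * ‖stft h₂ p z‖ₑ ^ 2) := by
        rw [enorm_mul]; ring
    _ ≤ 2 * (w ^ n * w ^ 2 * ‖stft h p z‖ₑ ^ 2) + 2 * (w ^ n * w ^ 2 * ‖stft h₂ p z‖ₑ ^ 2) := by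
        gcongr
        exact one_le_pow₀ h1
    _ = _ := by rw [pow_add]

/-- On phase space, multiplication by x is dominated by 1 + |x| + |ξ|, apart from a change of
window. It therefore costs two powers of the joint weight and keeps the frequency weight as well as
the position weight; this replaces an interpolation argument. -/
theorem BiWeighted.position_mul {n : ℕ} {p q : ℤ → L2Line} (hp : BiWeighted (n + 2) p)
    (hq : ∀ η, q η =ᵐ[volume] fun x => (x : ℂ) * p η x) : BiWeighted n q := by
  refine biWeighted_of_phaseNorm_lt_top fun h => ?_
  refine (ENNReal.tsum_le_tsum fun η => phaseNorm_le_of_eq_mul_add (h₂ := idMul h)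
    (p := p η) (fun z => (z.1 : ℂ)) (fun z => ?_) fun z => ?_).trans_lt ?_
  · rw [← ofReal_norm, Complex.norm_real, ofReal_norm, add_right_comm]
    exact le_add_self
  · rw [stft_position_mul h (hq η), sub_eq_add_neg, ← enorm_neg (stft (idMul h) (p η) z)]
    exact enorm_add_sq_le _ _
  · rw [ENNReal.tsum_add, ENNReal.tsum_mul_left, ENNReal.tsum_mul_left]
    exact ENNReal.add_lt_top.mpr ⟨ENNReal.mul_lt_top (by simp) (hp.phaseNorm_lt_top h),
      ENNReal.mul_lt_top (by simp) (hp.phaseNorm_lt_top _)⟩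

theorem BiWeighted.frequency_mul {n : ℕ} {p q : ℤ → L2Line} (hp : BiWeighted (n + 2) p)
    (hq : ∀ η, (𝓕 (q η) : L2Line) =ᵐ[volume] fun ξ => (ξ : ℂ) * (𝓕 (p η) : L2Line) ξ) :
    BiWeighted n q := by
  refine biWeighted_of_phaseNorm_lt_top fun h => ?_
  refine (ENNReal.tsum_le_tsum fun η => phaseNorm_le_of_eq_mul_add
    (h₂ := 𝓕⁻ (idMul (𝓕 h)))
    (p := p η) (fun z => (z.2 : ℂ)) (fun z => ?_) fun z => ?_).trans_lt ?_
  · rw [← ofReal_norm, Complex.norm_real, ofReal_norm]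
    exact le_add_self
  · rw [stft_frequency_mul h (hq η)]
    exact enorm_add_sq_le _ _
  · rw [ENNReal.tsum_add, ENNReal.tsum_mul_left, ENNReal.tsum_mul_left]
    exact ENNReal.add_lt_top.mpr ⟨ENNReal.mul_lt_top (by simp) (hp.phaseNorm_lt_top h),
      ENNReal.mul_lt_top (by simp) (hp.phaseNorm_lt_top _)⟩

theorem polyWeight_mono {m n : ℕ} (h : m ≤ n) (p : ℝ → ℂ) : polyWeight m p ≤ polyWeight n p :=
  lintegral_mono fun _ => mul_le_mul' (pow_le_pow_right₀ le_self_add h) le_rfl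

theorem polyWeight_zero (p : ℝ → ℂ) : polyWeight 0 p = ∫⁻ x, ‖p x‖ₑ ^ 2 := by
  simp [polyWeight]

theorem polyWeight_congr {n : ℕ} {p q : ℝ → ℂ} (h : p =ᵐ[volume] q) :
    polyWeight n p = polyWeight n q := by
  refine lintegral_congr_ae ?_
  filter_upwards [h] with x hx
  rw [hx]

theorem polyWeight_add_le (n : ℕ) {p q : ℝ → ℂ} (hp : Measurable p) :
    polyWeight n (fun x => p x + q x) ≤ 2 * polyWeight n p + 2 * polyWeight n q := by
  unfold polyWeight
  rw [← lintegral_const_mul _ (by fun_prop), ← lintegral_const_mul' _ _ (by simp),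
    ← lintegral_add_left (by fun_prop)]
  refine lintegral_mono fun x => ?_
  calc (1 + ‖x‖ₑ) ^ n * ‖p x + q x‖ₑ ^ 2
      ≤ (1 + ‖x‖ₑ) ^ n * (2 * ‖p x‖ₑ ^ 2 + 2 * ‖q x‖ₑ ^ 2) := by
        gcongr; exact enorm_add_sq_le _ _
    _ = _ := by ring

theorem polyWeight_const_mul (n : ℕ) (c : ℂ) (p : ℝ → ℂ) :
    polyWeight n (fun x => c * p x) = ‖c‖ₑ ^ 2 * polyWeight n p := by
  unfold polyWeight
  rw [← lintegral_const_mul' _ _ (by simp)]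
  refine lintegral_congr fun x => ?_
  rw [enorm_mul]
  ring

theorem memLp_two_iff {p : ℝ → ℂ} (hp : AEStronglyMeasurable p volume) :
    MemLp p 2 volume ↔ ∫⁻ x, ‖p x‖ₑ ^ 2 < ⊤ := by
  rw [MemLp, eLpNorm_lt_top_iff_lintegral_rpow_enorm_lt_top (by norm_num) (by norm_num)]
  simp [hp]

theorem BiWeighted.mono {m n : ℕ} (h : m ≤ n) {p : ℤ → L2Line} (hp : BiWeighted n p) :
    BiWeighted m p :=
  ⟨(ENNReal.tsum_le_tsum fun _ => polyWeight_mono h _).trans_lt hp.position,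
    (ENNReal.tsum_le_tsum fun _ => polyWeight_mono h _).trans_lt hp.frequency⟩

theorem BiWeighted.add {n : ℕ} {p q : ℤ → L2Line} (hp : BiWeighted n p) (hq : BiWeighted n q) :
    BiWeighted n fun η => p η + q η := by
  have aux : ∀ {a b : ℤ → L2Line}, ∑' η, polyWeight n (a η) < ⊤ → ∑' η, polyWeight n (b η) < ⊤ →
      ∑' η, polyWeight n (a η + b η : L2Line) < ⊤ := by
    intro a b ha hb
    refine (ENNReal.tsum_le_tsum (g := fun η => 2 * polyWeight n (a η) + 2 * polyWeight n (b η))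
      fun η => ?_).trans_lt ?_
    · rw [polyWeight_congr (Lp.coeFn_add (a η) (b η))]
      exact polyWeight_add_le n (measurable_coe_Lp _)
    · rw [ENNReal.tsum_add, ENNReal.tsum_mul_left, ENNReal.tsum_mul_left]
      exact ENNReal.add_lt_top.mpr ⟨ENNReal.mul_lt_top (by simp) ha, ENNReal.mul_lt_top (by simp) hb⟩
  refine ⟨aux hp.position hq.position, ?_⟩
  simp_rw [FourierAdd.fourier_add]
  exact aux hp.frequency hq.frequency

theorem BiWeighted.const_smul {n : ℕ} {p : ℤ → L2Line} (hp : BiWeighted n p) (c : ℂ) :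
    BiWeighted n fun η => c • p η := by
  have aux : ∀ {a : ℤ → L2Line}, ∑' η, polyWeight n (a η) < ⊤ →
      ∑' η, polyWeight n (c • a η : L2Line) < ⊤ := by
    intro a ha
    have : ∀ η, polyWeight n (c • a η : L2Line) = ‖c‖ₑ ^ 2 * polyWeight n (a η) := fun η => by
      rw [polyWeight_congr (Lp.coeFn_smul c (a η)), ← polyWeight_const_mul]
      rfl
    simp_rw [this]
    rw [ENNReal.tsum_mul_left]
    exact ENNReal.mul_lt_top (by simp) ha
  refine ⟨aux hp.position, ?_⟩
  simp_rw [FourierSMul.fourier_smul]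
  exact aux hp.frequency

theorem memLp_id_mul {p : L2Line} (hp : polyWeight 2 p < ⊤) :
    MemLp (fun x : ℝ => (x : ℂ) * p x) 2 volume := by
  have hm := measurable_coe_Lp p
  rw [memLp_two_iff (by fun_prop)]
  refine (lintegral_mono fun x => ?_).trans_lt hp
  rw [enorm_mul, mul_pow]
  gcongr
  rw [← ofReal_norm, Complex.norm_real, ofReal_norm]
  exact le_add_self

theorem BiWeighted.exists_position_mul {n : ℕ} {p : ℤ → L2Line} (hp : BiWeighted (n + 2) p)
    (c : ℂ) : ∃ q : ℤ → L2Line, BiWeighted n q ∧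
      ∀ η, q η =ᵐ[volume] fun x => c * (x : ℂ) * p η x := by
  have h : ∀ η, MemLp (fun x : ℝ => (x : ℂ) * p η x) 2 volume := fun η =>
    memLp_id_mul ((polyWeight_mono (by omega) _).trans_lt
      ((ENNReal.le_tsum η).trans_lt hp.position))
  refine ⟨fun η => c • (h η).toLp _,
    (hp.position_mul fun η => (h η).coeFn_toLp).const_smul c, fun η => ?_⟩
  filter_upwards [Lp.coeFn_smul c ((h η).toLp _), (h η).coeFn_toLp] with x h1 h2
  rw [h1, Pi.smul_apply, h2, smul_eq_mul, mul_assoc]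

/-- Each factor x costs two units, so after l ≤ k factors at least one unit is left, which is what
H^{1/2} needs. -/
theorem BiWeighted.exists_position_pow_mul {k : ℕ} {p : ℤ → L2Line}
    (hp : BiWeighted (2 * k + 1) p) (c : ℂ) {l : ℕ} (hl : l ≤ k) :
    ∃ q : ℤ → L2Line, BiWeighted (2 * (k - l) + 1) q ∧
      ∀ η, q η =ᵐ[volume] fun x => (c * (x : ℂ)) ^ l * p η x := by
  induction l with
  | zero => exact ⟨p, hp, fun η => by simp⟩
  | succ l ih =>
    obtain ⟨q, hq, hqe⟩ := ih (by omega)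
    rw [show 2 * (k - l) + 1 = 2 * (k - (l + 1)) + 1 + 2 by omega] at hq
    obtain ⟨r, hr, hre⟩ := hq.exists_position_mul c
    refine ⟨r, hr, fun η => ?_⟩
    filter_upwards [hqe η, hre η] with x h1 h2
    rw [h2, h1]
    ring

/-- Families that are almost everywhere the Fourier transforms of a `BiWeighted` family. -/
def FreqBiWeighted (n : ℕ) (G : ℤ → ℝ → ℂ) : Prop :=
  ∃ p : ℤ → L2Line, BiWeighted n p ∧ ∀ η, (𝓕 (p η) : L2Line) =ᵐ[volume] G η

namespace FreqBiWeighted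

variable {m n : ℕ} {G H : ℤ → ℝ → ℂ}

theorem congr (hG : FreqBiWeighted n G) (h : ∀ η, G η =ᵐ[volume] H η) : FreqBiWeighted n H := by
  obtain ⟨p, hp, hpe⟩ := hG
  exact ⟨p, hp, fun η => (hpe η).trans (h η)⟩

theorem mono (hG : FreqBiWeighted n G) (h : m ≤ n) : FreqBiWeighted m G := by
  obtain ⟨p, hp, hpe⟩ := hG
  exact ⟨p, hp.mono h, hpe⟩

theorem add (hG : FreqBiWeighted n G) (hH : FreqBiWeighted n H) :
    FreqBiWeighted n fun η ξ => G η ξ + H η ξ := by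
  obtain ⟨p, hp, hpe⟩ := hG
  obtain ⟨q, hq, hqe⟩ := hH
  refine ⟨_, hp.add hq, fun η => ?_⟩
  rw [FourierAdd.fourier_add]
  filter_upwards [hpe η, hqe η, Lp.coeFn_add (𝓕 (p η) : L2Line) (𝓕 (q η))] with ξ h1 h2 h3
  rw [h3, Pi.add_apply, h1, h2]

theorem const_mul (hG : FreqBiWeighted n G) (c : ℂ) :
    FreqBiWeighted n fun η ξ => c * G η ξ := by
  obtain ⟨p, hp, hpe⟩ := hG
  refine ⟨_, hp.const_smul c, fun η => ?_⟩
  rw [FourierSMul.fourier_smul]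
  filter_upwards [hpe η, Lp.coeFn_smul c (𝓕 (p η) : L2Line)] with ξ h1 h3
  rw [h3, Pi.smul_apply, h1, smul_eq_mul]

theorem id_mul (hG : FreqBiWeighted (n + 2) G) :
    FreqBiWeighted n fun η ξ => (ξ : ℂ) * G η ξ := by
  obtain ⟨p, hp, hpe⟩ := hG
  have h : ∀ η, MemLp (fun ξ : ℝ => (ξ : ℂ) * (𝓕 (p η) : L2Line) ξ) 2 volume := fun η =>
    memLp_id_mul ((polyWeight_mono (by omega) _).trans_lt
      ((ENNReal.le_tsum η).trans_lt hp.frequency))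
  have hq : ∀ η, (𝓕 (𝓕⁻ ((h η).toLp _ : L2Line) : L2Line) : L2Line) =ᵐ[volume]
      fun ξ => (ξ : ℂ) * (𝓕 (p η) : L2Line) ξ := fun η => by
    rw [FourierTransform.fourier_fourierInv_eq]
    exact (h η).coeFn_toLp
  refine ⟨_, hp.frequency_mul hq, fun η => ?_⟩
  filter_upwards [hq η, hpe η] with ξ h1 h2
  rw [h1, h2]

/-- Horner's scheme: c = X · `c.divX` + c(0), with two units spent per power of ξ. -/
theorem polynomial_mul {d : ℕ} (c : Polynomial ℂ) (hc : c.natDegree ≤ d)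
    (hG : FreqBiWeighted (n + 2 * d) G) :
    FreqBiWeighted n fun η ξ => c.eval (ξ : ℂ) * G η ξ := by
  induction d generalizing c G with
  | zero =>
    rw [Polynomial.eq_C_of_natDegree_eq_zero (Nat.le_zero.mp hc)]
    simpa using hG.const_mul (c.coeff 0)
  | succ d ih =>
    have h1 : FreqBiWeighted (n + 2 * d) fun η ξ => (ξ : ℂ) * G η ξ := id_mul hG
    have hd : c.divX.natDegree ≤ d := by
      rw [Polynomial.natDegree_divX_eq_natDegree_tsub_one]; omega
    refine ((ih c.divX hd h1).add ((hG.const_mul (c.coeff 0)).mono (by omega))).congr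
      fun η => Filter.Eventually.of_forall fun ξ => ?_
    conv_rhs => rw [← Polynomial.divX_mul_X_add c]
    simp only [Polynomial.eval_add, Polynomial.eval_mul, Polynomial.eval_X, Polynomial.eval_C]
    ring

theorem sum {ι : Type*} (s : Finset ι) {G : ι → ℤ → ℝ → ℂ} (hs : s.Nonempty)
    (hG : ∀ i ∈ s, FreqBiWeighted n (G i)) :
    FreqBiWeighted n fun η ξ => ∑ i ∈ s, G i η ξ := by
  induction hs using Finset.Nonempty.cons_induction with
  | singleton a => simpa using hG a (by simp)
  | cons a s ha hs ih =>
    simp only [Finset.sum_cons]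
    exact (hG a (by simp)).add (ih fun i hi => hG i (by simp [hi]))

theorem tsum_gagliardo_lt_top (hG : FreqBiWeighted n G) (hn : 1 ≤ n) :
    ∑' η, gagliardo (G η) < ⊤ := by
  obtain ⟨p, hp, hpe⟩ := hG
  have : ∀ η, gagliardo (G η) ≤ gagliardoConst * polyWeight n (p η) := fun η => by
    rw [← gagliardo_congr (hpe η), gagliardo_fourier]
    refine mul_le_mul' le_rfl (lintegral_mono fun x => mul_le_mul' ?_ le_rfl)
    refine le_trans le_add_self ((pow_one (1 + ‖x‖ₑ)).symm.le.trans ?_)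
    exact pow_le_pow_right₀ le_self_add hn
  refine (ENNReal.tsum_le_tsum this).trans_lt ?_
  rw [ENNReal.tsum_mul_left]
  exact ENNReal.mul_lt_top gagliardoConst_ne_top.lt_top hp.position

theorem tsum_polyWeight_lt_top (hG : FreqBiWeighted n G) : ∑' η, polyWeight n (G η) < ⊤ := by
  obtain ⟨p, hp, hpe⟩ := hG
  simp_rw [← polyWeight_congr (hpe _)]
  exact hp.frequency

/-- Here |ξ|²/|ξ| = |ξ|, which the frequency weight controls: a factor ξ removes the singularity. -/
theorem tsum_hardyIntegral_id_mul_lt_top (hG : FreqBiWeighted n G) (hn : 1 ≤ n) :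
    ∑' η, hardyIntegral (fun ξ => (ξ : ℂ) * G η ξ) < ⊤ := by
  refine (ENNReal.tsum_le_tsum fun η => ?_).trans_lt hG.tsum_polyWeight_lt_top
  refine lintegral_mono_ae ?_
  filter_upwards [ae_ne_zero] with ξ hξ
  rw [enorm_mul, ← ofReal_norm (ξ : ℂ), Complex.norm_real, ofReal_norm, mul_pow, ← mul_assoc]
  refine mul_le_mul' ?_ le_rfl
  have h0 : ‖ξ‖ₑ ≠ 0 := by simpa using hξ
  rw [sq, ← mul_assoc, ENNReal.inv_mul_cancel h0 enorm_ne_top, one_mul]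
  refine le_trans le_add_self ((pow_one (1 + ‖ξ‖ₑ)).symm.le.trans ?_)
  exact pow_le_pow_right₀ le_self_add hn

end FreqBiWeighted

/-! ### Hardy energy and the value at the origin. -/

theorem hardyIntegral_add_le {G H : ℝ → ℂ} (hG : AEMeasurable G volume) :
    hardyIntegral (fun ξ => G ξ + H ξ) ≤ 2 * hardyIntegral G + 2 * hardyIntegral H := by
  unfold hardyIntegral
  rw [← lintegral_const_mul'' _ (by fun_prop), ← lintegral_const_mul' _ _ (by simp),
    ← lintegral_add_left' (by fun_prop)]
  refine lintegral_mono fun x => ?_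
  calc _ ≤ ‖x‖ₑ⁻¹ * (2 * ‖G x‖ₑ ^ 2 + 2 * ‖H x‖ₑ ^ 2) := by
        gcongr; exact enorm_add_sq_le _ _
    _ = _ := by ring

theorem hardyIntegral_const_mul (c : ℂ) (G : ℝ → ℂ) :
    hardyIntegral (fun ξ => c * G ξ) = ‖c‖ₑ ^ 2 * hardyIntegral G := by
  unfold hardyIntegral
  rw [← lintegral_const_mul' _ _ (by simp)]
  refine lintegral_congr fun ξ => ?_
  rw [enorm_mul]
  ring

/-- Cauchy-Schwarz gives |G(ξ)|² ≤ |ξ| ∫|G'|², which bounds the integrand on [-1,1], an interval of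
length 2; outside, 1/|ξ| ≤ 1. -/
theorem hardyIntegral_le_of_hasDerivAt {G G' : ℝ → ℂ} (hd : ∀ ξ, HasDerivAt G (G' ξ) ξ)
    (hc : Continuous G') (h0 : G 0 = 0) :
    hardyIntegral G ≤ 2 * (∫⁻ ξ, ‖G' ξ‖ₑ ^ 2) + ∫⁻ ξ, ‖G ξ‖ₑ ^ 2 := by
  have hmeas : MeasurableSet (Set.Icc (-1 : ℝ) 1) := measurableSet_Icc
  have hnear : ∀ ξ : ℝ, ξ ≠ 0 → ‖ξ‖ₑ⁻¹ * ‖G ξ‖ₑ ^ 2 ≤ ∫⁻ ξ, ‖G' ξ‖ₑ ^ 2 := by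
    intro ξ hξ
    have hne : ‖ξ‖ₑ ≠ 0 := by simpa using hξ
    have h1 : G ξ = ∫ u in (0 : ℝ)..ξ, G' u := by
      rw [intervalIntegral.integral_eq_sub_of_hasDerivAt (fun x _ => hd x)
        (hc.intervalIntegrable _ _), h0, sub_zero]
    have h2 : ‖G ξ‖ₑ ≤ eLpNorm G' 1 (volume.restrict (Set.uIoc 0 ξ)) := by
      rw [eLpNorm_one_eq_lintegral_enorm, h1, ← ofReal_norm,
        intervalIntegral.norm_integral_eq_norm_integral_uIoc, ofReal_norm]
      exact enorm_integral_le_lintegral_enorm _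
    have h3 := eLpNorm_le_eLpNorm_mul_rpow_measure_univ (p := 1) (q := 2)
      (μ := volume.restrict (Set.uIoc 0 ξ)) (by norm_num) hc.aestronglyMeasurable
    have h4 : volume.restrict (Set.uIoc 0 ξ) Set.univ = ‖ξ‖ₑ := by
      rw [Measure.restrict_apply_univ, Real.enorm_eq_ofReal_abs, Set.uIoc, Real.volume_Ioc,
        max_sub_min_eq_abs', zero_sub, abs_neg]
    have h5 : (eLpNorm G' 2 (volume.restrict (Set.uIoc 0 ξ))) ^ 2 ≤ ∫⁻ ξ, ‖G' ξ‖ₑ ^ 2 := by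
      rw [eLpNorm_eq_lintegral_rpow_enorm_toReal (by norm_num) (by norm_num),
        ← ENNReal.rpow_natCast, ← ENNReal.rpow_mul]
      simp only [ENNReal.toReal_ofNat, ENNReal.rpow_ofNat]
      norm_num
      exact setLIntegral_le_lintegral _ _
    have h6 : ‖G ξ‖ₑ ^ 2 ≤ (∫⁻ ξ, ‖G' ξ‖ₑ ^ 2) * ‖ξ‖ₑ := by
      calc ‖G ξ‖ₑ ^ 2 ≤ (eLpNorm G' 2 (volume.restrict (Set.uIoc 0 ξ)) *
            ‖ξ‖ₑ ^ ((1 : ℝ) / 2)) ^ 2 := by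
            gcongr
            refine h2.trans (h3.trans_eq ?_)
            rw [h4]; norm_num
        _ = (eLpNorm G' 2 (volume.restrict (Set.uIoc 0 ξ))) ^ 2 * ‖ξ‖ₑ := by
            rw [mul_pow, ← ENNReal.rpow_natCast (‖ξ‖ₑ ^ ((1 : ℝ) / 2)), ← ENNReal.rpow_mul]
            norm_num
        _ ≤ _ := by gcongr
    calc ‖ξ‖ₑ⁻¹ * ‖G ξ‖ₑ ^ 2 ≤ ‖ξ‖ₑ⁻¹ * ((∫⁻ ξ, ‖G' ξ‖ₑ ^ 2) * ‖ξ‖ₑ) := by gcongr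
      _ = (∫⁻ ξ, ‖G' ξ‖ₑ ^ 2) * (‖ξ‖ₑ⁻¹ * ‖ξ‖ₑ) := by ring
      _ = _ := by rw [ENNReal.inv_mul_cancel hne enorm_ne_top, mul_one]
  rw [hardyIntegral, ← lintegral_add_compl _ hmeas]
  refine add_le_add ?_ ?_
  · calc ∫⁻ ξ in Set.Icc (-1 : ℝ) 1, ‖ξ‖ₑ⁻¹ * ‖G ξ‖ₑ ^ 2
        ≤ ∫⁻ _ in Set.Icc (-1 : ℝ) 1, ∫⁻ ξ, ‖G' ξ‖ₑ ^ 2 := by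
          refine lintegral_mono_ae ?_
          filter_upwards [ae_restrict_of_ae ae_ne_zero] with ξ hξ using hnear ξ hξ
      _ = _ := by
          rw [setLIntegral_const, Real.volume_Icc, mul_comm]
          norm_num
  · refine (setLIntegral_mono_ae' hmeas.compl (Filter.Eventually.of_forall fun ξ hξ => ?_)).trans
      (setLIntegral_le_lintegral _ _)
    have h1 : 1 ≤ ‖ξ‖ₑ := by
      rw [Real.enorm_eq_ofReal_abs, ← ENNReal.ofReal_one]
      refine ENNReal.ofReal_le_ofReal (le_of_not_ge fun h => hξ (abs_le.mp h))
    calc ‖ξ‖ₑ⁻¹ * ‖G ξ‖ₑ ^ 2 ≤ 1 * ‖G ξ‖ₑ ^ 2 := by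
          gcongr
          exact ENNReal.inv_le_one.mpr h1
      _ = _ := one_mul _

/-- Otherwise |G| is bounded below near 0, where 1/|ξ| is not integrable. -/
theorem apply_zero_eq_zero_of_hardyIntegral_lt_top {G : ℝ → ℂ} (hG : Continuous G)
    (h : hardyIntegral G < ⊤) : G 0 = 0 := by
  by_contra h0
  have hpos : 0 < ‖G 0‖ := norm_pos_iff.mpr h0
  have hev : ∀ᶠ ξ in nhds (0 : ℝ), ‖G 0‖ / 2 < ‖G ξ‖ :=
    hG.norm.continuousAt.eventually_const_lt (by linarith)
  obtain ⟨δ, hδ, hball⟩ := Metric.eventually_nhds_iff_ball.mp hev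
  have hni : ¬ IntervalIntegrable (fun x : ℝ => x⁻¹) volume 0 (δ / 2) := by
    rw [intervalIntegrable_inv_iff]
    have : (0 : ℝ) ∈ Set.uIcc 0 (δ / 2) := Set.left_mem_uIcc
    rintro (h | h)
    · linarith
    · exact h this
  apply hni
  rw [intervalIntegrable_iff_integrableOn_Ioc_of_le (by linarith)]
  refine ⟨(measurable_inv.aestronglyMeasurable), ?_⟩
  rw [hasFiniteIntegral_iff_enorm]
  have hc : ENNReal.ofReal (‖G 0‖ / 2) ^ 2 ≠ 0 := by
    simpa using hpos
  have hle : ENNReal.ofReal (‖G 0‖ / 2) ^ 2 * ∫⁻ ξ in Set.Ioc 0 (δ / 2), ‖ξ⁻¹‖ₑ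
      ≤ hardyIntegral G := by
    rw [← lintegral_const_mul' _ _ (by simp)]
    refine (setLIntegral_mono_ae' measurableSet_Ioc
      (Filter.Eventually.of_forall fun ξ hξ => ?_)).trans (setLIntegral_le_lintegral _ _)
    rw [enorm_inv hξ.1.ne', mul_comm]
    gcongr
    rw [← ofReal_norm]
    refine ENNReal.ofReal_le_ofReal (hball ξ ?_).le
    rw [Metric.mem_ball, Real.dist_0_eq_abs, abs_of_pos hξ.1]
    linarith [hξ.2]
  exact ENNReal.lt_top_of_mul_ne_top_right (hle.trans_lt h).ne hc

/-! ### Derivatives of the Fourier transform of a weighted function -/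

/-- Both (1 + |x|)^k p and (1 + |x|)^{-1} are in L². Spending one power on integrability is why l <
k must be strict. -/
theorem integrable_pow_mul_of_polyWeight {p : ℝ → ℂ} (hp : Measurable p) {k l : ℕ} (hl : l < k)
    (h : polyWeight (2 * k) p < ⊤) (c : ℂ) :
    Integrable (fun x : ℝ => (c * (x : ℂ)) ^ l * p x) volume := by
  have h1 : MemLp (fun x : ℝ => (((1 + |x|) ^ k : ℝ) : ℂ) * p x) 2 volume := by
    rw [memLp_two_iff (by fun_prop)]
    refine lt_of_le_of_lt (le_of_eq (lintegral_congr fun x => ?_)) h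
    rw [enorm_mul, mul_pow, ← ofReal_norm, Complex.norm_real, ofReal_norm, enorm_pow, ← pow_mul,
      mul_comm k 2]
    congr 2
    rw [Real.enorm_of_nonneg (by positivity), ENNReal.ofReal_add zero_le_one (abs_nonneg _),
      ENNReal.ofReal_one, Real.enorm_eq_ofReal_abs]
  have h2 : MemLp (fun x : ℝ => (((1 + |x|)⁻¹ : ℝ) : ℂ)) 2 volume := by
    rw [memLp_two_iff_integrable_sq_norm (by fun_prop)]
    refine integrable_inv_one_add_sq.mono' (by fun_prop) (Filter.Eventually.of_forall fun x => ?_)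
    rw [Complex.norm_real, Real.norm_of_nonneg (by positivity), Real.norm_of_nonneg (by positivity),
      inv_pow]
    refine inv_anti₀ (by positivity) ?_
    nlinarith [abs_nonneg x, sq_abs x]
  have h3 := (h1.integrable_mul h2).norm.const_mul (‖c‖ ^ l)
  refine h3.mono' (by fun_prop) (Filter.Eventually.of_forall fun x => ?_)
  have hx : 0 < 1 + |x| := by positivity
  simp only [Pi.mul_apply, norm_mul, norm_pow, Complex.norm_real, Real.norm_eq_abs]
  rw [abs_of_pos hx, abs_of_pos (inv_pos.mpr hx), mul_pow, mul_assoc]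
  refine mul_le_mul_of_nonneg_left ?_ (by positivity)
  have hkl : (1 + |x|) ^ k * (1 + |x|)⁻¹ = (1 + |x|) ^ (k - 1) := by
    obtain ⟨m, rfl⟩ : ∃ m, k = m + 1 := ⟨k - 1, by omega⟩
    rw [pow_succ, mul_assoc, mul_inv_cancel₀ hx.ne', mul_one, Nat.add_sub_cancel]
  calc |x| ^ l * ‖p x‖ ≤ (1 + |x|) ^ (k - 1) * ‖p x‖ := by
        gcongr ?_ * _
        calc |x| ^ l ≤ (1 + |x|) ^ l := by gcongr; linarith
          _ ≤ _ := pow_le_pow_right₀ (by linarith [abs_nonneg x]) (by omega)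
    _ = _ := by rw [← hkl]; ring

theorem integral_mul_fourier {φ : ℝ → ℂ} (h1 : Integrable φ) (h2 : MemLp φ 2 volume)
    (q : L2Line) : ∫ ξ, φ ξ * (𝓕 q : L2Line) ξ = ∫ x, 𝓕 φ x * q x := by
  have hF2 : MemLp (𝓕 φ) 2 volume :=
    (Lp.memLp (𝓕 (h2.toLp φ) : L2Line)).ae_eq (fourier_toLp_ae h1 h2)
  have pair : ∀ {a : ℝ → ℂ} (ha : MemLp a 2 volume) (b : L2Line),
      ∫ x, a x * b x = inner ℂ (ha.star.toLp _) b := fun {a} ha b => by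
    rw [L2.inner_def]
    refine integral_congr_ae ?_
    filter_upwards [ha.star.coeFn_toLp] with x hx
    rw [hx, RCLike.inner_apply, Pi.star_apply, RCLike.star_def, Complex.conj_conj, mul_comm]
  rw [pair h2, pair hF2]
  suffices (fun q : L2Line => inner ℂ (h2.star.toLp (star φ)) (𝓕 q : L2Line)) =
      fun q : L2Line => inner ℂ (hF2.star.toLp (star (𝓕 φ))) q from congrFun this q
  refine DenseRange.equalizer (SchwartzMap.denseRange_toLpCLM (F := ℂ)
    (E := ℝ) (μ := volume) (p := 2) (by simp)) ?_ ?_ ?_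
  · exact continuous_const.inner ((Lp.fourierTransformₗᵢ ℝ ℂ).continuous)
  · exact continuous_const.inner continuous_id
  · ext ψ
    simp only [Function.comp_apply, SchwartzMap.toLpCLM_apply]
    rw [← pair h2, ← pair hF2, SchwartzMap.toLp_fourier_eq]
    have e1 : ∫ x, φ x * ((𝓕 ψ).toLp 2 : L2Line) x = ∫ x, φ x * 𝓕 (ψ : ℝ → ℂ) x := by
      refine integral_congr_ae ?_
      filter_upwards [(𝓕 ψ).coeFn_toLp 2] with x hx
      rw [hx, SchwartzMap.fourier_coe]
    have e2 : ∫ x, 𝓕 φ x * (ψ.toLp 2 : L2Line) x = ∫ x, 𝓕 φ x * ψ x := by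
      refine integral_congr_ae ?_
      filter_upwards [ψ.coeFn_toLp 2] with x hx
      rw [hx]
    rw [e1, e2]
    have := VectorFourier.integral_fourierIntegral_smul_eq_flip (L := innerₗ ℝ)
      (μ := volume) (ν := volume) Real.continuous_fourierChar (innerSL ℝ (E := ℝ)).continuous₂
      h1 (ψ.integrable (μ := volume))
    rw [flip_innerₗ] at this
    simp only [smul_eq_mul] at this
    exact this.symm

theorem fourier_indicator_Ioc_mul (a b x : ℝ) (hab : a ≤ b) :
    𝓕 (Set.indicator (Set.Ioc a b) fun _ => (1 : ℂ)) x * (-2 * Real.pi * Complex.I * x) =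
      (𝐞 (-(x * b)) : ℂ) - 𝐞 (-(x * a)) := by
  have h1 : 𝓕 (Set.indicator (Set.Ioc a b) fun _ => (1 : ℂ)) x
      = ∫ v in a..b, (𝐞 (-(v * x)) : ℂ) := by
    rw [Real.fourier_real_eq, intervalIntegral.integral_of_le hab,
      ← integral_indicator measurableSet_Ioc]
    refine integral_congr_ae (Filter.Eventually.of_forall fun v => ?_)
    by_cases hv : v ∈ Set.Ioc a b <;> simp [hv, Circle.smul_def]
  have hd : ∀ v : ℝ, HasDerivAt (fun v : ℝ => (𝐞 (-(v * x)) : ℂ))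
      ((𝐞 (-(v * x)) : ℂ) * (-2 * Real.pi * Complex.I * x)) v := fun v => by
    have := (Real.hasDerivAt_fourierChar (-(v * x))).scomp v
      (((hasDerivAt_id v).mul_const x).neg)
    simp only [Function.comp_def, id_eq, one_mul] at this
    refine this.congr_deriv ?_
    rw [Complex.real_smul]
    push_cast
    ring
  have hcont : Continuous fun v : ℝ => (𝐞 (-(v * x)) : ℂ) :=
    continuous_subtype_val.comp (Real.continuous_fourierChar.comp (by fun_prop))
  rw [h1, ← intervalIntegral.integral_mul_const,
    intervalIntegral.integral_eq_sub_of_hasDerivAt (fun v _ => hd v)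
      ((hcont.mul continuous_const).intervalIntegrable _ _), mul_comm b, mul_comm a]

/-- The fundamental theorem of calculus for a derivative that is only in L²: pair 𝓕 q with the
indicator of (a,b], whose transform has denominator -2πix and cancels the factor in q. -/
theorem integral_fourier_eq_sub {g : ℝ → ℂ} (hg : Integrable g) {q : L2Line}
    (hq : q =ᵐ[volume] fun x => (-2 * Real.pi * Complex.I * x) * g x) (a b : ℝ) :
    ∫ ξ in a..b, (𝓕 q : L2Line) ξ = 𝓕 g b - 𝓕 g a := by
  wlog hab : a ≤ b generalizing a b
  · rw [intervalIntegral.integral_symm, this b a (by linarith), neg_sub]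
  have hfin : volume (Set.Ioc a b) ≠ ⊤ := by simp
  have i1 : Integrable (Set.indicator (Set.Ioc a b) fun _ => (1 : ℂ)) volume :=
    (integrable_indicator_iff measurableSet_Ioc).mpr (integrableOn_const hfin)
  have i2 : MemLp (Set.indicator (Set.Ioc a b) fun _ => (1 : ℂ)) 2 volume :=
    memLp_indicator_const 2 measurableSet_Ioc 1 (Or.inr hfin)
  have h := integral_mul_fourier i1 i2 q
  have hl : ∫ ξ, Set.indicator (Set.Ioc a b) (fun _ => (1 : ℂ)) ξ * (𝓕 q : L2Line) ξ
      = ∫ ξ in a..b, (𝓕 q : L2Line) ξ := by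
    rw [intervalIntegral.integral_of_le hab, ← integral_indicator measurableSet_Ioc]
    refine integral_congr_ae (Filter.Eventually.of_forall fun v => ?_)
    by_cases hv : v ∈ Set.Ioc a b <;> simp [hv]
  rw [← hl, h, Real.fourier_real_eq, Real.fourier_real_eq,
    ← integral_sub ((Real.fourierIntegral_convergent_iff b).mpr hg |>.congr ?_)
      ((Real.fourierIntegral_convergent_iff a).mpr hg |>.congr ?_)]
  · refine integral_congr_ae ?_
    filter_upwards [hq] with x hx
    rw [hx, ← mul_assoc, fourier_indicator_Ioc_mul a b x hab]
    simp only [Circle.smul_def, smul_eq_mul]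
    ring
  · exact Filter.Eventually.of_forall fun x => by simp [mul_comm]
  · exact Filter.Eventually.of_forall fun x => by simp [mul_comm]

/-- Sequences of successive derivatives: `A 0, …, A (k - 1)` are continuous, and the last
derivative `A k` of `A (k - 1)` is only taken almost everywhere. -/
structure DerivSeq (k : ℕ) (A : ℕ → ℝ → ℂ) : Prop where
  measurable : ∀ l, Measurable (A l)
  continuous : ∀ l < k, Continuous (A l)
  hasDerivAt : ∀ l, l + 1 < k → ∀ ξ, HasDerivAt (A l) (A (l + 1) ξ) ξ
  ae_hasDerivAt : ∀ l, l + 1 = k → ∀ᵐ ξ, HasDerivAt (A l) (A (l + 1) ξ) ξ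

/-- Below order k the integrals converge and can be differentiated under the integral sign. At order
k only an L² transform exists; it is the derivative almost everywhere by Lebesgue differentiation.
-/
theorem exists_derivSeq (k : ℕ) (p : L2Line) (hp : polyWeight (2 * k) p < ⊤) :
    ∃ A : ℕ → ℝ → ℂ, DerivSeq k A ∧
      (∀ l ≤ k, ∀ q : L2Line, q =ᵐ[volume] (fun x => (-2 * Real.pi * Complex.I * x) ^ l * p x) →
        (𝓕 q : L2Line) =ᵐ[volume] A l) ∧
      ∀ l < k, A l 0 = ∫ x : ℝ, (-2 * Real.pi * Complex.I * x) ^ l * p x := by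
  have hpm := measurable_coe_Lp p
  have hint : ∀ l < k, Integrable fun x : ℝ => (-2 * Real.pi * Complex.I * x) ^ l * p x :=
    fun l hl => integrable_pow_mul_of_polyWeight hpm hl hp _
  have htop : MemLp (fun x : ℝ => (-2 * Real.pi * Complex.I * x) ^ k * p x) 2 volume := by
    rw [memLp_two_iff (by fun_prop)]
    have : polyWeight (2 * k) (fun x => (-2 * Real.pi * Complex.I) ^ k * p x) < ⊤ := by
      rw [polyWeight_const_mul]
      exact ENNReal.mul_lt_top (ENNReal.pow_lt_top enorm_lt_top) hp
    refine (lintegral_mono fun x => ?_).trans_lt this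
    rw [mul_pow, mul_assoc, mul_left_comm, enorm_mul, mul_pow]
    refine mul_le_mul' ?_ le_rfl
    rw [enorm_pow, ← pow_mul, mul_comm k 2, ← ofReal_norm, Complex.norm_real, ofReal_norm]
    gcongr
    exact le_add_self
  -- For l > k the value repeats the transform of order k; there it only has to be measurable.
  set A : ℕ → ℝ → ℂ := fun l => if l < k then
    𝓕 (fun x : ℝ => (-2 * Real.pi * Complex.I * x) ^ l * p x) else (𝓕 (htop.toLp _) : L2Line)
    with hA
  have hlt : ∀ l < k, A l = 𝓕 (fun x : ℝ => (-2 * Real.pi * Complex.I * x) ^ l * p x) :=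
    fun l hl => by rw [hA]; simp only [if_pos hl]
  have heq : A k = (𝓕 (htop.toLp _) : L2Line) := by rw [hA]; simp only [lt_irrefl, if_false]
  have hsucc : ∀ (l : ℕ) (x : ℝ), (-2 * Real.pi * Complex.I * x : ℂ) ^ (l + 1) * p x =
      (-2 * Real.pi * Complex.I * x) * ((-2 * Real.pi * Complex.I * x) ^ l * p x) :=
    fun l x => by ring
  have hcont : ∀ l < k, Continuous (A l) := fun l hl => by
    rw [hlt l hl]; exact continuous_fourier_of_integrable (hint l hl)
  refine ⟨A, ⟨fun l => ?_, hcont, fun l hl ξ => ?_, fun l hl => ?_⟩, fun l hl q hq => ?_,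
    fun l hl => ?_⟩
  · by_cases hl : l < k
    · exact (hcont l hl).measurable
    · rw [hA]; simp only [if_neg hl]
      exact measurable_coe_Lp _
  · rw [hlt l (by omega), hlt (l + 1) hl]
    have h1 := hint (l + 1) hl
    simp_rw [hsucc] at h1 ⊢
    refine Real.hasDerivAt_fourier (hint l (by omega)) ?_ ξ
    refine (h1.const_mul (-2 * Real.pi * Complex.I)⁻¹).congr
      (Filter.Eventually.of_forall fun x => ?_)
    have hne : (-2 * Real.pi * Complex.I : ℂ) ≠ 0 := by simp [Real.pi_ne_zero]
    beta_reduce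
    rw [Complex.real_smul, mul_assoc _ (x : ℂ), inv_mul_cancel_left₀ hne]
  · rw [hl, heq, hlt l (by omega)]
    set g : ℝ → ℂ := fun x : ℝ => (-2 * Real.pi * Complex.I * x) ^ l * p x with hg
    have hq : htop.toLp _ =ᵐ[volume] fun x => (-2 * Real.pi * Complex.I * x) * g x := by
      filter_upwards [htop.coeFn_toLp] with x hx
      rw [hx, ← hl, hsucc]
    have hloc : LocallyIntegrable (𝓕 (htop.toLp _) : L2Line) volume :=
      (Lp.memLp _).locallyIntegrable one_le_two
    filter_upwards [LocallyIntegrable.ae_hasDerivAt_integral hloc] with ξ hξ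
    have h2 := (hξ 0).const_add (𝓕 g 0)
    refine h2.congr_of_eventuallyEq (Filter.Eventually.of_forall fun u => ?_)
    change 𝓕 g u = 𝓕 g 0 + ∫ t in (0 : ℝ)..u, (𝓕 (htop.toLp _) : L2Line) t
    rw [integral_fourier_eq_sub (hint l (by omega)) hq]
    ring
  · rcases hl.lt_or_eq with hl | rfl
    · have h2 : MemLp (fun x : ℝ => (-2 * Real.pi * Complex.I * x) ^ l * p x) 2 volume :=
        (Lp.memLp q).ae_eq hq
      have : q = h2.toLp _ := by
        refine Lp.ext (hq.trans h2.coeFn_toLp.symm)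
      rw [hlt l hl, this]
      exact fourier_toLp_ae (hint l hl) h2
    · have : q = htop.toLp _ := Lp.ext (hq.trans htop.coeFn_toLp.symm)
      rw [heq, this]
  · rw [hlt l hl, Real.fourier_real_eq]
    simp

/-! ### Derivatives of products with a Gaussian -/

/-- The polynomials `q j` with `(e^{aξ²/2})^{(j)} = q j(ξ) e^{aξ²/2}`. -/
noncomputable def gaussPoly (a : ℂ) : ℕ → Polynomial ℂ
  | 0 => 1
  | j + 1 => Polynomial.derivative (gaussPoly a j) + Polynomial.C a * Polynomial.X * gaussPoly a j

theorem natDegree_gaussPoly_le (a : ℂ) (j : ℕ) : (gaussPoly a j).natDegree ≤ j := by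
  induction j with
  | zero => simp [gaussPoly]
  | succ j ih =>
    rw [gaussPoly]
    refine (Polynomial.natDegree_add_le _ _).trans (max_le ?_ ?_)
    · exact (Polynomial.natDegree_derivative_le _).trans (by omega)
    · refine Polynomial.natDegree_mul_le.trans ?_
      have : (Polynomial.C a * Polynomial.X).natDegree ≤ 1 := by
        simpa using Polynomial.natDegree_C_mul_X_pow_le a 1
      omega

theorem gaussPoly_one (a : ℂ) : gaussPoly a 1 = Polynomial.C a * Polynomial.X := by
  simp [gaussPoly]

theorem gaussPoly_two_eval_zero (a : ℂ) : (gaussPoly a 2).eval 0 = a := by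
  simp [gaussPoly]

/-- `∑ (n choose l) q_{n-l}(ξ) B_l(ξ)`, the `n`-th derivative of `e^{aξ²/2} B_0` divided by
`e^{aξ²/2}` when `B_l` is the `l`-th derivative of `B_0`. -/
noncomputable def gaussLeibniz (a : ℂ) (B : ℕ → ℝ → ℂ) (n : ℕ) (ξ : ℝ) : ℂ :=
  ∑ ij ∈ Finset.HasAntidiagonal.antidiagonal n, (n.choose ij.1 : ℂ) * ((gaussPoly a ij.2).eval (ξ : ℂ) * B ij.1 ξ)

/-- Pascal's rule together with the recursion for q_j. The subtracted term is the one that cancels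
the derivative of the Gaussian factor. -/
theorem hasDerivAt_gaussLeibniz (a : ℂ) {B : ℕ → ℝ → ℂ} {n : ℕ} {ξ : ℝ}
    (hB : ∀ l ≤ n, HasDerivAt (B l) (B (l + 1) ξ) ξ) :
    HasDerivAt (gaussLeibniz a B n)
      (gaussLeibniz a B (n + 1) ξ - a * ξ * gaussLeibniz a B n ξ) ξ := by
  have h1 : HasDerivAt (gaussLeibniz a B n) (∑ ij ∈ Finset.HasAntidiagonal.antidiagonal n, (n.choose ij.1 : ℂ) *
      ((gaussPoly a ij.2).derivative.eval (ξ : ℂ) * B ij.1 ξ +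
        (gaussPoly a ij.2).eval (ξ : ℂ) * B (ij.1 + 1) ξ)) ξ := by
    refine HasDerivAt.fun_sum fun ij hij => HasDerivAt.const_mul _ ?_
    have hp := ((gaussPoly a ij.2).hasDerivAt (ξ : ℂ)).comp_ofReal
    exact hp.mul (hB ij.1 (Finset.HasAntidiagonal.antidiagonal.fst_le hij))
  refine h1.congr_deriv ?_
  have h2 := Finset.sum_antidiagonal_choose_succ_mul
    (fun i j => (gaussPoly a j).eval (ξ : ℂ) * B i ξ) n
  unfold gaussLeibniz
  rw [h2, Finset.mul_sum, ← Finset.sum_add_distrib, ← Finset.sum_sub_distrib]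
  refine Finset.sum_congr rfl fun ij hij => ?_
  have h3 : n.choose ij.2 = n.choose ij.1 := by
    rw [← Finset.HasAntidiagonal.mem_antidiagonal.mp hij, Nat.choose_symm_add]
  rw [h3, gaussPoly]
  simp only [Polynomial.eval_add, Polynomial.eval_mul, Polynomial.eval_C, Polynomial.eval_X]
  ring

theorem eq_gaussLeibniz_succ {a : ℂ} {B : ℕ → ℝ → ℂ} {n : ℕ} {ξ : ℝ} {F g : ℝ → ℂ} {F' : ℂ}
    (hB : ∀ l ≤ n, HasDerivAt (B l) (B (l + 1) ξ) ξ) (hg : HasDerivAt g (a * ξ * g ξ) ξ)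
    (hF : HasDerivAt F F' ξ) (h : F =ᶠ[nhds ξ] fun u => g u * gaussLeibniz a B n u) :
    F' = g ξ * gaussLeibniz a B (n + 1) ξ := by
  have h1 := (hg.mul (hasDerivAt_gaussLeibniz a hB)).congr_of_eventuallyEq h
  rw [hF.unique h1]
  ring

/-- The function `c e^{aξ²/2}`. -/
noncomputable def gauss (c a : ℂ) (ξ : ℝ) : ℂ := c * Complex.exp (a * (ξ : ℂ) ^ 2 / 2)

theorem hasDerivAt_gauss (c a : ℂ) (ξ : ℝ) : HasDerivAt (gauss c a) (a * ξ * gauss c a ξ) ξ := by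
  have h1 : HasDerivAt (fun z : ℂ => c * Complex.exp (a * z ^ 2 / 2))
      (a * ξ * (c * Complex.exp (a * (ξ : ℂ) ^ 2 / 2))) (ξ : ℂ) := by
    have h2 : HasDerivAt (fun z : ℂ => a * z ^ 2 / 2) (a * ξ) (ξ : ℂ) := by
      refine (((hasDerivAt_pow 2 (ξ : ℂ)).const_mul a).div_const 2).congr_deriv ?_
      push_cast
      ring
    refine (h2.cexp.const_mul c).congr_deriv ?_
    ring
  exact h1.comp_ofReal

theorem continuous_gauss (c a : ℂ) : Continuous (gauss c a) :=
  continuous_iff_continuousAt.mpr fun ξ => (hasDerivAt_gauss c a ξ).continuousAt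

theorem gauss_zero (c a : ℂ) : gauss c a 0 = c := by simp [gauss]

theorem continuous_gaussLeibniz (a : ℂ) {B : ℕ → ℝ → ℂ} {n : ℕ}
    (hB : ∀ l ≤ n, Continuous (B l)) : Continuous (gaussLeibniz a B n) := by
  unfold gaussLeibniz
  refine continuous_finsetSum _ fun ij hij => ?_
  have h1 := hB ij.1 (Finset.HasAntidiagonal.antidiagonal.fst_le hij)
  have h2 : Continuous fun ξ : ℝ => (gaussPoly a ij.2).eval (ξ : ℂ) :=
    (gaussPoly a ij.2).continuous.comp Complex.continuous_ofReal
  fun_prop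

theorem measurable_gaussLeibniz (a : ℂ) {B : ℕ → ℝ → ℂ} (n : ℕ)
    (hB : ∀ l, Measurable (B l)) : Measurable (gaussLeibniz a B n) := by
  unfold gaussLeibniz
  refine Finset.measurable_fun_sum _ fun ij _ => ?_
  have h1 := hB ij.1
  have h2 : Continuous fun ξ : ℝ => (gaussPoly a ij.2).eval (ξ : ℂ) :=
    (gaussPoly a ij.2).continuous.comp Complex.continuous_ofReal
  have := h2.measurable
  fun_prop

section HalfLine

variable {k : ℕ} {A B : ℕ → ℝ → ℂ} {c a : ℂ} {O : Set ℝ}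

theorem DerivSeq.eqOn_gaussLeibniz (hA : DerivSeq k A) (hB : DerivSeq k B) (hO : IsOpen O)
    (h0 : ∀ᵐ ξ, ξ ∈ O → A 0 ξ = gauss c a ξ * B 0 ξ) {n : ℕ} (hn : n < k) :
    ∀ ξ ∈ O, A n ξ = gauss c a ξ * gaussLeibniz a B n ξ := by
  induction n with
  | zero =>
    have h1 : A 0 =ᵐ[volume.restrict O] fun ξ => gauss c a ξ * B 0 ξ :=
      (ae_restrict_iff' hO.measurableSet).mpr h0
    have h2 := Measure.eqOn_open_of_ae_eq h1 hO (hA.continuous 0 hn).continuousOn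
      ((continuous_gauss c a).mul (hB.continuous 0 hn)).continuousOn
    intro ξ hξ
    rw [h2 hξ]
    simp [gaussLeibniz, gaussPoly]
  | succ n ih =>
    intro ξ hξ
    refine eq_gaussLeibniz_succ (fun l hl => hB.hasDerivAt l (by omega) ξ)
      (hasDerivAt_gauss c a ξ) (hA.hasDerivAt n hn ξ) ?_
    filter_upwards [hO.mem_nhds hξ] with u hu using ih (by omega) u hu

/-- The identity of order k - 1 holds on all of the open set, so it can be differentiated once more
at each point where both top derivatives exist. -/
theorem DerivSeq.ae_eq_gaussLeibniz (hA : DerivSeq k A) (hB : DerivSeq k B) (hO : IsOpen O)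
    (h0 : ∀ᵐ ξ, ξ ∈ O → A 0 ξ = gauss c a ξ * B 0 ξ) :
    ∀ᵐ ξ, ξ ∈ O → A k ξ = gauss c a ξ * gaussLeibniz a B k ξ := by
  rcases Nat.eq_zero_or_pos k with rfl | hk
  · filter_upwards [h0] with ξ h hξ
    rw [h hξ]
    simp [gaussLeibniz, gaussPoly]
  · obtain ⟨n, rfl⟩ : ∃ n, k = n + 1 := ⟨k - 1, by omega⟩
    filter_upwards [hA.ae_hasDerivAt n rfl, hB.ae_hasDerivAt n rfl] with ξ h1 h2 hξ
    refine eq_gaussLeibniz_succ (fun l hl => ?_) (hasDerivAt_gauss c a ξ) h1 ?_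
    · rcases hl.lt_or_eq with hl | rfl
      · exact hB.hasDerivAt l (by omega) ξ
      · exact h2
    · filter_upwards [hO.mem_nhds hξ] with u hu using
        hA.eqOn_gaussLeibniz hB hO h0 (by omega) u hu

/-- Continuity carries the identity to the boundary point 0, which can be reached from either
half-line. -/
theorem DerivSeq.apply_zero_eq (hA : DerivSeq k A) (hB : DerivSeq k B) (hO : IsOpen O)
    (h0 : ∀ᵐ ξ, ξ ∈ O → A 0 ξ = gauss c a ξ * B 0 ξ) (hcl : (0 : ℝ) ∈ closure O)
    {n : ℕ} (hn : n < k) : A n 0 = c * gaussLeibniz a B n 0 := by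
  have h1 : Set.EqOn (A n) (fun ξ => gauss c a ξ * gaussLeibniz a B n ξ) (closure O) :=
    Set.EqOn.closure (hA.eqOn_gaussLeibniz hB hO h0 hn) (hA.continuous n hn)
      ((continuous_gauss c a).mul
        (continuous_gaussLeibniz a fun l hl => hB.continuous l (by omega)))
  rw [h1 hcl]
  beta_reduce
  rw [gauss_zero]

end HalfLine

theorem gaussLeibniz_zero_of_vanishing (a : ℂ) {B : ℕ → ℝ → ℂ} {n : ℕ}
    (h : ∀ l < n, B l 0 = 0) : gaussLeibniz a B n 0 = B n 0 := by
  unfold gaussLeibniz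
  rw [Finset.sum_eq_single (n, 0)]
  · simp [gaussPoly]
  · intro ij hij hne
    have h1 := Finset.HasAntidiagonal.mem_antidiagonal.mp hij
    have h2 : ij.1 < n := by
      rcases lt_or_ge ij.1 n with h | h
      · exact h
      · exact absurd (Prod.ext (by simp; omega) (by simp; omega)) hne
    rw [h _ h2]
    ring
  · intro h; simp at h

/-- The term with B_{n+1} drops out because q_1(0) = 0, and q_2(0) = a. Order n + 2 is thus the
first at which the sign of a is visible. -/
theorem gaussLeibniz_add_two_zero (a : ℂ) {B : ℕ → ℝ → ℂ} {n : ℕ} (h : ∀ l < n, B l 0 = 0) :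
    gaussLeibniz a B (n + 2) 0 = B (n + 2) 0 + ((n + 2).choose n : ℂ) * (a * B n 0) := by
  unfold gaussLeibniz
  rw [Finset.Nat.sum_antidiagonal_eq_sum_range_succ_mk, Finset.sum_range_succ,
    Finset.sum_range_succ, Finset.sum_range_succ, Finset.sum_eq_zero]
  · have e1 : n + 2 - n = 2 := by omega
    have e2 : n + 2 - (n + 1) = 1 := by omega
    simp only [e1, e2, Complex.ofReal_zero, gaussPoly_two_eval_zero, gaussPoly_one]
    simp [gaussPoly]
    ring
  · intro l hl
    rw [h l (Finset.mem_range.mp hl)]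
    ring

/-! ### Matching the two half-line expansions at the origin. -/

section Vanishing

variable {k : ℕ} {A B : ℕ → ℝ → ℂ} {c d a : ℂ}

/-- If two functions with `k - 1` continuous derivatives are related by `A = c e^{aξ²/2} B` for
`ξ > 0` and `A = d e^{-aξ²/2} B` for `ξ < 0`, then the derivatives of `B` of order at most
`k - 3` vanish at `0`. -/
theorem DerivSeq.apply_zero_eq_zero (hA : DerivSeq k A) (hB : DerivSeq k B)
    (hpos : ∀ᵐ ξ, ξ ∈ Set.Ioi (0 : ℝ) → A 0 ξ = gauss c a ξ * B 0 ξ)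
    (hneg : ∀ᵐ ξ, ξ ∈ Set.Iio (0 : ℝ) → A 0 ξ = gauss d (-a) ξ * B 0 ξ)
    (hc : c ≠ 0) (ha : a ≠ 0) {n : ℕ} (hn : n + 2 < k) : B n 0 = 0 := by
  induction n using Nat.strong_induction_on with
  | _ n ih =>
    have h : ∀ l < n, B l 0 = 0 := fun l hl => ih l hl (by omega)
    have hp : ∀ {m : ℕ}, m < k → A m 0 = c * gaussLeibniz a B m 0 := fun hm =>
      hA.apply_zero_eq hB isOpen_Ioi hpos (by simp) hm
    have hm : ∀ {m : ℕ}, m < k → A m 0 = d * gaussLeibniz (-a) B m 0 := fun hm =>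
      hA.apply_zero_eq hB isOpen_Iio hneg (by simp) hm
    have h1 := (hp (m := n) (by omega)).symm.trans (hm (by omega))
    rw [gaussLeibniz_zero_of_vanishing a h, gaussLeibniz_zero_of_vanishing (-a) h] at h1
    have h2 := (hp (m := n + 2) hn).symm.trans (hm hn)
    rw [gaussLeibniz_add_two_zero a h, gaussLeibniz_add_two_zero (-a) h] at h2
    by_contra h0
    -- If B_n(0) ≠ 0, order n forces c = d; order n + 2 then equates the contributions of a and -a.
    have hcd : c = d := mul_right_cancel₀ h0 h1
    rw [← hcd] at h2
    have h3 := mul_left_cancel₀ hc h2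
    have hch : ((n + 2).choose n : ℂ) ≠ 0 := by
      exact_mod_cast (Nat.choose_pos (by omega)).ne'
    have h4 : 2 * (((n + 2).choose n : ℂ) * (a * B n 0)) = 0 := by linear_combination h3
    simp [hch, ha, h0] at h4

/-- At n = k - 2 the comparison at order n + 2 is unavailable, as A_k need not be continuous. The
lower orders still vanish, leaving A_n(0) = c B_n(0). -/
theorem DerivSeq.apply_zero_eq_zero_iff (hA : DerivSeq k A) (hB : DerivSeq k B)
    (hpos : ∀ᵐ ξ, ξ ∈ Set.Ioi (0 : ℝ) → A 0 ξ = gauss c a ξ * B 0 ξ)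
    (hneg : ∀ᵐ ξ, ξ ∈ Set.Iio (0 : ℝ) → A 0 ξ = gauss d (-a) ξ * B 0 ξ)
    (hc : c ≠ 0) (ha : a ≠ 0) {n : ℕ} (hn : n + 2 = k) : A n 0 = 0 ↔ B n 0 = 0 := by
  have h : ∀ l < n, B l 0 = 0 := fun l hl =>
    hA.apply_zero_eq_zero hB hpos hneg hc ha (by omega)
  rw [hA.apply_zero_eq hB isOpen_Ioi hpos (by simp) (by omega),
    gaussLeibniz_zero_of_vanishing a h]
  simp [hc]

end Vanishing

/-! ### Families of finite Gagliardo or Hardy energy -/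

theorem tsum_gagliardo_add_lt_top {G H : ℤ → ℝ → ℂ} (hGm : ∀ η, Measurable (G η))
    (hHm : ∀ η, Measurable (H η)) (hG : ∑' η, gagliardo (G η) < ⊤)
    (hH : ∑' η, gagliardo (H η) < ⊤) : ∑' η, gagliardo (fun ξ => G η ξ + H η ξ) < ⊤ := by
  refine (ENNReal.tsum_le_tsum fun η => gagliardo_add_le _ _ (hGm η) (hHm η)).trans_lt ?_
  rw [ENNReal.tsum_add, ENNReal.tsum_mul_left, ENNReal.tsum_mul_left]
  exact ENNReal.add_lt_top.mpr ⟨ENNReal.mul_lt_top (by simp) hG, ENNReal.mul_lt_top (by simp) hH⟩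

theorem tsum_gagliardo_const_mul_lt_top {G : ℤ → ℝ → ℂ} (hGm : ∀ η, Measurable (G η))
    (hG : ∑' η, gagliardo (G η) < ⊤) (c : ℂ) : ∑' η, gagliardo (fun ξ => c * G η ξ) < ⊤ := by
  simp_rw [gagliardo_const_mul c (hGm _)]
  rw [ENNReal.tsum_mul_left]
  exact ENNReal.mul_lt_top (ENNReal.pow_lt_top enorm_lt_top) hG

theorem tsum_hardyIntegral_add_lt_top {G H : ℤ → ℝ → ℂ} (hGm : ∀ η, Measurable (G η))
    (hG : ∑' η, hardyIntegral (G η) < ⊤) (hH : ∑' η, hardyIntegral (H η) < ⊤) :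
    ∑' η, hardyIntegral (fun ξ => G η ξ + H η ξ) < ⊤ := by
  refine (ENNReal.tsum_le_tsum fun η => hardyIntegral_add_le (hGm η).aemeasurable).trans_lt ?_
  rw [ENNReal.tsum_add, ENNReal.tsum_mul_left, ENNReal.tsum_mul_left]
  exact ENNReal.add_lt_top.mpr ⟨ENNReal.mul_lt_top (by simp) hG, ENNReal.mul_lt_top (by simp) hH⟩

theorem tsum_hardyIntegral_const_mul_lt_top {G : ℤ → ℝ → ℂ}
    (hG : ∑' η, hardyIntegral (G η) < ⊤) (c : ℂ) :
    ∑' η, hardyIntegral (fun ξ => c * G η ξ) < ⊤ := by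
  simp_rw [hardyIntegral_const_mul c]
  rw [ENNReal.tsum_mul_left]
  exact ENNReal.mul_lt_top (ENNReal.pow_lt_top enorm_lt_top) hG

theorem tsum_hardyIntegral_sum_lt_top {ι : Type*} (s : Finset ι) {G : ι → ℤ → ℝ → ℂ}
    (hGm : ∀ i η, Measurable (G i η)) (hG : ∀ i ∈ s, ∑' η, hardyIntegral (G i η) < ⊤) :
    ∑' η, hardyIntegral (fun ξ => ∑ i ∈ s, G i η ξ) < ⊤ := by
  classical
  induction s using Finset.induction_on with
  | empty => simp [hardyIntegral]
  | insert a s ha ih =>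
    simp_rw [Finset.sum_insert ha]
    exact tsum_hardyIntegral_add_lt_top (hGm a) (hG a (by simp))
      (ih fun i hi => hG i (by simp [hi]))

/-! ### Gluing two Leibniz sums at the origin. -/

section Leibniz

variable {k : ℕ} {B : ℤ → ℕ → ℝ → ℂ}

/-- The budget is exact: B_l carries 2(k - l) + 1 units and a polynomial of degree at most k - l
costs 2(k - l). -/
theorem freqBiWeighted_leibnizSum (r : ℕ → Polynomial ℂ) (hr : ∀ j, (r j).natDegree ≤ j)
    (hreg : ∀ l ≤ k, FreqBiWeighted (2 * (k - l) + 1) fun η => B η l) :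
    FreqBiWeighted 1 fun η ξ => ∑ ij ∈ Finset.HasAntidiagonal.antidiagonal k,
      (k.choose ij.1 : ℂ) * ((r ij.2).eval (ξ : ℂ) * B η ij.1 ξ) := by
  have hne : (Finset.HasAntidiagonal.antidiagonal k).Nonempty :=
    ⟨(k, 0), Finset.HasAntidiagonal.mem_antidiagonal.mpr (Nat.add_zero k)⟩
  have hterm : ∀ ij ∈ Finset.HasAntidiagonal.antidiagonal k, FreqBiWeighted 1
      fun η ξ => (k.choose ij.1 : ℂ) * ((r ij.2).eval (ξ : ℂ) * B η ij.1 ξ) := by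
    intro ij hij
    have h1 := Finset.HasAntidiagonal.mem_antidiagonal.mp hij
    have h2 := hreg ij.1 (by omega)
    rw [show 2 * (k - ij.1) + 1 = 1 + 2 * ij.2 by omega] at h2
    exact (FreqBiWeighted.polynomial_mul (r ij.2) (hr ij.2) h2).const_mul _
  exact FreqBiWeighted.sum _ hne hterm

theorem freqBiWeighted_gaussLeibniz
    (hreg : ∀ l ≤ k, FreqBiWeighted (2 * (k - l) + 1) fun η => B η l) (a : ℂ) :
    FreqBiWeighted 1 fun η => gaussLeibniz a (B η) k :=
  freqBiWeighted_leibnizSum (gaussPoly a) (natDegree_gaussPoly_le a) hreg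

/-- The part of `gaussLeibniz a B k - gaussLeibniz (-a) B k` with constant coefficients. -/
noncomputable def leibnizDefect (a : ℂ) (B : ℕ → ℝ → ℂ) (k : ℕ) (ξ : ℝ) : ℂ :=
  ∑ ij ∈ Finset.HasAntidiagonal.antidiagonal k,
    ((k.choose ij.1 : ℂ) * (gaussPoly a ij.2 - gaussPoly (-a) ij.2).coeff 0) * B ij.1 ξ

/-- Split each coefficient polynomial into X times a quotient and its constant term. The quotient
part stays within the same budget, and its factor ξ makes its Hardy energy finite. -/
theorem exists_gaussLeibniz_sub_eq
    (hreg : ∀ l ≤ k, FreqBiWeighted (2 * (k - l) + 1) fun η => B η l)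
    (hm : ∀ η l, Measurable (B η l)) (a : ℂ) :
    ∃ K : ℤ → ℝ → ℂ, FreqBiWeighted 1 K ∧ (∀ η, Measurable (K η)) ∧
      ∀ η ξ, gaussLeibniz a (B η) k ξ - gaussLeibniz (-a) (B η) k ξ =
        (ξ : ℂ) * K η ξ + leibnizDefect a (B η) k ξ := by
  have hdeg : ∀ j, (gaussPoly a j - gaussPoly (-a) j).natDegree ≤ j := fun j => by
    have := Polynomial.natDegree_sub_le_of_le (natDegree_gaussPoly_le a j)
      (natDegree_gaussPoly_le (-a) j)
    rwa [max_self] at this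
  have hsub : ∀ j (z : ℂ), (gaussPoly a j).eval z - (gaussPoly (-a) j).eval z =
      z * (gaussPoly a j - gaussPoly (-a) j).divX.eval z +
        (gaussPoly a j - gaussPoly (-a) j).coeff 0 := fun j z => by
    rw [← Polynomial.eval_sub]
    generalize gaussPoly a j - gaussPoly (-a) j = q
    conv_lhs => rw [← Polynomial.divX_mul_X_add q]
    rw [Polynomial.eval_add, Polynomial.eval_mul, Polynomial.eval_X, Polynomial.eval_C, mul_comm]
  have hdeg' : ∀ j, (gaussPoly a j - gaussPoly (-a) j).divX.natDegree ≤ j := fun j => by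
    rw [Polynomial.natDegree_divX_eq_natDegree_tsub_one]
    have := hdeg j
    omega
  generalize hq : (fun j => (gaussPoly a j - gaussPoly (-a) j).divX) = q
  have hq' : ∀ j, (gaussPoly a j - gaussPoly (-a) j).divX = q j := fun j => congrFun hq j
  simp only [hq'] at hsub hdeg'
  refine ⟨_, freqBiWeighted_leibnizSum q hdeg' hreg, fun η => ?_, fun η ξ => ?_⟩
  · refine Finset.measurable_fun_sum _ fun ij _ => ?_
    have h1 := hm η ij.1
    have h2 : Continuous fun ξ : ℝ => (q ij.2).eval (ξ : ℂ) :=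
      (q ij.2).continuous.comp Complex.continuous_ofReal
    have := h2.measurable
    fun_prop
  · unfold gaussLeibniz leibnizDefect
    rw [← Finset.sum_sub_distrib, Finset.mul_sum, ← Finset.sum_add_distrib]
    refine Finset.sum_congr rfl fun ij _ => ?_
    rw [← mul_sub, ← sub_mul, hsub]
    generalize (gaussPoly a ij.2 - gaussPoly (-a) ij.2).coeff 0 = e
    ring

theorem tsum_hardyIntegral_gaussLeibniz_sub_iff
    (hreg : ∀ l ≤ k, FreqBiWeighted (2 * (k - l) + 1) fun η => B η l)
    (hm : ∀ η l, Measurable (B η l)) (a : ℂ) :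
    ∑' η, hardyIntegral
      (fun ξ => gaussLeibniz a (B η) k ξ - gaussLeibniz (-a) (B η) k ξ) < ⊤ ↔
      ∑' η, hardyIntegral (leibnizDefect a (B η) k) < ⊤ := by
  obtain ⟨K, hK, hKm, hKe⟩ := exists_gaussLeibniz_sub_eq hreg hm a
  have hKf := hK.tsum_hardyIntegral_id_mul_lt_top le_rfl
  have hKm' : ∀ η, Measurable fun ξ : ℝ => (ξ : ℂ) * K η ξ := fun η => by
    have := hKm η
    fun_prop
  constructor
  · intro h
    have h2 := tsum_hardyIntegral_add_lt_top (fun η => (hKm' η).const_mul (-1))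
      (tsum_hardyIntegral_const_mul_lt_top hKf (-1)) h
    convert h2 using 4 with η
    ext ξ
    rw [hKe η ξ]
    ring
  · intro h
    simp_rw [hKe]
    exact tsum_hardyIntegral_add_lt_top hKm' hKf h

/-- q_0 does not depend on a, and q_1 = aX has no constant term. -/
theorem leibnizDefect_eq_zero (a : ℂ) (B : ℕ → ℝ → ℂ) (hk : k ≤ 1) (ξ : ℝ) :
    leibnizDefect a B k ξ = 0 := by
  refine Finset.sum_eq_zero fun ij hij => ?_
  have h1 := Finset.HasAntidiagonal.mem_antidiagonal.mp hij
  have h2 : (gaussPoly a ij.2 - gaussPoly (-a) ij.2).coeff 0 = 0 := by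
    have : ij.2 = 0 ∨ ij.2 = 1 := by omega
    rcases this with h | h
    · simp [h, gaussPoly]
    · simp [h, gaussPoly_one]
  rw [h2, mul_zero, zero_mul]

theorem leibnizDefect_add_two (a : ℂ) (B : ℕ → ℝ → ℂ) (m : ℕ) (ξ : ℝ) :
    leibnizDefect a B (m + 2) ξ =
      (∑ l ∈ Finset.range m, (((m + 2).choose l : ℂ) *
        (gaussPoly a (m + 2 - l) - gaussPoly (-a) (m + 2 - l)).coeff 0) * B l ξ) +
      (((m + 2).choose m : ℂ) * (2 * a)) * B m ξ := by
  unfold leibnizDefect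
  rw [Finset.Nat.sum_antidiagonal_eq_sum_range_succ_mk, Finset.sum_range_succ,
    Finset.sum_range_succ, Finset.sum_range_succ]
  have e1 : m + 2 - m = 2 := by omega
  have e2 : m + 2 - (m + 1) = 1 := by omega
  have e3 : (gaussPoly a 2 - gaussPoly (-a) 2).coeff 0 = 2 * a := by
    rw [Polynomial.coeff_zero_eq_eval_zero, Polynomial.eval_sub, gaussPoly_two_eval_zero,
      gaussPoly_two_eval_zero]
    ring
  simp only [e1, e2, e3, gaussPoly_one]
  simp [gaussPoly]

theorem tsum_hardyIntegral_lt_top_of_vanishing (hB : ∀ η, DerivSeq k (B η))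
    (hreg : ∀ l ≤ k, FreqBiWeighted (2 * (k - l) + 1) fun η => B η l) {l : ℕ} (hl : l + 1 < k)
    (h0 : ∀ η, B η l 0 = 0) : ∑' η, hardyIntegral (B η l) < ⊤ := by
  refine (ENNReal.tsum_le_tsum fun η => hardyIntegral_le_of_hasDerivAt
    ((hB η).hasDerivAt l hl) ((hB η).continuous (l + 1) hl) (h0 η)).trans_lt ?_
  rw [ENNReal.tsum_add, ENNReal.tsum_mul_left]
  simp_rw [← polyWeight_zero]
  exact ENNReal.add_lt_top.mpr
    ⟨ENNReal.mul_lt_top (by simp)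
      ((hreg (l + 1) hl.le).mono (Nat.zero_le _)).tsum_polyWeight_lt_top,
      ((hreg l (by omega)).mono (Nat.zero_le _)).tsum_polyWeight_lt_top⟩

/-- The terms below order m vanish at 0 and have finite energy, so the nonzero multiple of B_m
decides alone. Since B_{m+1} is still continuous and in L², vanishing at 0 is also sufficient for
B_m. -/
theorem tsum_hardyIntegral_leibnizDefect_iff {m : ℕ} (hB : ∀ η, DerivSeq (m + 2) (B η))
    (hreg : ∀ l ≤ m + 2, FreqBiWeighted (2 * (m + 2 - l) + 1) fun η => B η l)
    {a : ℂ} (ha : a ≠ 0) (h0 : ∀ η, ∀ l < m, B η l 0 = 0) :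
    ∑' η, hardyIntegral (leibnizDefect a (B η) (m + 2)) < ⊤ ↔ ∀ η, B η m 0 = 0 := by
  have hm : ∀ η l, Measurable (B η l) := fun η l => (hB η).measurable l
  set c : ℂ := ((m + 2).choose m : ℂ) * (2 * a) with hc
  have hc0 : c ≠ 0 := by
    have : ((m + 2).choose m : ℂ) ≠ 0 := by exact_mod_cast (Nat.choose_pos (by omega)).ne'
    simp [hc, this, ha]
  set b : ℕ → ℂ := fun l => ((m + 2).choose l : ℂ) *
        (gaussPoly a (m + 2 - l) - gaussPoly (-a) (m + 2 - l)).coeff 0 with hb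
  have he : ∀ η ξ, leibnizDefect a (B η) (m + 2) ξ =
      (∑ l ∈ Finset.range m, b l * B η l ξ) + c * B η m ξ := fun η ξ =>
    leibnizDefect_add_two a (B η) m ξ
  have hlow : ∑' η, hardyIntegral (fun ξ => ∑ l ∈ Finset.range m, b l * B η l ξ) < ⊤ :=
    tsum_hardyIntegral_sum_lt_top _ (G := fun l η ξ => b l * B η l ξ)
      (fun l η => (hm η l).const_mul _) fun l hl =>
        have hl' := Finset.mem_range.mp hl
        tsum_hardyIntegral_const_mul_lt_top (tsum_hardyIntegral_lt_top_of_vanishing hB hreg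
          (by omega) fun η => h0 η l hl') _
  have hlowm : ∀ η, Measurable fun ξ => ∑ l ∈ Finset.range m, b l * B η l ξ := fun η =>
    Finset.measurable_fun_sum _ fun l _ => (hm η l).const_mul _
  constructor
  · intro h η
    have h1 := tsum_hardyIntegral_const_mul_lt_top (tsum_hardyIntegral_add_lt_top
      (fun η => (hlowm η).const_mul (-1)) (tsum_hardyIntegral_const_mul_lt_top hlow (-1)) h) c⁻¹
    have h2 : ∑' η, hardyIntegral (B η m) < ⊤ := by
      convert h1 using 4 with η
      ext ξ
      rw [he η ξ, neg_one_mul, neg_add_cancel_left, inv_mul_cancel_left₀ hc0]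
    exact apply_zero_eq_zero_of_hardyIntegral_lt_top ((hB η).continuous m (by omega))
      ((ENNReal.le_tsum η).trans_lt h2)
  · intro h
    have h1 := tsum_hardyIntegral_add_lt_top hlowm hlow (tsum_hardyIntegral_const_mul_lt_top
      (tsum_hardyIntegral_lt_top_of_vanishing hB hreg (l := m) (by omega) h) c)
    convert h1 using 4 with η
    ext ξ
    exact he η ξ

/-- With P and N the two Leibniz sums, Y = (P+N)/2 + sgn·(P-N)/2 almost everywhere. As P and N are
in H^{1/2}, only the sgn term matters, and the Hardy criterion applies to it. -/
theorem tsum_gagliardo_glued_iff (hB : ∀ η, DerivSeq k (B η))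
    (hreg : ∀ l ≤ k, FreqBiWeighted (2 * (k - l) + 1) fun η => B η l) {a : ℂ} {Y : ℤ → ℝ → ℂ}
    (hpos : ∀ η, ∀ᵐ ξ, ξ ∈ Set.Ioi (0 : ℝ) → Y η ξ = gaussLeibniz a (B η) k ξ)
    (hneg : ∀ η, ∀ᵐ ξ, ξ ∈ Set.Iio (0 : ℝ) → Y η ξ = gaussLeibniz (-a) (B η) k ξ) :
    ∑' η, gagliardo (Y η) < ⊤ ↔ ∑' η, hardyIntegral (leibnizDefect a (B η) k) < ⊤ := by
  have hm : ∀ η l, Measurable (B η l) := fun η l => (hB η).measurable l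
  rw [← tsum_hardyIntegral_gaussLeibniz_sub_iff hreg hm]
  have hPm := fun η => measurable_gaussLeibniz a k (hm η)
  have hNm := fun η => measurable_gaussLeibniz (-a) k (hm η)
  have hP := freqBiWeighted_gaussLeibniz hreg a
  have hN := freqBiWeighted_gaussLeibniz hreg (-a)
  generalize hPe : (fun η => gaussLeibniz a (B η) k) = P at *
  generalize hNe : (fun η => gaussLeibniz (-a) (B η) k) = N at *
  have hPe' : ∀ η, gaussLeibniz a (B η) k = P η := fun η => congrFun hPe η
  have hNe' : ∀ η, gaussLeibniz (-a) (B η) k = N η := fun η => congrFun hNe η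
  simp only [hPe', hNe'] at *
  have hDm : ∀ η, Measurable fun ξ => P η ξ - N η ξ := fun η => (hPm η).sub (hNm η)
  have hDs : ∀ η, Measurable fun ξ => ((Real.sign ξ : ℝ) : ℂ) * (P η ξ - N η ξ) := fun η => by
    have := measurable_sign
    have := hDm η
    fun_prop
  have hS : FreqBiWeighted 1 fun η ξ => P η ξ + N η ξ := hP.add hN
  have hSm : ∀ η, Measurable fun ξ => P η ξ + N η ξ := fun η => (hPm η).add (hNm η)
  have hD : FreqBiWeighted 1 fun η ξ => P η ξ - N η ξ := by
    refine (hP.add (hN.const_mul (-1))).congr fun η => Filter.Eventually.of_forall fun ξ => ?_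
    ring
  rw [← tsum_gagliardo_sign_mul_lt_top_iff hDm (hD.tsum_gagliardo_lt_top le_rfl)]
  have hY : ∀ η, ∀ᵐ ξ, Y η ξ = 2⁻¹ * (P η ξ + N η ξ) +
      2⁻¹ * (((Real.sign ξ : ℝ) : ℂ) * (P η ξ - N η ξ)) := fun η => by
    filter_upwards [hpos η, hneg η, ae_ne_zero] with ξ h1 h2 h3
    rcases h3.lt_or_gt with h | h
    · rw [h2 h, Real.sign_of_neg h]; push_cast; ring
    · rw [h1 h, Real.sign_of_pos h]; push_cast; ring
  have hSg := hS.tsum_gagliardo_lt_top le_rfl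
  constructor
  · intro h
    have hconv : ∀ η, gagliardo (fun ξ => 2⁻¹ * (P η ξ + N η ξ) +
        2⁻¹ * (((Real.sign ξ : ℝ) : ℂ) * (P η ξ - N η ξ))) = gagliardo (Y η) := fun η =>
      gagliardo_congr ((hY η).mono fun ξ h => h.symm)
    have hYm : ∀ η, Measurable fun ξ => 2⁻¹ * (P η ξ + N η ξ) +
        2⁻¹ * (((Real.sign ξ : ℝ) : ℂ) * (P η ξ - N η ξ)) := fun η =>
      ((hSm η).const_mul _).add ((hDs η).const_mul _)
    simp_rw [← hconv] at h
    have h1 := tsum_gagliardo_add_lt_top (fun η => (hSm η).const_mul (-1))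
      (fun η => (hYm η).const_mul 2) (tsum_gagliardo_const_mul_lt_top hSm hSg (-1))
      (tsum_gagliardo_const_mul_lt_top hYm h 2)
    convert h1 using 4 with η
    ext ξ
    ring
  · intro h
    simp_rw [fun η => gagliardo_congr (hY η)]
    exact tsum_gagliardo_add_lt_top (fun η => (hSm η).const_mul _) (fun η => (hDs η).const_mul _)
      (tsum_gagliardo_const_mul_lt_top hSm hSg _) (tsum_gagliardo_const_mul_lt_top hDs h _)

end Leibniz

/-! ### Parseval's identity on the cylinder -/

theorem tsum_enorm_sq_integral_fourier_mul {h : AddCircle (2 * Real.pi) → ℂ}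
    (hh : MemLp h 2 volume) :
    ∑' η : ℤ, ‖∫ y, fourier (-η) y * h y‖ₑ ^ 2 =
      ENNReal.ofReal (2 * Real.pi) * ∫⁻ y, ‖h y‖ₑ ^ 2 := by
  have hpi := Real.two_pi_pos
  have hh' : MemLp h 2 (AddCircle.haarAddCircle (T := 2 * Real.pi)) := hh.haarAddCircle
  have h1 := hasSum_sq_fourierCoeff hh'.toLp
  simp only [fourierCoeff_congr_ae hh'.coeFn_toLp] at h1
  have h2 : ∫ y : AddCircle (2 * Real.pi), ‖hh'.toLp h y‖ ^ 2 ∂AddCircle.haarAddCircle =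
      (2 * Real.pi)⁻¹ * ∫ y, ‖h y‖ ^ 2 := by
    refine Eq.trans (integral_congr_ae ?_)
      (AddCircle.integral_haarAddCircle (f := fun y : AddCircle (2 * Real.pi) => ‖h y‖ ^ 2))
    filter_upwards [hh'.coeFn_toLp] with y hy
    rw [hy]
  rw [h2] at h1
  have h3 : ∀ η : ℤ, ‖∫ y, fourier (-η) y * h y‖ₑ ^ 2 =
      ENNReal.ofReal ((2 * Real.pi) ^ 2 * ‖fourierCoeff h η‖ ^ 2) := fun η => by
    have : ∫ y, fourier (-η) y * h y = (2 * Real.pi : ℝ) • fourierCoeff h η := by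
      rw [fourierCoeff, AddCircle.integral_haarAddCircle, smul_inv_smul₀ hpi.ne']
      rfl
    rw [this, enorm_sq_eq_ofReal, norm_smul, mul_pow, Real.norm_of_nonneg hpi.le]
  have h4 : ∫⁻ y, ‖h y‖ₑ ^ 2 = ENNReal.ofReal (∫ y, ‖h y‖ ^ 2) := by
    rw [ofReal_integral_eq_lintegral_ofReal hh.integrable_norm_pow'
      (Filter.Eventually.of_forall fun y => by positivity)]
    exact lintegral_congr fun y => enorm_sq_eq_ofReal _
  -- The unnormalized coefficients are 2π times those for Haar probability measure, whose squared
  -- norm carries (2π)^{-1}; the net factor is 2π.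
  have h5 := h1.mul_left ((2 * Real.pi) ^ 2)
  simp_rw [h3]
  rw [← ENNReal.ofReal_tsum_of_nonneg (fun η => by positivity) h5.summable, h5.tsum_eq, h4,
    ← ENNReal.ofReal_mul hpi.le]
  congr 1
  field_simp

theorem coe_coeffL2 (f : L2Cyl) (η : ℤ) : coeffL2 f η =ᵐ[volume] yCoeff f η :=
  MemLp.coeFn_toLp _

theorem lintegral_cyl {F : Cyl → ℝ≥0∞} (hF : Measurable F) :
    ∫⁻ p, F p = ∫⁻ x, ∫⁻ y, F (x, y) :=
  lintegral_prod _ hF.aemeasurable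

theorem tsum_lintegral_coeffL2 (f : L2Cyl) {w : ℝ → ℝ≥0∞} (hw : Measurable w) :
    ∑' η, ∫⁻ x, w x * ‖coeffL2 f η x‖ₑ ^ 2 =
      ENNReal.ofReal (2 * Real.pi) * ∫⁻ p : Cyl, w p.1 * ‖f p‖ₑ ^ 2 := by
  have hm : Measurable f := (Lp.stronglyMeasurable f).measurable
  have hc : ∀ η, Measurable (coeffL2 f η) := fun η => measurable_coe_Lp _
  have hfib : ∀ᵐ x : ℝ, ∫⁻ y, ‖f (x, y)‖ₑ ^ 2 < ⊤ := by
    have h1 := (Lp.memLp f).2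
    rw [eLpNorm_lt_top_iff_lintegral_rpow_enorm_lt_top (by norm_num) (by norm_num)] at h1
    simp only [ENNReal.toReal_ofNat, ENNReal.rpow_ofNat] at h1
    rw [lintegral_cyl (by fun_prop)] at h1
    exact ae_lt_top (Measurable.lintegral_prod_right' (f := fun p : Cyl => ‖f p‖ₑ ^ 2)
      (by fun_prop)) h1.ne
  rw [← lintegral_tsum fun η => by have := hc η; fun_prop,
    lintegral_cyl (by fun_prop), ← lintegral_const_mul _
      (Measurable.lintegral_prod_right' (f := fun p : Cyl => w p.1 * ‖f p‖ₑ ^ 2) (by fun_prop))]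
  refine lintegral_congr_ae ?_
  filter_upwards [hfib, ae_all_iff.mpr fun η => coe_coeffL2 f η] with x hx hcx
  have hmx : Measurable fun y => f (x, y) := hm.comp measurable_prodMk_left
  have hL : MemLp (fun y => f (x, y)) 2 volume := by
    refine ⟨hmx.aestronglyMeasurable, ?_⟩
    rw [eLpNorm_lt_top_iff_lintegral_rpow_enorm_lt_top (by norm_num) (by norm_num)]
    simpa using hx
  simp_rw [hcx]
  rw [ENNReal.tsum_mul_left, lintegral_const_mul _ (by fun_prop), mul_left_comm]
  congr 1
  exact tsum_enorm_sq_integral_fourier_mul hL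

theorem memLp_weight_iff (f : L2Cyl) (k : ℕ) :
    MemLp f 2 (weight ((k : ℝ) + 1 / 2)) ↔
      ∑' η, ∫⁻ x, ‖x‖ₑ ^ (2 * k + 1) * ‖coeffL2 f η x‖ₑ ^ 2 < ⊤ := by
  have hm : Measurable f := (Lp.stronglyMeasurable f).measurable
  have hpi : ENNReal.ofReal (2 * Real.pi) ≠ 0 := by simp [Real.pi_pos]
  have hw : ∀ x : ℝ, ENNReal.ofReal (|x| ^ (2 * ((k : ℝ) + 1 / 2))) = ‖x‖ₑ ^ (2 * k + 1) :=
    fun x => by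
      rw [show 2 * ((k : ℝ) + 1 / 2) = ((2 * k + 1 : ℕ) : ℝ) by push_cast; ring,
        Real.rpow_natCast, ENNReal.ofReal_pow (abs_nonneg x), Real.enorm_eq_ofReal_abs]
  have h1 : ∫⁻ p, ‖f p‖ₑ ^ 2 ∂(weight ((k : ℝ) + 1 / 2)) =
      ∫⁻ p : Cyl, ‖p.1‖ₑ ^ (2 * k + 1) * ‖f p‖ₑ ^ 2 := by
    rw [weight, lintegral_withDensity_eq_lintegral_mul _ (by fun_prop) (by fun_prop)]
    exact lintegral_congr fun p => by rw [Pi.mul_apply, hw]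
  rw [MemLp, eLpNorm_lt_top_iff_lintegral_rpow_enorm_lt_top (by norm_num) (by norm_num),
    and_iff_right hm.aestronglyMeasurable, tsum_lintegral_coeffL2 f (w := fun x => ‖x‖ₑ ^ (2 * k + 1))
      (by fun_prop)]
  simp only [ENNReal.toReal_ofNat, ENNReal.rpow_ofNat]
  rw [h1]
  constructor
  · exact fun h => ENNReal.mul_lt_top ENNReal.ofReal_lt_top h
  · exact fun h => (ENNReal.lt_top_of_mul_ne_top_right h.ne hpi)

theorem memLp_weight_half_iff (f : L2Cyl) :
    MemLp f 2 (weight (1 / 2)) ↔ ∑' η, gagliardo (cylFourier f η) < ⊤ := by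
  have h := memLp_weight_iff f 0
  simp only [Nat.cast_zero, zero_add, mul_zero, pow_one] at h
  rw [h]
  unfold cylFourier
  simp_rw [gagliardo_fourier]
  rw [ENNReal.tsum_mul_left]
  constructor
  · exact fun h => ENNReal.mul_lt_top gagliardoConst_ne_top.lt_top h
  · exact fun h => (ENNReal.lt_top_of_mul_ne_top_right h.ne gagliardoConst_ne_zero)

theorem tsum_lintegral_enorm_sq_coeffL2_lt_top (f : L2Cyl) :
    ∑' η, ∫⁻ x, ‖coeffL2 f η x‖ₑ ^ 2 < ⊤ := by
  have h := tsum_lintegral_coeffL2 f (w := fun _ => 1) measurable_const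
  simp only [one_mul] at h
  rw [h]
  refine ENNReal.mul_lt_top ENNReal.ofReal_lt_top ?_
  have h1 := (Lp.memLp f).2
  rw [eLpNorm_lt_top_iff_lintegral_rpow_enorm_lt_top (by norm_num) (by norm_num)] at h1
  simpa using h1

theorem tsum_polyWeight_coeffL2_lt_top {f : L2Cyl} {k : ℕ}
    (hf : MemLp f 2 (weight ((k : ℝ) + 1 / 2))) :
    ∑' η, polyWeight (2 * k + 1) (coeffL2 f η) < ⊤ := by
  have h1 := (memLp_weight_iff f k).mp hf
  have h2 := tsum_lintegral_enorm_sq_coeffL2_lt_top f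
  have hle : ∀ η, polyWeight (2 * k + 1) (coeffL2 f η) ≤ 2 ^ (2 * k + 1) *
      ((∫⁻ x, ‖coeffL2 f η x‖ₑ ^ 2) + ∫⁻ x, ‖x‖ₑ ^ (2 * k + 1) * ‖coeffL2 f η x‖ₑ ^ 2) := by
    intro η
    have := measurable_coe_Lp (coeffL2 f η)
    rw [← lintegral_add_left (by fun_prop), ← lintegral_const_mul _ (by fun_prop)]
    refine lintegral_mono fun x => ?_
    beta_reduce
    rw [← one_add_mul, ← mul_assoc]
    refine mul_le_mul' ?_ le_rfl
    rcases le_total ‖x‖ₑ 1 with h | h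
    · calc (1 + ‖x‖ₑ) ^ (2 * k + 1) ≤ 2 ^ (2 * k + 1) := by
            gcongr; rw [← one_add_one_eq_two]; gcongr
        _ ≤ _ := le_mul_of_one_le_right' le_self_add
    · calc (1 + ‖x‖ₑ) ^ (2 * k + 1) ≤ (2 * ‖x‖ₑ) ^ (2 * k + 1) := by
            gcongr; rw [two_mul]; gcongr
        _ ≤ _ := by rw [mul_pow]; gcongr; exact le_add_self
  refine (ENNReal.tsum_le_tsum hle).trans_lt ?_
  rw [ENNReal.tsum_mul_left, ENNReal.tsum_add]
  exact ENNReal.mul_lt_top (by simp) (ENNReal.add_lt_top.mpr ⟨h2, h1⟩)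

theorem tsum_polyWeight_cylFourier_lt_top {f : L2Cyl} {k : ℕ}
    (hf : MemSobolevX ((k : ℝ) + 1 / 2) f) :
    ∑' η, polyWeight (2 * k + 1) (cylFourier f η) < ⊤ := by
  refine (ENNReal.tsum_le_tsum (g := fun η => 2 ^ (2 * k + 1) *
    ∫⁻ ξ : ℝ, ENNReal.ofReal ((1 + (2 * Real.pi * ξ) ^ 2) ^ ((k : ℝ) + 1 / 2)) *
    ‖cylFourier f η ξ‖ₑ ^ 2) fun η => ?_).trans_lt ?_
  · rw [← lintegral_const_mul' _ _ (by simp)]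
    refine lintegral_mono fun ξ => ?_
    rw [← mul_assoc]
    refine mul_le_mul' ?_ le_rfl
    have h1 : ((1 + (2 * Real.pi * ξ) ^ 2) ^ ((k : ℝ) + 1 / 2) : ℝ) =
        (Real.sqrt (1 + (2 * Real.pi * ξ) ^ 2)) ^ (2 * k + 1) := by
      rw [Real.sqrt_eq_rpow, ← Real.rpow_natCast _ (2 * k + 1), ← Real.rpow_mul (by positivity)]
      congr 1
      push_cast
      ring
    -- Both 1 and |ξ| are at most the root; the factor 2 yields the constant 2^{2k+1}.
    have h2 : 1 + |ξ| ≤ 2 * Real.sqrt (1 + (2 * Real.pi * ξ) ^ 2) := by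
      have h3 : 1 ≤ Real.sqrt (1 + (2 * Real.pi * ξ) ^ 2) :=
        Real.one_le_sqrt.mpr (by nlinarith [sq_nonneg (2 * Real.pi * ξ)])
      have h4 : |ξ| ≤ Real.sqrt (1 + (2 * Real.pi * ξ) ^ 2) := by
        refine Real.abs_le_sqrt ?_
        have : 1 ≤ (2 * Real.pi) ^ 2 := by nlinarith [Real.pi_gt_three]
        rw [mul_pow]
        nlinarith [sq_nonneg ξ]
      linarith
    have h5 : 1 + ‖ξ‖ₑ = ENNReal.ofReal (1 + |ξ|) := by
      rw [ENNReal.ofReal_add zero_le_one (abs_nonneg _), ENNReal.ofReal_one,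
        Real.enorm_eq_ofReal_abs]
    rw [h1, h5, ← ENNReal.ofReal_pow (by positivity),
      show (2 : ℝ≥0∞) ^ (2 * k + 1) = ENNReal.ofReal (2 ^ (2 * k + 1)) by
        rw [ENNReal.ofReal_pow zero_le_two, ENNReal.ofReal_ofNat],
      ← ENNReal.ofReal_mul (by positivity), ← mul_pow]
    exact ENNReal.ofReal_le_ofReal (pow_le_pow_left₀ (by positivity) h2 _)
  · rw [ENNReal.tsum_mul_left]
    exact ENNReal.mul_lt_top (by simp) hf

/-! ### Symbols -/

theorem enorm_cylFourier_U (t : ℝ) (f : L2Cyl) (η : ℤ) :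
    ∀ᵐ ξ, ‖cylFourier (U t f) η ξ‖ₑ = ‖cylFourier f η ξ‖ₑ := by
  filter_upwards [cylFourier_multiplier _ (measurable_expOmega t) (norm_expOmega t) f η] with ξ h
  rw [U, h, enorm_mul, mul_comm Complex.I, ← ofReal_norm, Complex.norm_exp_ofReal_mul_I,
    ENNReal.ofReal_one, one_mul]

theorem biWeighted_coeffL2 {f : L2Cyl} {k : ℕ} (hfs : MemSobolevX ((k : ℝ) + 1 / 2) f)
    (hfw : MemLp f 2 (weight ((k : ℝ) + 1 / 2))) : BiWeighted (2 * k + 1) (coeffL2 f) :=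
  ⟨tsum_polyWeight_coeffL2_lt_top hfw, tsum_polyWeight_cylFourier_lt_top hfs⟩

theorem MemSobolevX.U {f : L2Cyl} {s : ℝ} (hf : MemSobolevX s f) (t : ℝ) :
    MemSobolevX s (U t f) := by
  refine lt_of_eq_of_lt (tsum_congr fun η => lintegral_congr_ae ?_) hf
  filter_upwards [enorm_cylFourier_U t f η] with ξ h
  rw [h]

theorem sign_two_pi_mul (ξ : ℝ) : Real.sign (2 * Real.pi * ξ) = Real.sign ξ := by
  have h := Real.two_pi_pos
  rcases lt_trichotomy ξ 0 with h1 | h1 | h1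
  · rw [Real.sign_of_neg h1, Real.sign_of_neg (mul_neg_of_pos_of_neg h h1)]
  · simp [h1]
  · rw [Real.sign_of_pos h1, Real.sign_of_pos (mul_pos h h1)]

/-- The symbol `e^{itω(2πξ, η)}` of `U t` in the frequency variable of Mathlib. -/
noncomputable def phase (t : ℝ) (η : ℤ) (ξ : ℝ) : ℂ :=
  Complex.exp (Complex.I * ((t * omega (2 * Real.pi * ξ) η : ℝ) : ℂ))

theorem norm_phase (t : ℝ) (η : ℤ) (ξ : ℝ) : ‖phase t η ξ‖ = 1 := by
  rw [phase, mul_comm, Complex.norm_exp_ofReal_mul_I]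

theorem cylFourier_U (t : ℝ) (f : L2Cyl) (η : ℤ) :
    cylFourier (U t f) η =ᵐ[volume] fun ξ => phase t η ξ * cylFourier f η ξ :=
  cylFourier_multiplier _ (measurable_expOmega t) (norm_expOmega t) f η

theorem cylFourier_hilbertX (f : L2Cyl) (η : ℤ) :
    cylFourier (hilbertX f) η =ᵐ[volume]
      fun ξ => -Complex.I * (((Real.sign ξ : ℝ) : ℂ) * cylFourier f η ξ) := by
  filter_upwards [cylFourier_multiplier _ (fun _ => measurable_hilbertSymbol)
    (fun ξ _ => norm_hilbertSymbol ξ) f η] with ξ h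
  rw [hilbertX, h, sign_two_pi_mul, mul_assoc]

/-- The value of a comes from it(2πξ)² = aξ²/2. The η-part of the symbol is constant on the
half-line and goes into the prefactor, so a is the same for all modes. -/
theorem phase_eq_gauss_of_pos (t : ℝ) (η : ℤ) {ξ : ℝ} (hξ : 0 < ξ) :
    phase t η ξ = gauss (Complex.exp (Complex.I * t * η ^ 2))
      (8 * Real.pi ^ 2 * Complex.I * t) ξ := by
  rw [phase, gauss, omega, Real.sign_of_pos (mul_pos Real.two_pi_pos hξ), ← Complex.exp_add]
  congr 1
  push_cast
  ring

theorem phase_eq_gauss_of_neg (t : ℝ) (η : ℤ) {ξ : ℝ} (hξ : ξ < 0) :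
    phase t η ξ = gauss (Complex.exp (-(Complex.I * t * η ^ 2)))
      (-(8 * Real.pi ^ 2 * Complex.I * t)) ξ := by
  rw [phase, gauss, omega, Real.sign_of_neg (mul_neg_of_pos_of_neg Real.two_pi_pos hξ),
    ← Complex.exp_add]
  congr 1
  push_cast
  ring

/-! ### The Hilbert transform and the weight `|x|` -/

theorem tsum_gagliardo_const_mul_lt_top_iff {G : ℤ → ℝ → ℂ} (hG : ∀ η, Measurable (G η)) {c : ℂ}
    (hc : c ≠ 0) :
    ∑' η, gagliardo (fun ξ => c * G η ξ) < ⊤ ↔ ∑' η, gagliardo (G η) < ⊤ := by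
  refine ⟨fun h => ?_, fun h => tsum_gagliardo_const_mul_lt_top hG h c⟩
  have h1 := tsum_gagliardo_const_mul_lt_top (fun η => (hG η).const_mul c) h c⁻¹
  simpa only [inv_mul_cancel_left₀ hc] using h1

theorem memLp_hilbertX_iff {g : L2Cyl} (hg : MemLp g 2 (weight (1 / 2))) :
    MemLp (hilbertX g) 2 (weight (1 / 2)) ↔ ∑' η, hardyIntegral (cylFourier g η) < ⊤ := by
  have hm : ∀ η, Measurable (cylFourier g η) := fun η => measurable_coe_Lp _
  rw [memLp_weight_half_iff] at hg ⊢
  have hs : ∀ η, Measurable fun ξ : ℝ => ((Real.sign ξ : ℝ) : ℂ) * cylFourier g η ξ := fun η => by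
    have := measurable_sign
    have := hm η
    fun_prop
  rw [← tsum_gagliardo_sign_mul_lt_top_iff hm hg,
    ← tsum_gagliardo_const_mul_lt_top_iff hs (neg_ne_zero.mpr Complex.I_ne_zero)]
  exact iff_of_eq
    (congrArg (· < ⊤) (tsum_congr fun η => gagliardo_congr (cylFourier_hilbertX g η)))

/-- Multipliers commute, so both sides ask whether a Hilbert transform lies in L²(|x|), of U(t)g and
of g respectively. The criterion depends only on the modulus of the transform, which U(t) preserves.
-/
theorem memLp_U_hilbertX_iff {g : L2Cyl} {t : ℝ} (hg : MemLp g 2 (weight (1 / 2)))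
    (hUg : MemLp (U t g) 2 (weight (1 / 2))) :
    MemLp (U t (hilbertX g)) 2 (weight (1 / 2)) ↔ MemLp (hilbertX g) 2 (weight (1 / 2)) := by
  have h1 : MemLp (U t (hilbertX g)) 2 (weight (1 / 2)) ↔
      MemLp (hilbertX (U t g)) 2 (weight (1 / 2)) := by
    rw [memLp_weight_half_iff, memLp_weight_half_iff]
    refine iff_of_eq (congrArg (· < ⊤) (tsum_congr fun η => gagliardo_congr ?_))
    filter_upwards [cylFourier_U t (hilbertX g) η, cylFourier_hilbertX g η,
      cylFourier_hilbertX (U t g) η, cylFourier_U t g η] with ξ h1 h2 h3 h4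
    rw [h1, h2, h3, h4]
    ring
  rw [h1, memLp_hilbertX_iff hUg, memLp_hilbertX_iff hg]
  refine iff_of_eq (congrArg (· < ⊤) (tsum_congr fun η => hardyIntegral_congr ?_))
  filter_upwards [cylFourier_U t g η] with ξ h
  rw [h, norm_mul, norm_phase, one_mul]

/-! ### The derivatives of the Fourier transform of `f` and of `U t f` -/

theorem BiWeighted.exists_derivSeq {k : ℕ} {p : ℤ → L2Line} (hp : BiWeighted (2 * k + 1) p) :
    ∃ A : ℤ → ℕ → ℝ → ℂ, (∀ η, DerivSeq k (A η)) ∧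
      (∀ l ≤ k, FreqBiWeighted (2 * (k - l) + 1) fun η => A η l) ∧
      (∀ η, ∀ l ≤ k, ∀ q : L2Line,
        q =ᵐ[volume] (fun x => (-2 * Real.pi * Complex.I * x) ^ l * p η x) →
        (𝓕 q : L2Line) =ᵐ[volume] A η l) ∧
      ∀ η, ∀ l < k, A η l 0 = ∫ x : ℝ, (-2 * Real.pi * Complex.I * x) ^ l * p η x := by
  choose A h1 h2 h3 using fun η => Cylinder.exists_derivSeq k (p η)
    ((polyWeight_mono (by omega) _).trans_lt ((ENNReal.le_tsum η).trans_lt hp.position))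
  refine ⟨A, h1, fun l hl => ?_, h2, h3⟩
  obtain ⟨q, hq, hqe⟩ := hp.exists_position_pow_mul (-2 * Real.pi * Complex.I) hl
  exact ⟨q, hq, fun η => h2 η l hl (q η) (hqe η)⟩

theorem coeffL2_powX (k : ℕ) (f : L2Cyl) (hf : MemLp f 2 (weight ((k : ℝ) + 1 / 2))) (η : ℤ) :
    coeffL2 (powX k f hf) η =ᵐ[volume] fun x => (x : ℂ) ^ k * coeffL2 f η x := by
  have h1 : ∀ᵐ p : Cyl ∂((volume : Measure ℝ).prod volume), powX k f hf p = (p.1 : ℂ) ^ k * f p :=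
    (memLp_powX k f hf).coeFn_toLp
  filter_upwards [coe_coeffL2 (powX k f hf) η, coe_coeffL2 f η, Measure.ae_ae_of_ae_prod h1]
    with x h2 h3 h4
  rw [h2, h3, yCoeff, yCoeff, ← integral_const_mul]
  refine integral_congr_ae ?_
  filter_upwards [h4] with y hy
  rw [hy]
  ring

theorem phase_neg_mul_phase (t : ℝ) (η : ℤ) (ξ : ℝ) : phase (-t) η ξ * phase t η ξ = 1 := by
  rw [phase, phase, ← Complex.exp_add, ← Complex.exp_zero]
  congr 1
  push_cast
  ring

/-! ### Powers of x, the group, and moments. -/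

section Profile

variable {k : ℕ} {f : L2Cyl}

theorem cylFourier_powX_of_derivSeq (hfw : MemLp f 2 (weight ((k : ℝ) + 1 / 2))) {η : ℤ}
    {A : ℝ → ℂ} (hA : ∀ q : L2Line,
        q =ᵐ[volume] (fun x => (-2 * Real.pi * Complex.I * x) ^ k * coeffL2 f η x) →
        (𝓕 q : L2Line) =ᵐ[volume] A) :
    ∀ᵐ ξ, (-2 * Real.pi * Complex.I) ^ k * cylFourier (powX k f hfw) η ξ = A ξ := by
  have h1 := hA (((-2 * Real.pi * Complex.I) ^ k : ℂ) • coeffL2 (powX k f hfw) η) (by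
    filter_upwards [coeffL2_powX k f hfw η,
      Lp.coeFn_smul ((-2 * Real.pi * Complex.I) ^ k : ℂ) (coeffL2 (powX k f hfw) η)] with x h2 h3
    rw [h3, Pi.smul_apply, h2, smul_eq_mul]
    ring)
  rw [FourierSMul.fourier_smul] at h1
  filter_upwards [h1, Lp.coeFn_smul ((-2 * Real.pi * Complex.I) ^ k : ℂ)
    (𝓕 (coeffL2 (powX k f hfw) η) : L2Line)] with ξ h2 h3
  rw [← h2, h3, Pi.smul_apply, smul_eq_mul]
  rfl

theorem neg_two_pi_I_pow_ne_zero (k : ℕ) : ((-2 * Real.pi * Complex.I) ^ k : ℂ) ≠ 0 := by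
  simp [Real.pi_ne_zero]

theorem memLp_powX_weight_half (hfs : MemSobolevX ((k : ℝ) + 1 / 2) f)
    (hfw : MemLp f 2 (weight ((k : ℝ) + 1 / 2))) :
    MemLp (powX k f hfw) 2 (weight (1 / 2)) := by
  obtain ⟨A, -, h2, h3, -⟩ := (biWeighted_coeffL2 hfs hfw).exists_derivSeq
  rw [memLp_weight_half_iff, ← tsum_gagliardo_const_mul_lt_top_iff (fun η => measurable_coe_Lp _)
    (neg_two_pi_I_pow_ne_zero k)]
  simp_rw [fun η => gagliardo_congr (cylFourier_powX_of_derivSeq hfw (h3 η k le_rfl))]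
  exact (h2 k le_rfl).tsum_gagliardo_lt_top (by omega)

/-- The expansion is made around U(t)f: the group preserves the Sobolev norm, so the weighted bound
on U(t)f gives B all its regularity. The sequence A of f serves for the matching at 0 and for
reading off the moments. -/
theorem exists_profile (hfs : MemSobolevX ((k : ℝ) + 1 / 2) f)
    (hfw : MemLp f 2 (weight ((k : ℝ) + 1 / 2))) {t : ℝ} (ht : t ≠ 0)
    (hU : MemLp (U t f) 2 (weight ((k : ℝ) + 1 / 2))) :
    ∃ (a : ℂ) (B : ℤ → ℕ → ℝ → ℂ), a ≠ 0 ∧ (∀ η, DerivSeq k (B η)) ∧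
      (∀ l ≤ k, FreqBiWeighted (2 * (k - l) + 1) fun η => B η l) ∧
      (MemLp (U t (powX k f hfw)) 2 (weight (1 / 2)) ↔
        ∑' η, hardyIntegral (leibnizDefect a (B η) k) < ⊤) ∧
      (∀ η l, l + 2 < k → B η l 0 = 0) ∧
      (∀ η l, l + 2 = k → (B η l 0 = 0 ↔ ∫ x : ℝ, (x : ℂ) ^ l * coeffL2 f η x = 0)) := by
  obtain ⟨A, hA, -, hA3, hA4⟩ := (biWeighted_coeffL2 hfs hfw).exists_derivSeq
  obtain ⟨B, hB, hB2, hB3, -⟩ := (biWeighted_coeffL2 (hfs.U t) hU).exists_derivSeq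
  -- The time is -t because the transform of f is recovered from that of U(t)f by the inverse phase.
  set a : ℂ := 8 * Real.pi ^ 2 * Complex.I * (-t : ℝ) with ha
  have ha0 : a ≠ 0 := by simp [ha, ht, Real.pi_ne_zero]
  have hAB : ∀ η, ∀ᵐ ξ, A η 0 ξ = phase (-t) η ξ * B η 0 ξ := fun η => by
    have h1 : (𝓕 (coeffL2 f η) : L2Line) =ᵐ[volume] A η 0 :=
      hA3 η 0 (Nat.zero_le _) _ (by simp)
    have h2 : (𝓕 (coeffL2 (U t f) η) : L2Line) =ᵐ[volume] B η 0 :=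
      hB3 η 0 (Nat.zero_le _) _ (by simp)
    filter_upwards [h1, h2, cylFourier_U t f η] with ξ h3 h4 h5
    have h6 : (𝓕 (coeffL2 (U t f) η) : L2Line) ξ =
      phase t η ξ * (𝓕 (coeffL2 f η) : L2Line) ξ := h5
    rw [← h3, ← h4, h6, ← mul_assoc, phase_neg_mul_phase, one_mul]
  have hpos : ∀ η, ∀ᵐ ξ, ξ ∈ Set.Ioi (0 : ℝ) → A η 0 ξ =
      gauss (Complex.exp (Complex.I * (-t : ℝ) * η ^ 2)) a ξ * B η 0 ξ := fun η => by
    filter_upwards [hAB η] with ξ h hξ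
    rw [h, phase_eq_gauss_of_pos _ _ hξ]
  have hneg : ∀ η, ∀ᵐ ξ, ξ ∈ Set.Iio (0 : ℝ) → A η 0 ξ =
      gauss (Complex.exp (-(Complex.I * (-t : ℝ) * η ^ 2))) (-a) ξ * B η 0 ξ := fun η => by
    filter_upwards [hAB η] with ξ h hξ
    rw [h, phase_eq_gauss_of_neg _ _ hξ]
  refine ⟨a, B, ha0, hB, hB2, ?_, fun η l hl => ?_, fun η l hl => ?_⟩
  -- The phase at time t cancels the Gaussian in the Leibniz formula for A_k, leaving the bare
  -- Leibniz sum on each half-line.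
  · have hY : ∀ η, ∀ᵐ ξ, (-2 * Real.pi * Complex.I) ^ k * cylFourier (U t (powX k f hfw)) η ξ =
        phase t η ξ * A η k ξ := fun η => by
      filter_upwards [cylFourier_U t (powX k f hfw) η,
        cylFourier_powX_of_derivSeq hfw (hA3 η k le_rfl)] with ξ h1 h2
      rw [h1, ← h2]
      ring
    rw [memLp_weight_half_iff, ← tsum_gagliardo_const_mul_lt_top_iff
      (fun η => measurable_coe_Lp _) (neg_two_pi_I_pow_ne_zero k)]
    refine tsum_gagliardo_glued_iff hB hB2 (fun η => ?_) (fun η => ?_)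
    · filter_upwards [hY η, (hA η).ae_eq_gaussLeibniz (hB η) isOpen_Ioi (hpos η)] with ξ h1 h2 hξ
      rw [h1, h2 hξ, ← phase_eq_gauss_of_pos _ _ hξ, ← mul_assoc, mul_comm (phase t η ξ),
        phase_neg_mul_phase, one_mul]
    · filter_upwards [hY η, (hA η).ae_eq_gaussLeibniz (hB η) isOpen_Iio (hneg η)] with ξ h1 h2 hξ
      rw [h1, h2 hξ, ← phase_eq_gauss_of_neg _ _ hξ, ← mul_assoc, mul_comm (phase t η ξ),
        phase_neg_mul_phase, one_mul]
  · exact (hA η).apply_zero_eq_zero (hB η) (hpos η) (hneg η) (Complex.exp_ne_zero _) ha0 hl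
  · rw [← (hA η).apply_zero_eq_zero_iff (hB η) (hpos η) (hneg η) (Complex.exp_ne_zero _) ha0 hl,
      hA4 η l (by omega)]
    have h1 : ∫ x : ℝ, (-2 * Real.pi * Complex.I * x) ^ l * coeffL2 f η x =
        (-2 * Real.pi * Complex.I) ^ l * ∫ x : ℝ, (x : ℂ) ^ l * coeffL2 f η x := by
      rw [← integral_const_mul]
      exact integral_congr_ae (Filter.Eventually.of_forall fun x => by ring)
    rw [h1, mul_eq_zero, or_iff_right (neg_two_pi_I_pow_ne_zero l)]

theorem memLp_U_powX_of_le_one (hk : k ≤ 1) (hfs : MemSobolevX ((k : ℝ) + 1 / 2) f)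
    (hfw : MemLp f 2 (weight ((k : ℝ) + 1 / 2))) {t : ℝ} (ht : t ≠ 0)
    (hU : MemLp (U t f) 2 (weight ((k : ℝ) + 1 / 2))) :
    MemLp (U t (powX k f hfw)) 2 (weight (1 / 2)) := by
  obtain ⟨a, B, -, -, -, h, -, -⟩ := exists_profile hfs hfw ht hU
  rw [h]
  simp [hardyIntegral, leibnizDefect_eq_zero _ _ hk]

theorem memLp_U_powX_iff {m : ℕ} (hfs : MemSobolevX (((m + 2 : ℕ) : ℝ) + 1 / 2) f)
    (hfw : MemLp f 2 (weight (((m + 2 : ℕ) : ℝ) + 1 / 2))) {t : ℝ} (ht : t ≠ 0)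
    (hU : MemLp (U t f) 2 (weight (((m + 2 : ℕ) : ℝ) + 1 / 2))) :
    MemLp (U t (powX (m + 2) f hfw)) 2 (weight (1 / 2)) ↔
      ∀ η, ∫ x : ℝ, (x : ℂ) ^ m * coeffL2 f η x = 0 := by
  obtain ⟨a, B, ha, hB, hB2, h, h0, h1⟩ := exists_profile hfs hfw ht hU
  rw [h, tsum_hardyIntegral_leibnizDefect_iff hB hB2 ha fun η l hl => h0 η l (by omega)]
  exact forall_congr' fun η => h1 η m rfl

/-- Cauchy-Schwarz with (1 + x²)^{-1}, which is in L² of the cylinder because the circle has finite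
measure; the two spare powers of x pay for 1 + x². -/
theorem integrable_pow_mul_cyl {m : ℕ} (hfw : MemLp f 2 (weight (((m + 2 : ℕ) : ℝ) + 1 / 2))) :
    Integrable (fun p : Cyl => (p.1 : ℂ) ^ m * f p) := by
  have hm : Measurable f := (Lp.stronglyMeasurable f).measurable
  have h1 : MemLp (fun x : ℝ => (((1 + x ^ 2)⁻¹ : ℝ) : ℂ)) 2 volume := by
    have hmeas : Measurable fun x : ℝ => (((1 + x ^ 2)⁻¹ : ℝ) : ℂ) := by fun_prop
    rw [memLp_two_iff_integrable_sq_norm hmeas.aestronglyMeasurable]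
    refine integrable_inv_one_add_sq.mono' (by fun_prop) (Filter.Eventually.of_forall fun x => ?_)
    have h2 : 0 < (1 + x ^ 2)⁻¹ := by positivity
    have h3 : (1 + x ^ 2)⁻¹ ≤ 1 := inv_le_one_of_one_le₀ (by nlinarith [sq_nonneg x])
    rw [Complex.norm_real, Real.norm_of_nonneg h2.le, Real.norm_of_nonneg (by positivity)]
    nlinarith
  have h2 : MemLp (fun p : Cyl => (((1 + p.1 ^ 2)⁻¹ : ℝ) : ℂ)) 2 (volume : Measure Cyl) :=
    h1.comp_fst (volume : Measure (AddCircle (2 * Real.pi)))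
  have h3 : MemLp (fun p : Cyl => ((1 + p.1 ^ 2 : ℝ) : ℂ) * ((p.1 : ℂ) ^ m * f p)) 2
      (volume : Measure Cyl) := by
    refine MemLp.of_le ((Lp.memLp f).norm.add ((memLp_powX _ f hfw).norm.const_mul 2))
      (by fun_prop) (Filter.Eventually.of_forall fun p => ?_)
    have h4 : |p.1| ^ m ≤ 1 + |p.1| ^ (m + 2) := by
      rcases le_total |p.1| 1 with h | h
      · have := pow_le_one₀ (n := m) (abs_nonneg p.1) h
        have : 0 ≤ |p.1| ^ (m + 2) := by positivity
        linarith
      · have := pow_le_pow_right₀ h (show m ≤ m + 2 by omega)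
        linarith
    have h5 : (1 + p.1 ^ 2) * |p.1| ^ m ≤ 1 + 2 * |p.1| ^ (m + 2) := by
      have : p.1 ^ 2 * |p.1| ^ m = |p.1| ^ (m + 2) := by rw [← sq_abs]; ring
      linarith
    rw [norm_mul, norm_mul, norm_pow, Complex.norm_real, Complex.norm_real, Real.norm_eq_abs p.1,
      Real.norm_of_nonneg (by positivity : (0 : ℝ) ≤ 1 + p.1 ^ 2), Pi.add_apply, norm_mul, norm_pow,
      Complex.norm_real, Real.norm_eq_abs p.1, Real.norm_of_nonneg (by positivity)]
    calc _ = ((1 + p.1 ^ 2) * |p.1| ^ m) * ‖f p‖ := by ring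
      _ ≤ (1 + 2 * |p.1| ^ (m + 2)) * ‖f p‖ := by gcongr
      _ = _ := by ring
  refine (h2.integrable_mul h3).congr (Filter.Eventually.of_forall fun p => ?_)
  have h4 : ((1 + p.1 ^ 2 : ℝ) : ℂ) ≠ 0 := by
    exact_mod_cast (by positivity : (0 : ℝ) < 1 + p.1 ^ 2).ne'
  simp only [Pi.mul_apply]
  rw [Complex.ofReal_inv, inv_mul_cancel_left₀ h4]

theorem integral_pow_mul_coeffL2 {m : ℕ}
    (hf : Integrable (fun p : Cyl => (p.1 : ℂ) ^ m * f p)) (η : ℤ) :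
    ∫ x : ℝ, (x : ℂ) ^ m * coeffL2 f η x = ∫ y : AddCircle (2 * Real.pi), ∫ x : ℝ,
      fourier (-η) y * (x : ℂ) ^ m * f (x, y) := by
  have h1 : Integrable (Function.uncurry fun (x : ℝ) (y : AddCircle (2 * Real.pi)) =>
      fourier (-η) y * (x : ℂ) ^ m * f (x, y)) ((volume : Measure ℝ).prod volume) := by
    refine (hf.bdd_mul (c := 1) (f := fun p : Cyl => (fourier (-η) p.2 : ℂ))
      ((fourier (-η)).continuous.comp continuous_snd).aestronglyMeasurable
      (Filter.Eventually.of_forall fun p => ?_)).congr (Filter.Eventually.of_forall fun p => ?_)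
    · rw [fourier_apply, Circle.norm_coe]
    · exact (mul_assoc _ _ _).symm
  rw [← integral_integral_swap h1]
  refine integral_congr_ae ?_
  filter_upwards [coe_coeffL2 f η] with x hx
  rw [hx, yCoeff, ← integral_const_mul]
  refine integral_congr_ae (Filter.Eventually.of_forall fun y => ?_)
  ring

end Profile

end Cylinder

theorem corollary1p3 (k : ℕ) (f : L2Cyl)
    (hfs : MemSobolevX ((k : ℝ) + 1 / 2) f)
    (hfw : MemLp f 2 (weight ((k : ℝ) + 1 / 2)))
    (t : ℝ) (ht : t ≠ 0)
    (hU : MemLp (U t f) 2 (weight ((k : ℝ) + 1 / 2))) :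
    ((k = 0 ∨ k = 1) →
      (MemLp (U t (hilbertX (powX k f hfw))) 2 (weight (1 / 2)) ↔
        MemLp (hilbertX (powX k f hfw)) 2 (weight (1 / 2)))) ∧
    (2 ≤ k →
      Integrable (fun p : Cyl => (p.1 : ℂ) ^ (k - 2) * f p) ∧
      (MemLp (U t (powX k f hfw)) 2 (weight (1 / 2)) ↔
        ∀ η : ℤ, (∫ y : AddCircle (2 * Real.pi), ∫ x : ℝ,
          fourier (-η) y * (x : ℂ) ^ (k - 2) * f (x, y)) = 0) ∧
      ((MemLp (U t (powX k f hfw)) 2 (weight (1 / 2)) ∨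
        ∀ η : ℤ, (∫ y : AddCircle (2 * Real.pi), ∫ x : ℝ,
          fourier (-η) y * (x : ℂ) ^ (k - 2) * f (x, y)) = 0) →
        (MemLp (U t (hilbertX (powX k f hfw))) 2 (weight (1 / 2)) ↔
          MemLp (hilbertX (powX k f hfw)) 2 (weight (1 / 2))))) := by
  have hg := memLp_powX_weight_half hfs hfw
  refine ⟨fun hk => memLp_U_hilbertX_iff hg (memLp_U_powX_of_le_one (by omega) hfs hfw ht hU),
    fun hk => ?_⟩
  obtain ⟨m, rfl⟩ : ∃ m, k = m + 2 := ⟨k - 2, by omega⟩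
  have hint := integrable_pow_mul_cyl hfw
  have hiff := memLp_U_powX_iff hfs hfw ht hU
  simp_rw [integral_pow_mul_coeffL2 hint] at hiff
  rw [Nat.add_sub_cancel]
  -- Either alternative supplies U(t)(x^k f) in L²(|x|), the one missing input for the Hilbert
  -- transform equivalence.
  exact ⟨hint, hiff, fun h => memLp_U_hilbertX_iff hg (h.elim id hiff.mpr)⟩
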